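/- **Setting.** Fix $m_0,\bar m_1,\bar m_2,\bar m_3>0$. For $\mu>0$ let three bodies of masses $m_i=\mu\bar m_i$ move in the plane around a body of mass $m_0$; let $q_i\in\mathbb R^2$ be their positions relative to that body and $\mu p_i$ their (canonical) momenta. In each of the following two models the Hamiltonian, divided by $\mu$, is $F=F_{Kep}+F_{pert}$ on the phase space of points $(q,p)$ with $q_i\neq0$ and $q_i\ne q_j$ for $i\neq j$, with the symplectic form $\sum_i dp_i\wedge dq_i$: * fixed centre ($1+3$-body problem): $F_{Kep}=\sum_i\big(\frac{\|p_i\|^2}{2\bar m_i}-\frac{m_0\bar m_i}{\|q_i\|}\big)$, $F_{pert}=-\mu\sum_{i<j}\frac{\bar m_i\bar m_j}{\|q_i-q_j\|}$; set $\mu_i=\bar m_i$, $M_i=m_0$; * $4$-body problem with zero total momentum: $F_{Kep}=\sum_i\big(\frac{\|p_i\|^2}{2}\big(\frac1{\bar m_i}+\frac{\mu}{m_0}\big)-\frac{m_0\bar m_i}{\|q_i\|}\big)$, $F_{pert}=\mu\sum_{i<j}\big(\frac{p_i\cdot p_j}{m_0}-\frac{\bar m_i\bar m_j}{\|q_i-q_j\|}\big)$;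 set $\mu_i=\frac{m_0\bar m_i}{m_0+\mu\bar m_i}$, $M_i=m_0+\mu\bar m_i$. Let $a_i,e_i,l_i,g_i$ be the semi-major axes, eccentricities, mean anomalies and arguments of pericentre of the (direct, non-circular) elliptic motions of $F_{Kep}$, and $L_i=\mu_i\sqrt{M_ia_i}$, $G_i=L_i\sqrt{1-e_i^2}$. We use the coordinates $(D,\delta,Z,\eta)$ with $D_1=L_1$, $D_2=2L_1+L_2$, $D_3=4L_1+2L_2+L_3$, $\delta_1=l_1-2l_2$, $\delta_2=l_2-2l_3$, $\delta_3=l_3$, $Z_1=G_1$, $Z_2=G_1+G_2$, $Z_3=G_1+G_2+G_3$, $\eta_1=g_1-g_2$, $\eta_2=g_2-g_3$, $\eta_3=g_3$, and write $\langle f\rangle_{\delta_3}=\frac1{2\pi}\int_0^{2\pi}f\,d\delta_3$. Fix $0<e^\wedge<1$, $\nu>0$ and $C_1>0$. For $\mu\ge0$ let $D^0=D^0(\mu)$ be such that on $\{D=D^0\}$ the Keplerian frequencies of $l_1,l_2,l_3$ are $4\nu,2\nu,\nu$. Let $\tilde{\mathcal P}$ be given by $$0<e_i<e^\wedge\ (i=1,2,3),\qquad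 0<a_1<a_2<a_3,\qquad \frac{a_1(1+e^\wedge)}{a_2(1-e^\wedge)}<1,\qquad \frac{a_2(1+e^\wedge)}{a_3(1-e^\wedge)}<1,$$ and assume that the semi-major axes belonging to $\mu=0$, $D=D^0(0)$ satisfy these conditions on $a_1,a_2,a_3$. Let $\tilde N=\tilde N_\mu$ be the set of points of $\tilde{\mathcal P}$ with $\max_i|D_i-D_i^0(\mu)|<C_1\mu$. Let $F_{res}$ be the truncation at first order in the eccentricities of $\langle F_{pert}\rangle_{\delta_3}$, i.e. the sum of the terms of order $0$ and $1$ of its Taylor expansion at $(e_1,e_2,e_3)=0$, with $D,\delta,\eta$ fixed. **Proposition.** In both models there are $\mu_0>0$ and $C>0$ such that for every $0<\mu<\mu_0$ there is an injective, real-analytic, symplectic map $\phi=\phi_\mu$ from $\tilde N_\mu$ (seen in the phase space) to the phase space such that $$\phi^*F=F_{Kep}+F_{res}+F_{rem}\quad\text{on }\tilde N_\mu,$$ where $F_{res}$ and $F_{rem}$ are analytic on $\tilde N_\mu$, $F_{res}=\langle F_{res}\rangle_{\delta_3}$, and $$|F_{rem}|\le C(\mu e^2+\mu^2),\qquad e=\max_i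 e_i .$$ Moreover $\phi_\mu$ is $O(\mu)$-close to the identity: $\|\phi_\mu(z)-z\|\le C\mu$ for all $z=(q,p)$ in $\tilde N_\mu$, and for every $e_0>0$ there are $\mu_1,C'>0$ such that for $0<\mu<\mu_1$, at all points of $\tilde N_\mu$ with $e_1,e_2,e_3\ge e_0$, $\phi_\mu$ changes each of the coordinates $(D,\delta,Z,\eta)$ by at most $C'\mu$ (angles modulo $2\pi$). -/

import Mathlib

open Set MeasureTheory

noncomputable section

namespace SatelliteProblem

/-- The two planar models: three satellites attracted by a fixed centre (the `1+3`-body problem),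
or the full `4`-body problem in canonical centre-centric coordinates, with total momentum `0`. -/
inductive Model where
  | fixedCentre
  | fourBody

/-- Euclidean plane. -/
abbrev Plane := EuclideanSpace ℝ (Fin 2)

/-- Phase space: positions `z.1 i` relative to the centre, momenta `z.2 i`, for `i = 0, 1, 2`
(the first, second and third satellite). -/
abbrev PhaseSpace := (Fin 3 → Plane) × (Fin 3 → Plane)

/-- The universal cover `ℝ⁶ × ℝ⁶` of `𝕋⁶ × ℝ⁶`, with coordinates `(D, δ, Z, η)` in this order.
It is also used with `e`, the eccentricities, in the place of `Z`. -/
abbrev Coords := (Fin 3 → ℝ) × (Fin 3 → ℝ) × (Fin 3 → ℝ) × (Fin 3 → ℝ)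

/-- Phase points without collision, neither with the centre nor between satellites. -/
def collisionFree : Set PhaseSpace :=
  {z | (∀ i, z.1 i ≠ 0) ∧ ∀ i j, i ≠ j → z.1 i ≠ z.1 j}

/-- The symplectic form `∑ dp_i ∧ dq_i` on tangent vectors. -/
def symplecticForm (v w : PhaseSpace) : ℝ :=
  ∑ i, (inner ℝ (v.2 i) (w.1 i) - inner ℝ (w.2 i) (v.1 i))

/-- `φ` preserves the symplectic form at all points of `N`. -/
def IsSymplecticOn (φ : PhaseSpace → PhaseSpace) (N : Set PhaseSpace) : Prop :=
  ∀ z ∈ N, ∀ v w, symplecticForm (fderiv ℝ φ z v) (fderiv ℝ φ z w) = symplecticForm v w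

/-! ### The Hamiltonians -/

/-- Keplerian part for the actual masses `m₀` (centre) and `m i` (satellites). -/
def hamKep (mod : Model) (m₀ : ℝ) (m : Fin 3 → ℝ) (z : PhaseSpace) : ℝ :=
  match mod with
  | .fixedCentre => ∑ i, (‖z.2 i‖ ^ 2 / (2 * m i) - m₀ * m i / ‖z.1 i‖)
  | .fourBody => ∑ i, (1 / 2 * ‖z.2 i‖ ^ 2 * (1 / m i + 1 / m₀) - m₀ * m i / ‖z.1 i‖)

/-- Perturbing part for the actual masses: the mutual attractions and, in the four-body problem,
the indirect part. -/
def hamPert (mod : Model) (m₀ : ℝ) (m : Fin 3 → ℝ) (z : PhaseSpace) : ℝ :=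
  match mod with
  | .fixedCentre => ∑ i, ∑ j ∈ Finset.Ioi i, -(m i * m j / ‖z.1 i - z.1 j‖)
  | .fourBody => ∑ i, ∑ j ∈ Finset.Ioi i,
      (inner ℝ (z.2 i) (z.2 j) / m₀ - m i * m j / ‖z.1 i - z.1 j‖)

/-- Rescaled Keplerian part: satellites of masses `μ * m i`, momenta `μ * p i`, Hamiltonian
divided by `μ`. -/
def FKep (mod : Model) (m₀ : ℝ) (m : Fin 3 → ℝ) (μ : ℝ) (z : PhaseSpace) : ℝ :=
  μ⁻¹ * hamKep mod m₀ (fun i => μ * m i) (z.1, fun i => μ • z.2 i)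

/-- Rescaled perturbing part. -/
def FPert (mod : Model) (m₀ : ℝ) (m : Fin 3 → ℝ) (μ : ℝ) (z : PhaseSpace) : ℝ :=
  μ⁻¹ * hamPert mod m₀ (fun i => μ * m i) (z.1, fun i => μ • z.2 i)

/-- The rescaled Hamiltonian `F = F_Kep + F_pert`. -/
def FTotal (mod : Model) (m₀ : ℝ) (m : Fin 3 → ℝ) (μ : ℝ) (z : PhaseSpace) : ℝ :=
  FKep mod m₀ m μ z + FPert mod m₀ m μ z

/-! ### Elliptic Keplerian motion -/

/-- Fictitious mass `μ_i` of the (rescaled) Kepler problem of the `i`-th satellite. -/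
def fictMass (mod : Model) (m₀ : ℝ) (m : Fin 3 → ℝ) (μ : ℝ) (i : Fin 3) : ℝ :=
  match mod with
  | .fixedCentre => m i
  | .fourBody => m₀ * m i / (m₀ + μ * m i)

/-- Central mass `M_i` of the (rescaled) Kepler problem of the `i`-th satellite. -/
def centMass (mod : Model) (m₀ : ℝ) (m : Fin 3 → ℝ) (μ : ℝ) (i : Fin 3) : ℝ :=
  match mod with
  | .fixedCentre => m₀
  | .fourBody => m₀ + μ * m i

/-- The eccentric anomaly `u`, the solution of Kepler's equation `u - e sin u = l`;
see `eccentricAnomaly_spec` and `eccentricAnomaly_unique`. -/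
def eccentricAnomaly (e l : ℝ) : ℝ :=
  Function.invFun (fun u : ℝ => u - e * Real.sin u) l

theorem kepler_strictMono {e : ℝ} (he : |e| < 1) :
    StrictMono (fun u : ℝ => u - e * Real.sin u) := by
  apply strictMono_of_deriv_pos
  intro u
  have h : HasDerivAt (fun u : ℝ => u - e * Real.sin u) (1 - e * Real.cos u) u :=
    (hasDerivAt_id u).sub ((Real.hasDerivAt_sin u).const_mul e)
  rw [h.deriv]
  have h1 : |e * Real.cos u| < 1 := by
    rw [abs_mul]
    calc |e| * |Real.cos u| ≤ |e| * 1 := by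
          gcongr
          exact Real.abs_cos_le_one u
      _ < 1 := by simpa using he
  have h2 := (abs_lt.mp h1).2
  linarith

theorem eccentricAnomaly_spec {e : ℝ} (he : |e| < 1) (l : ℝ) :
    eccentricAnomaly e l - e * Real.sin (eccentricAnomaly e l) = l := by
  have hc : Continuous (fun u : ℝ => u - e * Real.sin u) := by fun_prop
  have hb : ∀ u : ℝ, |e * Real.sin u| ≤ 1 := by
    intro u
    rw [abs_mul]
    exact mul_le_one₀ he.le (abs_nonneg _) (Real.abs_sin_le_one u)
  have hex : ∃ u : ℝ, u - e * Real.sin u = l := by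
    have h := intermediate_value_Icc (show l - 1 ≤ l + 1 by linarith) hc.continuousOn
    have h1 := abs_le.mp (hb (l - 1))
    have h2 := abs_le.mp (hb (l + 1))
    obtain ⟨u, -, hu⟩ := h (show l ∈ Icc _ _ from ⟨by linarith, by linarith⟩)
    exact ⟨u, hu⟩
  exact Function.invFun_eq (f := fun u : ℝ => u - e * Real.sin u) hex

theorem eccentricAnomaly_unique {e : ℝ} (he : |e| < 1) {l u : ℝ} (hu : u - e * Real.sin u = l) :
    u = eccentricAnomaly e l :=
  (kepler_strictMono he).injective (hu.trans (eccentricAnomaly_spec he l).symm)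

/-- Rotation by the angle `g` of the vector with coordinates `x, y`. -/
def rotated (g x y : ℝ) : Plane :=
  !₂[Real.cos g * x - Real.sin g * y, Real.sin g * x + Real.cos g * y]

/-- Position on the ellipse of semi-major axis `a` and eccentricity `e` with one focus at the
origin, at mean anomaly `l` and argument of pericentre `g`. -/
def ellipsePos (a e l g : ℝ) : Plane :=
  rotated g (a * (Real.cos (eccentricAnomaly e l) - e))
    (a * (Real.sqrt (1 - e ^ 2) * Real.sin (eccentricAnomaly e l)))

/-- Velocity of the Keplerian motion of central mass `M` at the same point. -/
def ellipseVel (M a e l g : ℝ) : Plane :=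
  (Real.sqrt (M / a) / (1 - e * Real.cos (eccentricAnomaly e l))) •
    rotated g (-Real.sin (eccentricAnomaly e l))
      (Real.sqrt (1 - e ^ 2) * Real.cos (eccentricAnomaly e l))

/-! ### Delaunay variables and the modified Delaunay coordinates -/

/-- `L` in terms of `D`, where `D₁ = L₁`, `D₂ = 2L₁ + L₂`, `D₃ = 4L₁ + 2L₂ + L₃`. -/
def circMom (D : Fin 3 → ℝ) : Fin 3 → ℝ := ![D 0, D 1 - 2 * D 0, D 2 - 2 * D 1]

/-- The mean anomalies in terms of `δ₁ = l₁ - 2l₂`, `δ₂ = l₂ - 2l₃`, `δ₃ = l₃`. -/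
def meanAnom (δ : Fin 3 → ℝ) : Fin 3 → ℝ :=
  ![δ 0 + 2 * δ 1 + 4 * δ 2, δ 1 + 2 * δ 2, δ 2]

/-- `G` in terms of `Z₁ = G₁`, `Z₂ = G₁ + G₂`, `Z₃ = G₁ + G₂ + G₃`. -/
def angMom (Z : Fin 3 → ℝ) : Fin 3 → ℝ := ![Z 0, Z 1 - Z 0, Z 2 - Z 1]

/-- The arguments of pericentre in terms of `η₁ = g₁ - g₂`, `η₂ = g₂ - g₃`, `η₃ = g₃`. -/
def argPeri (η : Fin 3 → ℝ) : Fin 3 → ℝ := ![η 0 + η 1 + η 2, η 1 + η 2, η 2]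

/-- Semi-major axes, from `L_i = μ_i √M_i √a_i`. -/
def semiMajor (mod : Model) (m₀ : ℝ) (m : Fin 3 → ℝ) (μ : ℝ) (D : Fin 3 → ℝ) (i : Fin 3) : ℝ :=
  (circMom D i / fictMass mod m₀ m μ i) ^ 2 / centMass mod m₀ m μ i

/-- Eccentricities, from `G_i = L_i √(1 - e_i²)`. -/
def ecc (D Z : Fin 3 → ℝ) (i : Fin 3) : ℝ := Real.sqrt (1 - (angMom Z i / circMom D i) ^ 2)

/-- Keplerian frequency of the mean anomaly `l_i`. -/
def meanMotion (mod : Model) (m₀ : ℝ) (m : Fin 3 → ℝ) (μ : ℝ) (D : Fin 3 → ℝ) (i : Fin 3) : ℝ :=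
  Real.sqrt (centMass mod m₀ m μ i / semiMajor mod m₀ m μ D i ^ 3)

/-- The phase point with given `(D, δ, e, η)`. -/
def ofElements (mod : Model) (m₀ : ℝ) (m : Fin 3 → ℝ) (μ : ℝ) (y : Coords) : PhaseSpace :=
  (fun i => ellipsePos (semiMajor mod m₀ m μ y.1 i) (y.2.2.1 i) (meanAnom y.2.1 i)
      (argPeri y.2.2.2 i),
   fun i => fictMass mod m₀ m μ i •
      ellipseVel (centMass mod m₀ m μ i) (semiMajor mod m₀ m μ y.1 i) (y.2.2.1 i)
        (meanAnom y.2.1 i) (argPeri y.2.2.2 i))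

/-- The phase point with modified Delaunay coordinates `(D, δ, Z, η)`. -/
def ofDelaunay (mod : Model) (m₀ : ℝ) (m : Fin 3 → ℝ) (μ : ℝ) (x : Coords) : PhaseSpace :=
  ofElements mod m₀ m μ (x.1, x.2.1, ecc x.1 x.2.2.1, x.2.2.2)

/-- Values of the coordinates that belong to direct, non-circular elliptic motions. -/
def delaunayDomain : Set Coords :=
  {x | ∀ i, 0 < angMom x.2.2.1 i ∧ angMom x.2.2.1 i < circMom x.1 i}

/-- The conditions on the semi-major axes that keep the ellipses of eccentricity less than `E`
away from each other. -/
def Separated (E : ℝ) (a : Fin 3 → ℝ) : Prop :=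
  0 < a 0 ∧ a 0 < a 1 ∧ a 1 < a 2 ∧
    a 0 * (1 + E) / (a 1 * (1 - E)) < 1 ∧ a 1 * (1 + E) / (a 2 * (1 - E)) < 1

/-- The domain `0 < e_i < E` with separated ellipses, in modified Delaunay coordinates. -/
def ellipticRegion (mod : Model) (m₀ : ℝ) (m : Fin 3 → ℝ) (μ E : ℝ) : Set Coords :=
  {x | x ∈ delaunayDomain ∧ (∀ i, ecc x.1 x.2.2.1 i < E) ∧ Separated E (semiMajor mod m₀ m μ x.1)}

/-- The tori `D = D⁰` are `4:2:1`-resonant, `ν` being the Keplerian frequency of the third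
satellite. -/
def IsResonant (mod : Model) (m₀ : ℝ) (m : Fin 3 → ℝ) (μ ν : ℝ) (D : Fin 3 → ℝ) : Prop :=
  (∀ i, 0 < circMom D i) ∧ meanMotion mod m₀ m μ D 0 = 4 * ν ∧
    meanMotion mod m₀ m μ D 1 = 2 * ν ∧ meanMotion mod m₀ m μ D 2 = ν

/-- The points of the domain at distance less than `r` from `D = D⁰`. -/
def resonantNhd (mod : Model) (m₀ : ℝ) (m : Fin 3 → ℝ) (μ E : ℝ) (D₀ : Fin 3 → ℝ) (r : ℝ) :
    Set Coords :=
  {x | x ∈ ellipticRegion mod m₀ m μ E ∧ ‖x.1 - D₀‖ < r}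

/-! ### Averaging and truncation -/

/-- The average over the angle `δ₃`. -/
def avgδ₃ (f : Coords → ℝ) (x : Coords) : ℝ :=
  1 / (2 * Real.pi) *
    ∫ t in (0 : ℝ)..(2 * Real.pi), f (x.1, Function.update x.2.1 2 t, x.2.2)

/-- The truncation at first order in the eccentricities of a function of `(D, δ, e, η)`:
the terms of order `0` and `1` of its Taylor expansion at `e = 0`. -/
def truncEcc (f : Coords → ℝ) (y : Coords) : ℝ :=
  f (y.1, y.2.1, 0, y.2.2.2) +
    fderiv ℝ (fun e : Fin 3 → ℝ => f (y.1, y.2.1, e, y.2.2.2)) 0 y.2.2.1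

/-- `F_res` as a function of `(D, δ, Z, η)`: the truncation at first order in the eccentricities
of the average of `F_pert` over `δ₃`. The eccentricities depend on `D` and `Z` only, so that
averaging with `Z` fixed is averaging with `e` fixed. -/
def FRes (mod : Model) (m₀ : ℝ) (m : Fin 3 → ℝ) (μ : ℝ) (x : Coords) : ℝ :=
  truncEcc (avgδ₃ (fun y => FPert mod m₀ m μ (ofElements mod m₀ m μ y)))
    (x.1, x.2.1, ecc x.1 x.2.2.1, x.2.2.2)

end SatelliteProblem

end

open SatelliteProblem

/-!
The proof is one step of averaging along the resonant Keplerian flow.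

Write `F = K + μ f`, with `K = keplerHam` and `f = hamPert`. On the tori `D = D⁰` the Keplerian
motion is periodic: it is `ν` times the generator of the circle action `resonantFlow`, which
translates `δ₃`, and the two fields differ by `O(μ)` on `Ñ`
(`exists_abs_meanMotion_ratio_le`). The function
`averagingHam (z) = (2π)⁻¹ ∫ (t - π) f (T_t z) dt`, where `T_t` is this action, has the derivative
`f - ⟨f⟩` along the action (`hasDerivAt_averagingHam_advance`). So a symplectic map `φ` that is
close to the time-`μ` flow of `averagingHam / ν` removes the oscillating part:
`F ∘ φ = K + μ ⟨f⟩ + O(μ²)`. Taylor's formula in the eccentricities replaces `μ ⟨f⟩` by `F_res` with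
an error `O(μ e²)` (`exists_abs_avgPert_sub_truncPert_le`).

The flow is replaced by the implicit midpoint map (`exists_midpointMap`), which is symplectic,
injective, and analytic wherever its Hamiltonian is; it is built by the inverse function theorem, so
that no theory of analytic differential equations is needed. The estimates are uniform because all
functions are first replaced by smooth functions of compact support that coincide with them near
the compact set of resonant ellipses at `μ = 0` (`exists_contDiff_hasCompactSupport_eventuallyEq`,
`exists_symplectic_step`).

Circular motions are limits of points of the domain, and there the elements are singular
coordinates in phase space. The circle action is therefore expressed through positions and
velocities by Lagrange's formulas (`keplerStep`); these involve the eccentric anomaly only through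
its increment (`keplerIncrement`), which is analytic at circular motions, too. As the integral of an
analytic function over a parameter is analytic (`contDiffAt_omega_intervalIntegral`),
`averagingHam` is analytic near the compact set.

At non-circular motions the elements are local coordinates, because energy, the functions
`e cos u`, `e sin u` of the eccentric anomaly `u`, and the direction of the axes are determined by
position and velocity to first order (`ellipse_deriv_eq_zero`). The inverse function theorem, with
constants that are uniform on compact sets, then turns the displacement `O(μ)` in phase space into a
displacement `O(μ)` of the modified Delaunay coordinates (`exists_delaunay_close`).
-/

open Set MeasureTheory

noncomputable section

namespace SatelliteProblem

open Filter Topology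
open scoped ContDiff

/-! ### Integrals of analytic functions depending on a parameter -/

section ParametricIntegral

open scoped NNReal ENNReal

variable {E F : Type*} [NormedAddCommGroup E] [NormedSpace ℝ E]
  [NormedAddCommGroup F] [NormedSpace ℝ F] [CompleteSpace F]

/-- The integral of an analytic function over a short interval of one of its variables is
analytic in the other variables: the power series at `(x₀, t)`, obtained from the one at
`(x₀, t₀)` by a change of origin, are integrated term by term over `t`. -/
theorem exists_analyticAt_intervalIntegral {f : E × ℝ → F} {x₀ : E} {t₀ : ℝ}
    (hf : AnalyticAt ℝ f (x₀, t₀)) :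
    ∃ ε > 0, ∀ a ∈ Metric.ball t₀ ε, ∀ b ∈ Metric.ball t₀ ε,
      AnalyticAt ℝ (fun x => ∫ t in a..b, f (x, t)) x₀ := by
  obtain ⟨p, r, hp⟩ := hf
  have hr0 : 0 < r / 2 := ENNReal.half_pos hp.r_pos.ne'
  obtain ⟨ρ, hρ0, hρ⟩ := ENNReal.lt_iff_exists_nnreal_btwn.1 hr0
  have hρ0' : 0 < ρ := by simpa using hρ0
  have h2 : (ρ : ℝ≥0∞) + ρ < r := by
    calc (ρ : ℝ≥0∞) + ρ < r / 2 + r / 2 := ENNReal.add_lt_add hρ hρ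
      _ = r := ENNReal.add_halves r
  have h2p : (ρ : ℝ≥0∞) + ρ < p.radius := h2.trans_le hp.r_le
  have h1 : (ρ : ℝ≥0∞) < r := lt_of_le_of_lt (le_add_right le_rfl) h2
  have h1p : (ρ : ℝ≥0∞) < p.radius := h1.trans_le hp.r_le
  -- `B k` bounds the `k`-th coefficient of the power series at `(x₀, t)` for all `t` at distance
  -- less than `ρ` from `t₀`; two radii `ρ` fit into `r`, so that `∑ B k ρ ^ k` still converges.
  let B : ℕ → ℝ≥0 := fun k =>
    ∑' s : Σ l : ℕ, { s : Finset (Fin (k + l)) // s.card = l }, ‖p (k + s.1)‖₊ * ρ ^ s.1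
  have hB : Summable fun k => B k * ρ ^ k := by
    simpa only [B, ← NNReal.tsum_mul_right] using
      (NNReal.summable_sigma.1 (p.changeOriginSeries_summable_aux₁ h2p)).2
  let y : ℝ → E × ℝ := fun t => (0, t - t₀)
  have hy : ∀ t ∈ Metric.ball t₀ (ρ : ℝ), ‖y t‖₊ < ρ := by
    intro t ht
    rw [← NNReal.coe_lt_coe, coe_nnnorm]
    simpa [y, Prod.norm_def, dist_eq_norm] using ht
  have hco : ∀ t ∈ Metric.ball t₀ (ρ : ℝ), ∀ k, ‖p.changeOrigin (y t) k‖₊ ≤ B k := by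
    intro t ht k
    have hyt := hy t ht
    refine (p.nnnorm_changeOrigin_le k ((ENNReal.coe_lt_coe.2 hyt).trans h1p)).trans ?_
    refine Summable.tsum_le_tsum (fun s => ?_)
      (p.changeOriginSeries_summable_aux₂ ((ENNReal.coe_lt_coe.2 hyt).trans h1p) k)
      (p.changeOriginSeries_summable_aux₂ h1p k)
    gcongr
  -- `q t` is the power series at `x₀` of `x ↦ f (x, t)`.
  let q : ℝ → FormalMultilinearSeries ℝ E F := fun t =>
    (p.changeOrigin (y t)).compContinuousLinearMap (ContinuousLinearMap.inl ℝ E ℝ)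
  have hq : ∀ t ∈ Metric.ball t₀ (ρ : ℝ), ∀ n, ‖q t n‖ ≤ B n := by
    intro t ht n
    refine ((p.changeOrigin (y t) n).norm_compContinuousLinearMap_le _).trans ?_
    have h3 : ∏ _i : Fin n, ‖ContinuousLinearMap.inl ℝ E ℝ‖ ≤ 1 :=
      Finset.prod_le_one (fun _ _ => norm_nonneg _)
        (fun _ _ => ContinuousLinearMap.norm_inl_le_one ℝ E ℝ)
    calc _ ≤ ‖p.changeOrigin (y t) n‖ * 1 := by gcongr
      _ ≤ B n := by rw [mul_one]; exact_mod_cast hco t ht n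
  have hqsum : ∀ t ∈ Metric.ball t₀ (ρ : ℝ), ∀ x : E, ‖x‖₊ < ρ →
      HasSum (fun n => q t n fun _ => x) (f (x₀ + x, t)) := by
    intro t ht x hx
    have hyt := hy t ht
    have h3 := hp.changeOrigin (y := y t) ((ENNReal.coe_lt_coe.2 hyt).trans h1)
    have h4 := h3.hasSum (y := (x, 0)) (by
      rw [mem_eball_zero_iff, lt_tsub_iff_right]
      refine lt_of_le_of_lt ?_ h2
      have : ‖((x, 0) : E × ℝ)‖ₑ = (‖x‖₊ : ℝ≥0∞) := by
        simp [enorm_eq_nnnorm, Prod.nnnorm_def]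
      rw [this]
      gcongr)
    have h5 : (x₀, t₀) + y t + (x, 0) = (x₀ + x, t) := by simp [y]
    rw [h5] at h4
    exact h4
  have hcont : ∀ n, ContinuousOn (fun t => q t n) (Metric.ball t₀ (ρ : ℝ)) := by
    intro n
    have h3 : ContinuousOn (fun z => p.changeOrigin z n) (Metric.eball 0 p.radius) :=
      ((p.hasFPowerSeriesOnBall_changeOrigin n (lt_of_le_of_lt zero_le h1p))).continuousOn
    have h4 : ContinuousOn (fun t => p.changeOrigin (y t) n) (Metric.ball t₀ (ρ : ℝ)) := by
      refine h3.comp (by fun_prop) fun t ht => ?_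
      rw [mem_eball_zero_iff]
      exact (ENNReal.coe_lt_coe.2 (hy t ht)).trans h1p
    exact (ContinuousMultilinearMap.compContinuousLinearMapL
      (fun _ : Fin n => ContinuousLinearMap.inl ℝ E ℝ)).continuous.comp_continuousOn h4
  refine ⟨ρ, by exact_mod_cast hρ0', fun a ha b hb => ?_⟩
  have hab : uIcc a b ⊆ Metric.ball t₀ (ρ : ℝ) := by
    have hc : Convex ℝ (Metric.ball t₀ (ρ : ℝ)) := convex_ball _ _
    rw [← segment_eq_uIcc]
    exact hc.segment_subset ha hb
  have habo : uIoc a b ⊆ Metric.ball t₀ (ρ : ℝ) := uIoc_subset_uIcc.trans hab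
  have hint : ∀ n, IntervalIntegrable (fun t => q t n) volume a b := fun n =>
    ((hcont n).mono hab).intervalIntegrable
  let Q : FormalMultilinearSeries ℝ E F := fun n => ∫ t in a..b, q t n
  have hQ : ∀ n, ‖Q n‖ ≤ B n * |b - a| := fun n =>
    intervalIntegral.norm_integral_le_of_norm_le_const fun t ht => hq t (habo ht) n
  have hQr : (ρ : ℝ≥0∞) ≤ Q.radius := by
    apply Q.le_radius_of_summable_norm
    refine Summable.of_nonneg_of_le (fun n => by positivity) (fun n => ?_)
      ((NNReal.summable_coe.2 hB).mul_right |b - a|)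
    calc ‖Q n‖ * (ρ : ℝ) ^ n ≤ (B n * |b - a|) * (ρ : ℝ) ^ n := by gcongr; exact hQ n
      _ = _ := by push_cast; ring
  refine ⟨Q, ρ, ⟨hQr, by simpa using hρ0', fun {x} hx => ?_⟩⟩
  have hx' : ‖x‖₊ < ρ := by
    rw [mem_eball_zero_iff, enorm_eq_nnnorm] at hx
    exact_mod_cast hx
  have hQx : ∀ n, (Q n fun _ => x) = ∫ t in a..b, q t n fun _ => x := by
    intro n
    exact (ContinuousLinearMap.intervalIntegral_comp_comm
      (ContinuousMultilinearMap.apply ℝ (fun _ : Fin n => E) F fun _ => x) (hint n)).symm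
  simp only [hQx]
  refine intervalIntegral.hasSum_integral_of_dominated_convergence
    (fun n _ => ((B n * ρ ^ n : ℝ≥0) : ℝ)) (fun n => ?_) (fun n => ?_) ?_ ?_ ?_
  · have h3 : ContinuousOn (fun t => q t n fun _ => x) (uIoc a b) :=
      (ContinuousMultilinearMap.apply ℝ (fun _ : Fin n => E) F
        fun _ => x).continuous.comp_continuousOn ((hcont n).mono habo)
    exact h3.aestronglyMeasurable measurableSet_uIoc
  · refine Eventually.of_forall fun t ht => ?_
    refine ((q t n).le_opNorm _).trans ?_
    simp only [Finset.prod_const, Finset.card_univ, Fintype.card_fin, NNReal.coe_mul,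
      NNReal.coe_pow]
    have h4 : ‖x‖ ≤ ρ := by exact_mod_cast hx'.le
    gcongr
    exact hq t (habo ht) n
  · exact Eventually.of_forall fun t _ => NNReal.summable_coe.2 hB
  · exact intervalIntegrable_const
  · exact Eventually.of_forall fun t ht => hqsum t (habo ht) x hx'

/-- A function that is analytic near `{x₀} × [a, b]` has an analytic integral over `[a, b]`. -/
theorem contDiffAt_omega_intervalIntegral {f : E × ℝ → F} {x₀ : E} {a b : ℝ} (hab : a ≤ b)
    (hf : ∀ t ∈ Icc a b, ContDiffAt ℝ ω f (x₀, t)) :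
    ContDiffAt ℝ ω (fun x => ∫ t in a..b, f (x, t)) x₀ := by
  have hf' : ∀ t ∈ Icc a b, AnalyticAt ℝ f (x₀, t) := fun t ht => (hf t ht).analyticAt
  -- The interval is cut into finitely many pieces that are short in the sense of
  -- `exists_analyticAt_intervalIntegral`.
  choose! ε hε0 hε using fun t (ht : t ∈ Icc a b) => exists_analyticAt_intervalIntegral (hf' t ht)
  obtain ⟨s, hs0, hs, ⟨N, hN⟩, hsub⟩ := exists_monotone_Icc_subset_open_cover_Icc hab
    (c := fun i : Icc a b => Subtype.val ⁻¹' Metric.ball (i : ℝ) (ε i))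
    (fun i => Metric.isOpen_ball.preimage continuous_subtype_val)
    (fun t _ => mem_iUnion.2 ⟨t, by simpa using hε0 t t.2⟩)
  -- continuity of the integrand on the interval, for all parameters close to `x₀`
  have hcont : ∀ᶠ x in 𝓝 x₀, ∀ t ∈ Icc a b, ContinuousAt f (x, t) := by
    have h1 : {z : E × ℝ | AnalyticAt ℝ f z} ∈ 𝓝ˢ (({x₀} : Set E) ×ˢ Icc a b) := by
      rw [(isOpen_analyticAt ℝ f).mem_nhdsSet]
      rintro ⟨x, t⟩ ⟨hx, ht⟩
      rw [mem_singleton_iff] at hx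
      subst hx
      exact hf' t ht
    obtain ⟨u, v, hu, -, hxu, hv, huv⟩ := generalized_tube_lemma isCompact_singleton isCompact_Icc
      (isOpen_analyticAt ℝ f) (subset_of_mem_nhdsSet h1)
    filter_upwards [hu.mem_nhds (hxu rfl)] with x hx t ht
    exact (huv (mk_mem_prod hx (hv ht)) : AnalyticAt ℝ f (x, t)).continuousAt
  have hII : ∀ᶠ x in 𝓝 x₀, ∀ c ∈ Icc a b, ∀ d ∈ Icc a b,
      IntervalIntegrable (fun t => f (x, t)) volume c d := by
    filter_upwards [hcont] with x hx c hc d hd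
    refine ContinuousOn.intervalIntegrable fun t ht => ContinuousAt.continuousWithinAt ?_
    exact ContinuousAt.comp (f := fun t => (x, t)) (hx t (uIcc_subset_Icc hc hd ht))
      (by fun_prop)
  have key : ∀ n, AnalyticAt ℝ (fun x => ∫ t in a..(s n : ℝ), f (x, t)) x₀ := by
    intro n
    induction n with
    | zero => simpa [hs0] using analyticAt_const
    | succ n ih =>
      obtain ⟨i, hi⟩ := hsub n
      have h1 := hε i i.2 (s n) (hi ⟨le_rfl, hs n.le_succ⟩) (s (n + 1)) (hi ⟨hs n.le_succ, le_rfl⟩)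
      refine (ih.add h1).congr ?_
      filter_upwards [hII] with x hx
      exact intervalIntegral.integral_add_adjacent_intervals
        (hx a (left_mem_Icc.2 hab) _ (s n).2) (hx _ (s n).2 _ (s (n + 1)).2)
  have h := key N
  rw [hN N le_rfl] at h
  exact h.contDiffAt

end ParametricIntegral

/-! ### Cutting off analytic functions near compact sets -/

section Cutoff

variable {E : Type*} [NormedAddCommGroup E] [NormedSpace ℝ E]

/-- A function that is analytic near a compact set coincides, near this set, with a smooth
function of compact support. All uniform estimates below are global bounds for such functions. -/
theorem exists_contDiff_hasCompactSupport_eventuallyEq [FiniteDimensional ℝ E] {g : E → ℝ}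
    {k : Set E} (hk : IsCompact k) (hg : ∀ x ∈ k, ContDiffAt ℝ ω g x) :
    ∃ G : E → ℝ, ContDiff ℝ ∞ G ∧ HasCompactSupport G ∧ ∀ᶠ x in 𝓝ˢ k, G x = g x := by
  have hO : IsOpen {x | AnalyticAt ℝ g x} := isOpen_analyticAt ℝ g
  obtain ⟨l, hl, hkl, hlO⟩ := exists_compact_between hk hO fun x hx => (hg x hx).analyticAt
  obtain ⟨χ, hχ1, hχ0, -⟩ := exists_contMDiffMap_one_nhds_of_subset_interior (n := (⊤ : ℕ∞))
    (modelWithCornersSelf ℝ E) hk.isClosed hkl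
  have hχs : ContDiff ℝ ∞ χ := χ.contMDiff.contDiff
  refine ⟨fun x => χ x * g x, ?_, ?_, ?_⟩
  · refine contDiff_iff_contDiffAt.2 fun x => ?_
    by_cases hx : x ∈ l
    · exact hχs.contDiffAt.mul ((hlO hx : AnalyticAt ℝ g x).contDiffAt.of_le le_top)
    · have h0 : (fun x => χ x * g x) =ᶠ[𝓝 x] fun _ => 0 := by
        filter_upwards [hl.isClosed.isOpen_compl.mem_nhds hx] with y hy
        rw [hχ0 y hy, zero_mul]
      exact contDiffAt_const.congr_of_eventuallyEq h0
  · exact HasCompactSupport.intro hl fun x hx => by rw [hχ0 x hx, zero_mul]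
  · filter_upwards [hχ1] with x hx
    rw [hx, one_mul]

theorem exists_taylor_bound {G : E → ℝ} (hG : ContDiff ℝ ∞ G) (hs : HasCompactSupport G) :
    ∃ C : ℝ, 0 ≤ C ∧ (∀ x, ‖fderiv ℝ G x‖ ≤ C) ∧
      ∀ x v, |G (x + v) - G x - fderiv ℝ G x v| ≤ C * ‖v‖ ^ 2 := by
  have hd : ContDiff ℝ ∞ (fderiv ℝ G) := hG.fderiv_right (by simp)
  obtain ⟨C₁, hC₁⟩ := (hs.fderiv ℝ).exists_bound_of_continuous hd.continuous
  obtain ⟨C₂, hC₂⟩ := ContDiff.lipschitzWith_of_hasCompactSupport (hs.fderiv ℝ) hd (by simp)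
  refine ⟨max C₁ C₂, le_max_of_le_right C₂.2, fun x => (hC₁ x).trans (le_max_left _ _),
    fun x v => ?_⟩
  have h := (convex_closedBall x ‖v‖).norm_image_sub_le_of_norm_fderiv_le' (𝕜 := ℝ) (f := G)
    (φ := fderiv ℝ G x) (C := max C₁ C₂ * ‖v‖) (x := x) (y := x + v)
    (fun y _ => hG.differentiable (by simp) y) (fun y hy => ?_) (by simp) (by simp)
  · simpa [sq, mul_assoc] using h
  · rw [← dist_eq_norm]
    calc dist (fderiv ℝ G y) (fderiv ℝ G x) ≤ C₂ * dist y x := hC₂.dist_le_mul y x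
      _ ≤ max C₁ C₂ * ‖v‖ := by
        gcongr
        · exact le_max_right _ _
        · simpa using hy

end Cutoff

/-! ### The cohomological equation on the circle -/

section CohomologicalEquation

/-- The solution of the cohomological equation on the circle: the derivative of
`(2π)⁻¹ ∫ (t - π) F(s + t) dt` is `F` minus its average. -/
theorem hasDerivAt_integral_mul_periodic {F : ℝ → ℝ} (hF : Continuous F)
    (hp : Function.Periodic F (2 * Real.pi)) (s : ℝ) :
    HasDerivAt (fun s => 1 / (2 * Real.pi) *
        ∫ t in (0 : ℝ)..(2 * Real.pi), (t - Real.pi) * F (s + t))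
      (F s - 1 / (2 * Real.pi) * ∫ t in (0 : ℝ)..(2 * Real.pi), F t) s := by
  set A := ∫ t in (0 : ℝ)..(2 * Real.pi), F t with hA
  have hG : Continuous fun t => t * F t := by fun_prop
  have hi : ∀ a b, IntervalIntegrable (fun t => t * F t) volume a b := fun a b =>
    hG.intervalIntegrable a b
  -- By periodicity, `s` enters only through the bounds of integrals of `t F(t)` and a linear term.
  have h1 : (fun s => ∫ t in (0 : ℝ)..(2 * Real.pi), (t - Real.pi) * F (s + t)) =
      fun s => (∫ t in (0 : ℝ)..(s + 2 * Real.pi), t * F t) - (∫ t in (0 : ℝ)..s, t * F t)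
        - (s + Real.pi) * A := by
    funext s
    have h2 : ∫ t in (0 : ℝ)..(2 * Real.pi), (t - Real.pi) * F (s + t) =
        ∫ t in s..(s + 2 * Real.pi), (t - s - Real.pi) * F t := by
      have := intervalIntegral.integral_comp_add_left (a := 0) (b := 2 * Real.pi)
        (fun t => (t - s - Real.pi) * F t) s
      rw [add_zero] at this
      rw [← this]
      congr 1
      funext t
      ring_nf
    have h3 : ∫ t in s..(s + 2 * Real.pi), F t = A := by
      simpa using hp.intervalIntegral_add_eq s 0
    rw [h2, intervalIntegral.integral_interval_sub_left (hi _ _) (hi _ _), ← h3,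
      ← intervalIntegral.integral_const_mul, ← intervalIntegral.integral_sub (hi _ _)
        ((hF.const_mul _).intervalIntegrable _ _)]
    congr 1
    funext t
    ring
  rw [funext_iff] at h1
  simp only [h1]
  have hd : ∀ x, HasDerivAt (fun x => ∫ t in (0 : ℝ)..x, t * F t) (x * F x) x := fun x =>
    intervalIntegral.integral_hasDerivAt_right (hi 0 x)
      (hG.stronglyMeasurableAtFilter _ _) hG.continuousAt
  have h4 : HasDerivAt (fun s => ∫ t in (0 : ℝ)..(s + 2 * Real.pi), t * F t)
      ((s + 2 * Real.pi) * F (s + 2 * Real.pi)) s :=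
    (hd (s + 2 * Real.pi)).comp_add_const s (2 * Real.pi)
  have h5 := ((h4.sub (hd s)).sub
    (((hasDerivAt_id s).add_const Real.pi).mul_const A)).const_mul (1 / (2 * Real.pi))
  refine h5.congr_deriv ?_
  rw [hp s]
  have := Real.pi_pos
  field_simp
  ring

end CohomologicalEquation

/-! ### The symplectic midpoint map and one step of averaging -/

section Symplectic

theorem symplecticForm_add_left (u v w : PhaseSpace) :
    symplecticForm (u + v) w = symplecticForm u w + symplecticForm v w := by
  simp only [symplecticForm, ← Finset.sum_add_distrib, Prod.fst_add, Prod.snd_add, Pi.add_apply,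
    inner_add_left, inner_add_right]
  exact Finset.sum_congr rfl fun i _ => by ring

theorem symplecticForm_smul_left (c : ℝ) (v w : PhaseSpace) :
    symplecticForm (c • v) w = c * symplecticForm v w := by
  simp only [symplecticForm, Finset.mul_sum, Prod.smul_fst, Prod.smul_snd, Pi.smul_apply,
    real_inner_smul_left, real_inner_smul_right]
  exact Finset.sum_congr rfl fun i _ => by ring

theorem symplecticForm_swap (v w : PhaseSpace) : symplecticForm v w = -symplecticForm w v := by
  simp only [symplecticForm, ← Finset.sum_neg_distrib, neg_sub]

theorem symplecticForm_add_right (u v w : PhaseSpace) :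
    symplecticForm w (u + v) = symplecticForm w u + symplecticForm w v := by
  rw [symplecticForm_swap, symplecticForm_add_left, symplecticForm_swap w u,
    symplecticForm_swap w v]
  ring

theorem symplecticForm_smul_right (c : ℝ) (v w : PhaseSpace) :
    symplecticForm w (c • v) = c * symplecticForm w v := by
  rw [symplecticForm_swap, symplecticForm_smul_left, symplecticForm_swap w v]
  ring

/-- The linear map from covectors to vectors given by the symplectic form, so that
`hamVector (fderiv ℝ H z)` is the Hamiltonian vector `(∂H/∂p, -∂H/∂q)` of `H` at `z`. -/
def hamVector : (PhaseSpace →L[ℝ] ℝ) →L[ℝ] PhaseSpace :=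
  LinearMap.toContinuousLinearMap
    { toFun := fun ℓ =>
        (fun i => WithLp.toLp 2 fun a => ℓ (0, Pi.single i (EuclideanSpace.single a 1)),
         fun i => WithLp.toLp 2 fun a => -ℓ (Pi.single i (EuclideanSpace.single a 1), 0))
      map_add' := fun ℓ ℓ' => by
        ext i a <;> (simp; try ring)
      map_smul' := fun c ℓ => by
        ext i a <;> simp }

theorem hamVector_fst (ℓ : PhaseSpace →L[ℝ] ℝ) (i : Fin 3) (a : Fin 2) :
    (hamVector ℓ).1 i a = ℓ (0, Pi.single i (EuclideanSpace.single a 1)) := rfl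

theorem hamVector_snd (ℓ : PhaseSpace →L[ℝ] ℝ) (i : Fin 3) (a : Fin 2) :
    (hamVector ℓ).2 i a = -ℓ (Pi.single i (EuclideanSpace.single a 1), 0) := rfl

theorem symplecticForm_hamVector (ℓ : PhaseSpace →L[ℝ] ℝ) (w : PhaseSpace) :
    symplecticForm (hamVector ℓ) w = -ℓ w := by
  have hpl : ∀ x : Plane, x = ∑ a, x a • EuclideanSpace.single a (1 : ℝ) := by
    intro x
    ext b
    fin_cases b <;> simp
  have hV : ∀ q : Fin 3 → Plane, q = ∑ i, ∑ a, q i a • Pi.single i (EuclideanSpace.single a 1) := by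
    intro q
    conv_lhs => rw [← Finset.univ_sum_single q]
    refine Finset.sum_congr rfl fun i _ => ?_
    conv_lhs => rw [hpl (q i)]
    simp only [← Pi.single_smul]
    exact map_sum (AddMonoidHom.single (fun _ : Fin 3 => Plane) i) _ _
  have hw : w = ContinuousLinearMap.inl ℝ _ _ w.1 + ContinuousLinearMap.inr ℝ _ _ w.2 := by
    ext <;> simp
  have h1 : ℓ w = ∑ i, ∑ a, (w.1 i a * ℓ (Pi.single i (EuclideanSpace.single a 1), 0) +
      w.2 i a * ℓ (0, Pi.single i (EuclideanSpace.single a 1))) := by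
    conv_lhs => rw [hw, hV w.1, hV w.2]
    simp only [map_add, map_sum, map_smul, Finset.sum_add_distrib, smul_eq_mul]
    rfl
  rw [h1, symplecticForm, ← Finset.sum_neg_distrib]
  refine Finset.sum_congr rfl fun i _ => ?_
  simp only [PiLp.inner_apply, hamVector_fst, hamVector_snd, Fin.sum_univ_two]
  simp
  ring

/-- The Poisson bracket is antisymmetric. -/
theorem apply_hamVector_swap (ℓ ℓ' : PhaseSpace →L[ℝ] ℝ) :
    ℓ (hamVector ℓ') = -ℓ' (hamVector ℓ) := by
  have h1 := symplecticForm_hamVector ℓ (hamVector ℓ')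
  have h2 := symplecticForm_hamVector ℓ' (hamVector ℓ)
  rw [symplecticForm_swap] at h2
  linarith

/-- The implicit midpoint map `z ↦ z'`, `z' - z = X((z + z') / 2)`, of a Hamiltonian vector field
`X`. With `A` the derivative of `X` at the midpoint, its derivative is the Cayley transform
`(1 + A/2)(1 - A/2)⁻¹`, which is symplectic because `A` is infinitesimally symplectic. -/
theorem exists_midpointMap {G : PhaseSpace → ℝ} (hG : ContDiff ℝ ∞ G) {B : ℝ}
    (hL : LipschitzWith 1 fun z => hamVector (fderiv ℝ G z))
    (hB : ∀ z, ‖hamVector (fderiv ℝ G z)‖ ≤ B) :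
    ∃ φ : PhaseSpace → PhaseSpace, Function.Injective φ ∧
      (∀ z v w, symplecticForm (fderiv ℝ φ z v) (fderiv ℝ φ z w) = symplecticForm v w) ∧
      (∀ z, (∀ w, ‖w - z‖ ≤ B → ContDiffAt ℝ ω G w) → ContDiffAt ℝ ω φ z) ∧
      ∀ z, ∃ w, ‖w - z‖ ≤ B ∧ φ z - z = hamVector (fderiv ℝ G w) := by
  set X : PhaseSpace → PhaseSpace := fun z => hamVector (fderiv ℝ G z) with hX
  have hdG : ContDiff ℝ ∞ (fderiv ℝ G) := hG.fderiv_right (by simp)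
  have hXs : ContDiff ℝ ∞ X := hamVector.contDiff.comp hdG
  have hN : (1 / 2 : NNReal) <
      ‖((ContinuousLinearEquiv.refl ℝ PhaseSpace).symm : PhaseSpace →L[ℝ] PhaseSpace)‖₊⁻¹ := by
    have h1 : ‖((ContinuousLinearEquiv.refl ℝ PhaseSpace).symm :
        PhaseSpace →L[ℝ] PhaseSpace)‖₊ = 1 := by
      rw [← NNReal.coe_inj]
      exact ContinuousLinearMap.norm_id
    rw [h1, inv_one]
    exact NNReal.half_lt_self one_ne_zero
  have hlip : ∀ x y, ‖(1 / 2 : ℝ) • X x - (1 / 2 : ℝ) • X y‖ ≤ 1 / 2 * ‖x - y‖ := by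
    intro x y
    have h1 := hL.dist_le_mul x y
    rw [dist_eq_norm, dist_eq_norm] at h1
    rw [← smul_sub, norm_smul]
    simp only [NNReal.coe_one, one_mul] at h1
    norm_num
    exact h1
  have happ : ApproximatesLinearOn (fun w => w - (1 / 2 : ℝ) • X w)
      (ContinuousLinearEquiv.refl ℝ PhaseSpace : PhaseSpace →L[ℝ] PhaseSpace) univ
      (1 / 2 : NNReal) := by
    intro x _ y _
    have h1 := hlip x y
    rw [← norm_neg] at h1
    have h2 : x - (1 / 2 : ℝ) • X x - (y - (1 / 2 : ℝ) • X y) - (x - y) =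
        -((1 / 2 : ℝ) • X x - (1 / 2 : ℝ) • X y) := by abel
    exact (congrArg norm h2).le.trans h1
  have happ' : ApproximatesLinearOn (fun w => w + (1 / 2 : ℝ) • X w)
      (ContinuousLinearEquiv.refl ℝ PhaseSpace : PhaseSpace →L[ℝ] PhaseSpace) univ
      (1 / 2 : NNReal) := by
    intro x _ y _
    have h2 : x + (1 / 2 : ℝ) • X x - (y + (1 / 2 : ℝ) • X y) - (x - y) =
        (1 / 2 : ℝ) • X x - (1 / 2 : ℝ) • X y := by abel
    exact (congrArg norm h2).le.trans (hlip x y)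
  -- `e` sends the midpoint `w` of `z` and its image to `z`, so that the image is `2 w - z`.
  let e : PhaseSpace ≃ₜ PhaseSpace := happ.toHomeomorph _ (Or.inr hN)
  have he : ∀ w, e w = w - (1 / 2 : ℝ) • X w := fun w => rfl
  have hes : ∀ z, e.symm z - (1 / 2 : ℝ) • X (e.symm z) = z := fun z => by
    rw [← he, e.apply_symm_apply]
  let φ : PhaseSpace → PhaseSpace := fun z => (2 : ℝ) • e.symm z - z
  have hφ : ∀ z, φ z = e.symm z + (1 / 2 : ℝ) • X (e.symm z) := by
    intro z
    have h1 := hes z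
    calc φ z = (2 : ℝ) • e.symm z - (e.symm z - (1 / 2 : ℝ) • X (e.symm z)) := by rw [h1]
      _ = _ := by rw [two_smul]; abel
  let A : PhaseSpace → PhaseSpace →L[ℝ] PhaseSpace := fun w => fderiv ℝ X w
  have hAn : ∀ w, ‖(1 / 2 : ℝ) • A w‖ < 1 := by
    intro w
    have h1 : ‖A w‖ ≤ (1 : NNReal) := norm_fderiv_le_of_lipschitz ℝ hL
    rw [norm_smul]
    norm_num
    have : ((1 : NNReal) : ℝ) = 1 := rfl
    linarith
  let f' : PhaseSpace → PhaseSpace ≃L[ℝ] PhaseSpace := fun w =>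
    ContinuousLinearEquiv.ofUnit (Units.oneSub ((1 / 2 : ℝ) • A w) (hAn w))
  have hf' : ∀ w u, f' w u = u - (1 / 2 : ℝ) • A w u := fun w u => rfl
  have hXd : ∀ w, HasFDerivAt X (A w) w := fun w => (hXs.differentiable (by simp) w).hasFDerivAt
  have hed : ∀ w, HasFDerivAt e (f' w : PhaseSpace →L[ℝ] PhaseSpace) w := by
    intro w
    have h1 : HasFDerivAt (fun w => w - (1 / 2 : ℝ) • X w)
      (ContinuousLinearMap.id ℝ PhaseSpace - (1 / 2 : ℝ) • A w) w :=
      HasFDerivAt.fun_sub (hasFDerivAt_id w) (HasFDerivAt.fun_const_smul (hXd w) _)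
    exact h1
  have hesd : ∀ z, HasFDerivAt e.symm ((f' (e.symm z)).symm : PhaseSpace →L[ℝ] PhaseSpace) z :=
    fun z => HasFDerivAt.of_local_left_inverse e.symm.continuous.continuousAt (hed (e.symm z))
      (Eventually.of_forall e.apply_symm_apply)
  have hclose : ∀ z, ‖e.symm z - z‖ ≤ B := by
    intro z
    have h1 : e.symm z - z = (1 / 2 : ℝ) • X (e.symm z) := by
      nth_rewrite 2 [← hes z]
      abel
    rw [h1, norm_smul]
    have h2 := hB (e.symm z)
    have h3 := norm_nonneg (X (e.symm z))
    norm_num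
    change ‖X (e.symm z)‖ ≤ B at h2
    linarith
  refine ⟨φ, ?_, ?_, ?_, ?_⟩
  · -- the image is obtained from the midpoint by the injective map `w ↦ w + X(w) / 2`
    intro z z' h
    rw [hφ, hφ] at h
    have h1 := (happ'.injective (Or.inr hN))
    have h2 : e.symm z = e.symm z' :=
      congrArg Subtype.val (@h1 ⟨e.symm z, mem_univ _⟩ ⟨e.symm z', mem_univ _⟩ h)
    exact e.symm.injective h2
  · intro z v w
    set x := e.symm z with hx
    have hφd : HasFDerivAt φ ((2 : ℝ) • ((f' x).symm : PhaseSpace →L[ℝ] PhaseSpace) -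
        ContinuousLinearMap.id ℝ PhaseSpace) z :=
      ((hesd z).const_smul (2 : ℝ)).sub (hasFDerivAt_id z)
    -- The second derivative of `G` is symmetric: `A` is infinitesimally symplectic.
    have hsymm : ∀ a b, symplecticForm (A x a) b = symplecticForm (A x b) a := by
      intro a b
      have hA : ∀ c, A x c = hamVector (fderiv ℝ (fderiv ℝ G) x c) := by
        intro c
        have h1 : HasFDerivAt X (hamVector.comp (fderiv ℝ (fderiv ℝ G) x)) x :=
          hamVector.hasFDerivAt.comp x (hdG.differentiable (by simp) x).hasFDerivAt
        simp only [A, h1.fderiv]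
        rfl
      rw [hA, hA, symplecticForm_hamVector, symplecticForm_hamVector]
      have h2 : IsSymmSndFDerivAt ℝ G x := hG.contDiffAt.isSymmSndFDerivAt
        (by simpa using WithTop.coe_le_coe.2 (le_top : (2 : ℕ∞) ≤ ⊤))
      rw [h2.eq]
    -- On vectors `(1 - A/2) c`, the derivative of `φ` is `(1 + A/2) c`.
    obtain ⟨a, rfl⟩ := (f' x).surjective v
    obtain ⟨b, rfl⟩ := (f' x).surjective w
    have hval : ∀ c, fderiv ℝ φ z (f' x c) = c + (1 / 2 : ℝ) • A x c := by
      intro c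
      rw [hφd.fderiv]
      simp only [sub_apply, smul_apply, ContinuousLinearEquiv.coe_coe,
        ContinuousLinearEquiv.symm_apply_apply, ContinuousLinearMap.coe_id', id_eq]
      rw [hf', two_smul]
      abel
    rw [hval, hval, hf', hf', sub_eq_add_neg, sub_eq_add_neg, ← neg_smul, ← neg_smul]
    simp only [symplecticForm_add_left, symplecticForm_add_right, symplecticForm_smul_left,
      symplecticForm_smul_right]
    rw [hsymm a b, symplecticForm_swap a (A x b)]
    ring
  · intro z hz
    have h1 : ContDiffAt ℝ ω G (e.symm z) := hz _ (hclose z)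
    have h2 : ContDiffAt ℝ ω e (e.symm z) := by
      have h3 : ContDiffAt ℝ ω X (e.symm z) :=
        hamVector.contDiff.contDiffAt.comp _ (h1.fderiv_right (by simp))
      exact contDiffAt_id.sub (h3.const_smul (1 / 2 : ℝ))
    have h4 : ContDiffAt ℝ ω e.symm z :=
      e.toOpenPartialHomeomorph.contDiffAt_symm (mem_univ z) (hed _) h2
    exact (h4.const_smul (2 : ℝ)).sub contDiffAt_id
  · intro z
    refine ⟨e.symm z, hclose z, ?_⟩
    calc φ z - z = φ z - (e.symm z - (1 / 2 : ℝ) • X (e.symm z)) := by rw [hes z]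
      _ = (1 / 2 : ℝ) • X (e.symm z) + (1 / 2 : ℝ) • X (e.symm z) := by rw [hφ]; abel
      _ = X (e.symm z) := by rw [← add_smul]; norm_num

/-- The partial differential, with respect to the phase point, of a function of the small
parameter and the phase point. -/
def phaseDeriv (H : ℝ × PhaseSpace → ℝ) (p : ℝ × PhaseSpace) : PhaseSpace →L[ℝ] ℝ :=
  (fderiv ℝ H p).comp (ContinuousLinearMap.inr ℝ ℝ PhaseSpace)

theorem phaseDeriv_apply (H : ℝ × PhaseSpace → ℝ) (p : ℝ × PhaseSpace) (v : PhaseSpace) :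
    phaseDeriv H p v = fderiv ℝ H p (0, v) := rfl

theorem hasFDerivAt_phaseDeriv {H : ℝ × PhaseSpace → ℝ} {μ : ℝ} {z : PhaseSpace}
    (hH : DifferentiableAt ℝ H (μ, z)) :
    HasFDerivAt (fun z => H (μ, z)) (phaseDeriv H (μ, z)) z :=
  hH.hasFDerivAt.comp z (hasFDerivAt_prodMk_right μ z)

/-- One step of averaging: the midpoint map of `μ H` transforms `K + μ f` into
`K + μ (f + {K, H})` up to `O(μ ^ 2)`, uniformly. -/
theorem exists_symplectic_step {H K f : ℝ × PhaseSpace → ℝ}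
    (hH : ContDiff ℝ ∞ H) (hHs : HasCompactSupport H) (hK : ContDiff ℝ ∞ K)
    (hKs : HasCompactSupport K) (hf : ContDiff ℝ ∞ f) (hfs : HasCompactSupport f) :
    ∃ C > 0, ∃ μ₀ > 0, ∃ φ : ℝ → PhaseSpace → PhaseSpace, ∀ μ, 0 < μ → μ < μ₀ →
      Function.Injective (φ μ) ∧
      (∀ z v w, symplecticForm (fderiv ℝ (φ μ) z v) (fderiv ℝ (φ μ) z w) = symplecticForm v w) ∧
      (∀ z, (∀ w, ‖w - z‖ ≤ C * μ → ContDiffAt ℝ ω H (μ, w)) → ContDiffAt ℝ ω (φ μ) z) ∧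
      (∀ z, ‖φ μ z - z‖ ≤ C * μ) ∧
      ∀ z, |K (μ, φ μ z) + μ * f (μ, φ μ z) - K (μ, z) - μ * f (μ, z) +
        μ * phaseDeriv H (μ, z) (hamVector (phaseDeriv K (μ, z)))| ≤ C * μ ^ 2 := by
  let R : (ℝ × PhaseSpace →L[ℝ] ℝ) →L[ℝ] PhaseSpace :=
    hamVector.comp ((ContinuousLinearMap.compL ℝ PhaseSpace (ℝ × PhaseSpace) ℝ).flip
      (ContinuousLinearMap.inr ℝ ℝ PhaseSpace))
  let X : ℝ × PhaseSpace → PhaseSpace := fun p => R (fderiv ℝ H p)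
  have hX : ∀ p, X p = hamVector (phaseDeriv H p) := fun p => rfl
  have hXs : ContDiff ℝ ∞ X := R.contDiff.comp (hH.fderiv_right (by simp))
  have hXc : HasCompactSupport X := (hHs.fderiv ℝ).comp_left (map_zero R)
  obtain ⟨L, hL⟩ := ContDiff.lipschitzWith_of_hasCompactSupport hXc hXs (by simp)
  obtain ⟨B, hB⟩ := hXc.exists_bound_of_continuous hXs.continuous
  have hB0 : 0 ≤ B := (norm_nonneg _).trans (hB 0)
  obtain ⟨CK, hCK0, hCK1, hCK2⟩ := exists_taylor_bound hK hKs
  obtain ⟨Lf, hLf⟩ := ContDiff.lipschitzWith_of_hasCompactSupport hfs hf (by simp)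
  set C : ℝ := B + CK * B ^ 2 + CK * L * B + Lf * B + 1 with hC
  have hL0 : (0 : ℝ) ≤ L := L.2
  have hLf0 : (0 : ℝ) ≤ Lf := Lf.2
  have hBC : B ≤ C := by
    have : 0 ≤ CK * B ^ 2 + CK * L * B + Lf * B := by positivity
    linarith
  -- For `μ < 1 / (L + 1)` the vector field of `μ H` is a contraction.
  have hmid : ∀ μ : ℝ, 0 < μ → μ < 1 / (L + 1) →
      ∃ φ : PhaseSpace → PhaseSpace, Function.Injective φ ∧
      (∀ z v w, symplecticForm (fderiv ℝ φ z v) (fderiv ℝ φ z w) = symplecticForm v w) ∧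
      (∀ z, (∀ w, ‖w - z‖ ≤ μ * B → ContDiffAt ℝ ω (fun z => μ * H (μ, z)) w) →
        ContDiffAt ℝ ω φ z) ∧
      ∀ z, ∃ w, ‖w - z‖ ≤ μ * B ∧ φ z - z = μ • X (μ, w) := by
    intro μ hμ hμ1
    have hd : ∀ z, fderiv ℝ (fun z => μ * H (μ, z)) z = μ • phaseDeriv H (μ, z) := fun z =>
      ((hasFDerivAt_phaseDeriv (hH.differentiable (by simp) _)).const_mul μ).fderiv
    have hv : ∀ z, hamVector (fderiv ℝ (fun z => μ * H (μ, z)) z) = μ • X (μ, z) := fun z => by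
      rw [hd, map_smul, hX]
    have hG : ContDiff ℝ ∞ fun z => μ * H (μ, z) :=
      contDiff_const.mul (hH.comp (contDiff_prodMk_right μ))
    have hlip : LipschitzWith 1 fun z => hamVector (fderiv ℝ (fun z => μ * H (μ, z)) z) := by
      refine LipschitzWith.of_dist_le_mul fun x y => ?_
      rw [hv, hv, dist_eq_norm, ← smul_sub, norm_smul, Real.norm_of_nonneg hμ.le, ← dist_eq_norm]
      have h1 := hL.dist_le_mul (μ, x) (μ, y)
      have h2 : dist (μ, x) (μ, y) = dist x y := by simp [Prod.dist_eq]
      rw [h2] at h1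
      have h3 : μ * L ≤ 1 := by
        rw [lt_div_iff₀ (by positivity)] at hμ1
        nlinarith
      calc μ * dist (X (μ, x)) (X (μ, y)) ≤ μ * (L * dist x y) := by gcongr
        _ = (μ * L) * dist x y := by ring
        _ ≤ 1 * dist x y := by gcongr
    obtain ⟨φ, h1, h2, h3, h4⟩ := exists_midpointMap hG (B := μ * B) hlip fun z => by
      rw [hv, norm_smul, Real.norm_of_nonneg hμ.le]
      gcongr
      exact hB _
    refine ⟨φ, h1, h2, h3, fun z => ?_⟩
    obtain ⟨w, hw, hw'⟩ := h4 z
    exact ⟨w, hw, hw'.trans (hv w)⟩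
  choose! φ hφ1 hφ2 hφ3 hφ4 using hmid
  refine ⟨C, by positivity, 1 / (L + 1), by positivity, φ, fun μ hμ hμ1 =>
    ⟨hφ1 μ hμ hμ1, hφ2 μ hμ hμ1, fun z hz => ?_, fun z => ?_, fun z => ?_⟩⟩
  · refine hφ3 μ hμ hμ1 z fun w hw => ?_
    have h1 := hz w (hw.trans (by rw [mul_comm]; gcongr))
    exact contDiffAt_const.mul (h1.comp w (contDiff_prodMk_right μ).contDiffAt)
  · obtain ⟨w, -, hw⟩ := hφ4 μ hμ hμ1 z
    rw [hw, norm_smul, Real.norm_of_nonneg hμ.le, mul_comm]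
    gcongr
    exact (hB _).trans hBC
  · obtain ⟨w, hw, hw'⟩ := hφ4 μ hμ hμ1 z
    set d := φ μ z - z with hd
    have hz' : φ μ z = z + d := by rw [hd]; abel
    have hdn : ‖d‖ ≤ μ * B := by
      rw [hw', norm_smul, Real.norm_of_nonneg hμ.le]
      gcongr
      exact hB _
    have hn0 : ∀ v : PhaseSpace, ‖((0 : ℝ), v)‖ = ‖v‖ := fun v => by simp [Prod.norm_def]
    -- Three errors of order `μ ^ 2`: the second-order remainder of `K`, the displacement of the
    -- midpoint from `z` in the vector field of `H`, and the variation of `f`.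
    have h1 : |K (μ, φ μ z) - K (μ, z) - phaseDeriv K (μ, z) d| ≤ CK * (μ * B) ^ 2 := by
      have h := hCK2 (μ, z) (0, d)
      rw [Prod.mk_add_mk, add_zero, ← hz', hn0] at h
      exact h.trans (by gcongr)
    have h2 : |phaseDeriv K (μ, z) (d - μ • X (μ, z))| ≤ CK * (μ * (L * (μ * B))) := by
      rw [phaseDeriv_apply, ← Real.norm_eq_abs]
      refine ((fderiv ℝ K (μ, z)).le_opNorm _).trans ?_
      rw [hn0, hw', ← smul_sub, norm_smul, Real.norm_of_nonneg hμ.le]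
      gcongr
      · exact hCK1 _
      · have h := hL.dist_le_mul (μ, w) (μ, z)
        rw [dist_eq_norm, dist_eq_norm] at h
        refine h.trans ?_
        gcongr
        simpa using hw
    have h3 : phaseDeriv K (μ, z) (μ • X (μ, z)) =
        -(μ * phaseDeriv H (μ, z) (hamVector (phaseDeriv K (μ, z)))) := by
      rw [map_smul, hX, apply_hamVector_swap, smul_eq_mul]
      ring
    have h4 : |f (μ, φ μ z) - f (μ, z)| ≤ Lf * (μ * B) := by
      have h := hLf.dist_le_mul (μ, φ μ z) (μ, z)
      rw [dist_eq_norm, dist_eq_norm, Real.norm_eq_abs] at h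
      refine h.trans ?_
      gcongr
      simpa [← hd] using hdn
    have h5 : K (μ, φ μ z) + μ * f (μ, φ μ z) - K (μ, z) - μ * f (μ, z) +
        μ * phaseDeriv H (μ, z) (hamVector (phaseDeriv K (μ, z))) =
        (K (μ, φ μ z) - K (μ, z) - phaseDeriv K (μ, z) d) +
        phaseDeriv K (μ, z) (d - μ • X (μ, z)) + μ * (f (μ, φ μ z) - f (μ, z)) := by
      rw [map_sub (phaseDeriv K (μ, z)) d, h3]
      ring
    rw [h5]
    refine (abs_add_three _ _ _).trans ?_
    rw [abs_mul, abs_of_pos hμ]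
    calc _ ≤ CK * (μ * B) ^ 2 + CK * (μ * (L * (μ * B))) + μ * (Lf * (μ * B)) := by gcongr
      _ = (CK * B ^ 2 + CK * L * B + Lf * B) * μ ^ 2 := by ring
      _ ≤ C * μ ^ 2 := by
        gcongr
        linarith

end Symplectic

/-! ### Kepler's equation -/

section KeplerEquation

theorem mul_cos_sub_mul_sin_lt_one {α γ : ℝ} (h : α ^ 2 + γ ^ 2 < 1) (x : ℝ) :
    α * Real.cos x - γ * Real.sin x < 1 := by
  -- `(α, γ)` is rotated by the angle `x`
  have h1 : (α * Real.cos x - γ * Real.sin x) ^ 2 + (α * Real.sin x + γ * Real.cos x) ^ 2 =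
      α ^ 2 + γ ^ 2 := by
    linear_combination (α ^ 2 + γ ^ 2) * Real.sin_sq_add_cos_sq x
  nlinarith [sq_nonneg (α * Real.sin x + γ * Real.cos x),
    sq_nonneg (α * Real.cos x - γ * Real.sin x - 1)]

/-- The increment `x` of the eccentric anomaly when the mean anomaly increases by `τ`, from a
point of eccentric anomaly `u` with `α = e cos u`, `γ = e sin u`. In contrast with `u`, it depends
analytically on the phase point at circular motions. -/
def keplerIncrement (α γ τ : ℝ) : ℝ :=
  Function.invFun (fun x : ℝ => x - α * Real.sin x + γ * (1 - Real.cos x)) τ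

theorem strictMono_kepler {α γ : ℝ} (h : α ^ 2 + γ ^ 2 < 1) :
    StrictMono (fun x : ℝ => x - α * Real.sin x + γ * (1 - Real.cos x)) := by
  apply strictMono_of_deriv_pos
  intro x
  have h1 : HasDerivAt (fun x : ℝ => x - α * Real.sin x + γ * (1 - Real.cos x))
      (1 - α * Real.cos x + γ * (0 - -Real.sin x)) x :=
    ((hasDerivAt_id x).sub ((Real.hasDerivAt_sin x).const_mul α)).add
      (((hasDerivAt_const x (1 : ℝ)).sub (Real.hasDerivAt_cos x)).const_mul γ)
  rw [h1.deriv]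
  have := mul_cos_sub_mul_sin_lt_one h x
  linarith

theorem keplerIncrement_spec {α γ : ℝ} (h : α ^ 2 + γ ^ 2 < 1) (τ : ℝ) :
    keplerIncrement α γ τ - α * Real.sin (keplerIncrement α γ τ) +
      γ * (1 - Real.cos (keplerIncrement α γ τ)) = τ := by
  have hc : Continuous (fun x : ℝ => x - α * Real.sin x + γ * (1 - Real.cos x)) := by fun_prop
  have hb : ∀ x : ℝ, |-α * Real.sin x + γ * (1 - Real.cos x)| ≤ 3 := by
    intro x
    have hα : |α| ≤ 1 := abs_le_one_iff_mul_self_le_one.2 (by nlinarith [sq_nonneg γ])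
    have hγ : |γ| ≤ 1 := abs_le_one_iff_mul_self_le_one.2 (by nlinarith [sq_nonneg α])
    have h1 : |-α * Real.sin x| ≤ 1 := by
      rw [abs_mul, abs_neg]
      exact mul_le_one₀ hα (abs_nonneg _) (Real.abs_sin_le_one x)
    have h2 : |γ * (1 - Real.cos x)| ≤ 1 * 2 := by
      rw [abs_mul]
      gcongr
      rw [abs_le]
      constructor <;> linarith [Real.cos_le_one x, Real.neg_one_le_cos x]
    exact (abs_add_le _ _).trans (by linarith)
  have hex : ∃ x : ℝ, x - α * Real.sin x + γ * (1 - Real.cos x) = τ := by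
    have h := intermediate_value_Icc (show τ - 3 ≤ τ + 3 by linarith) hc.continuousOn
    have h1 := abs_le.mp (hb (τ - 3))
    have h2 := abs_le.mp (hb (τ + 3))
    obtain ⟨x, -, hx⟩ := h (show τ ∈ Icc _ _ from ⟨by linarith, by linarith⟩)
    exact ⟨x, hx⟩
  exact Function.invFun_eq (f := fun x : ℝ => x - α * Real.sin x + γ * (1 - Real.cos x)) hex

theorem keplerIncrement_unique {α γ : ℝ} (h : α ^ 2 + γ ^ 2 < 1) {τ x : ℝ}
    (hx : x - α * Real.sin x + γ * (1 - Real.cos x) = τ) : x = keplerIncrement α γ τ :=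
  (strictMono_kepler h).injective (hx.trans (keplerIncrement_spec h τ).symm)

/-- The implicit function theorem applied to the equation defining `keplerIncrement`. -/
theorem contDiffAt_keplerIncrement {p : ℝ × ℝ × ℝ} (h : p.1 ^ 2 + p.2.1 ^ 2 < 1) :
    ContDiffAt ℝ ω (fun p : ℝ × ℝ × ℝ => keplerIncrement p.1 p.2.1 p.2.2) p := by
  let f : (ℝ × ℝ × ℝ) × ℝ → ℝ := fun w =>
    w.2 - w.1.1 * Real.sin w.2 + w.1.2.1 * (1 - Real.cos w.2) - w.1.2.2
  set x := keplerIncrement p.1 p.2.1 p.2.2 with hx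
  have hf : ContDiff ℝ ω f := by
    simp only [f]
    have hs : ContDiff ℝ ω Real.sin := Real.contDiff_sin
    have hc : ContDiff ℝ ω Real.cos := Real.contDiff_cos
    fun_prop
  have hfx : f (p, x) = 0 := by
    have := keplerIncrement_spec h p.2.2
    simp only [f]
    linarith
  have hc : 0 < 1 - p.1 * Real.cos x + p.2.1 * (0 - -Real.sin x) := by
    have := mul_cos_sub_mul_sin_lt_one h x
    linarith
  have hinv : (fderiv ℝ f (p, x) ∘L .inr ℝ (ℝ × ℝ × ℝ) ℝ).IsInvertible := by
    refine ⟨ContinuousLinearEquiv.unitsEquivAut ℝ (Units.mk0 _ hc.ne'), ?_⟩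
    have h1 : HasFDerivAt (fun x => f (p, x)) (fderiv ℝ f (p, x) ∘L .inr ℝ (ℝ × ℝ × ℝ) ℝ) x :=
      (hf.differentiable (by simp) (p, x)).hasFDerivAt.comp x (hasFDerivAt_prodMk_right p x)
    have h2 : HasDerivAt (fun x => f (p, x))
        (1 - p.1 * Real.cos x + p.2.1 * (0 - -Real.sin x)) x :=
      (((hasDerivAt_id x).sub ((Real.hasDerivAt_sin x).const_mul p.1)).add
        (((hasDerivAt_const x (1 : ℝ)).sub
          (Real.hasDerivAt_cos x)).const_mul p.2.1)).sub_const p.2.2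
    rw [h1.unique h2.hasFDerivAt]
    ext
    simp
  have hcd := hf.contDiffAt (x := (p, x))
  have h1 := hcd.contDiffAt_implicitFunction (by simp) hinv
  refine h1.congr_of_eventuallyEq ?_
  have hopen : ∀ᶠ p' : ℝ × ℝ × ℝ in 𝓝 p, p'.1 ^ 2 + p'.2.1 ^ 2 < 1 :=
    ContinuousAt.eventually_lt
      (by fun_prop : Continuous fun p' : ℝ × ℝ × ℝ => p'.1 ^ 2 + p'.2.1 ^ 2).continuousAt
      continuousAt_const h
  filter_upwards [hcd.eventually_apply_implicitFunction (by simp) hinv, hopen] with p' hp' hp1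
  rw [hfx] at hp'
  refine (keplerIncrement_unique hp1 ?_).symm
  simp only [f] at hp'
  linarith

theorem eccentricAnomaly_eq_keplerIncrement (e l : ℝ) :
    eccentricAnomaly e l = keplerIncrement e 0 l := by
  simp [eccentricAnomaly, keplerIncrement]

theorem sq_lt_one_of_abs {e : ℝ} (he : |e| < 1) : e ^ 2 < 1 := (sq_lt_one_iff_abs_lt_one e).2 he

theorem contDiffAt_eccentricAnomaly {p : ℝ × ℝ} (he : |p.1| < 1) :
    ContDiffAt ℝ ω (fun p : ℝ × ℝ => eccentricAnomaly p.1 p.2) p := by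
  simp only [eccentricAnomaly_eq_keplerIncrement]
  have h1 := contDiffAt_keplerIncrement (p := (p.1, 0, p.2)) (by simpa using sq_lt_one_of_abs he)
  exact h1.comp p (f := fun p : ℝ × ℝ => ((p.1, 0, p.2) : ℝ × ℝ × ℝ)) (by fun_prop)

theorem eccentricAnomaly_add_int {e : ℝ} (he : |e| < 1) (l : ℝ) (k : ℤ) :
    eccentricAnomaly e (l + k * (2 * Real.pi)) = eccentricAnomaly e l + k * (2 * Real.pi) := by
  refine (eccentricAnomaly_unique he ?_).symm
  have h := eccentricAnomaly_spec he l
  rw [Real.sin_add_int_mul_two_pi]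
  linarith

theorem one_sub_mul_cos_pos {e : ℝ} (he : |e| < 1) (u : ℝ) : 0 < 1 - e * Real.cos u := by
  have := mul_cos_sub_mul_sin_lt_one (α := e) (γ := 0) (by simpa using sq_lt_one_of_abs he) u
  linarith

theorem hasDerivAt_eccentricAnomaly {e : ℝ} (he : |e| < 1) (l : ℝ) :
    HasDerivAt (fun l => eccentricAnomaly e l)
      (1 / (1 - e * Real.cos (eccentricAnomaly e l))) l := by
  have h0 := one_sub_mul_cos_pos he (eccentricAnomaly e l)
  have h1 : ContDiffAt ℝ ω (fun l => eccentricAnomaly e l) l :=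
    (contDiffAt_eccentricAnomaly (p := (e, l)) he).comp l (contDiff_prodMk_right e).contDiffAt
  have h2 := (h1.differentiableAt (by simp)).hasDerivAt
  set d := deriv (fun l => eccentricAnomaly e l) l
  have h3 : HasDerivAt (fun l => eccentricAnomaly e l - e * Real.sin (eccentricAnomaly e l))
      (d - e * (Real.cos (eccentricAnomaly e l) * d)) l := h2.sub (h2.sin.const_mul e)
  simp only [eccentricAnomaly_spec he] at h3
  have h4 := h3.unique (hasDerivAt_id l)
  refine h2.congr_deriv ?_
  rw [eq_div_iff h0.ne']
  linarith

end KeplerEquation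

/-! ### Keplerian ellipses and Lagrange's solution of the Kepler problem -/

section Ellipse

theorem rotated_add (g x y x' y' : ℝ) :
    rotated g x y + rotated g x' y' = rotated g (x + x') (y + y') := by
  ext i
  fin_cases i <;> simp [rotated] <;> ring

theorem smul_rotated (c g x y : ℝ) : c • rotated g x y = rotated g (c * x) (c * y) := by
  ext i
  fin_cases i <;> simp [rotated] <;> ring

theorem inner_rotated (g x y x' y' : ℝ) :
    inner ℝ (rotated g x y) (rotated g x' y') = x * x' + y * y' := by
  simp only [rotated, PiLp.inner_apply, Fin.sum_univ_two]
  simp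
  linear_combination (x * x' + y * y') * Real.sin_sq_add_cos_sq g

theorem norm_rotated_sq (g x y : ℝ) : ‖rotated g x y‖ ^ 2 = x ^ 2 + y ^ 2 := by
  rw [← real_inner_self_eq_norm_sq, inner_rotated]
  ring

theorem rotated_add_int (g x y : ℝ) (k : ℤ) :
    rotated (g + k * (2 * Real.pi)) x y = rotated g x y := by
  simp [rotated, Real.sin_add_int_mul_two_pi, Real.cos_add_int_mul_two_pi]

theorem contDiff_rotated : ContDiff ℝ ω (fun p : ℝ × ℝ × ℝ => rotated p.1 p.2.1 p.2.2) := by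
  have hs : ContDiff ℝ ω Real.sin := Real.contDiff_sin
  have hc : ContDiff ℝ ω Real.cos := Real.contDiff_cos
  rw [contDiff_euclidean]
  intro i
  fin_cases i
  · simp only [rotated, Fin.zero_eta, PiLp.toLp_apply, Matrix.cons_val_zero]
    fun_prop
  · simp only [rotated, Fin.mk_one, PiLp.toLp_apply, Matrix.cons_val_one, Matrix.cons_val_fin_one]
    fun_prop

variable {M a e : ℝ}

theorem norm_ellipsePos (ha : 0 < a) (he : |e| < 1) (l g : ℝ) :
    ‖ellipsePos a e l g‖ = a * (1 - e * Real.cos (eccentricAnomaly e l)) := by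
  have h0 := one_sub_mul_cos_pos he (eccentricAnomaly e l)
  have h1 := sq_lt_one_of_abs he
  rw [← sq_eq_sq₀ (norm_nonneg _) (by positivity), ellipsePos, norm_rotated_sq]
  simp only [mul_pow, Real.sq_sqrt (sub_nonneg.2 h1.le)]
  linear_combination a ^ 2 * (1 - e ^ 2) * Real.sin_sq_add_cos_sq (eccentricAnomaly e l)

theorem norm_ellipseVel_sq (ha : 0 < a) (hM : 0 < M) (he : |e| < 1) (l g : ℝ) :
    ‖ellipseVel M a e l g‖ ^ 2 = M / a * ((1 + e * Real.cos (eccentricAnomaly e l)) /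
      (1 - e * Real.cos (eccentricAnomaly e l))) := by
  have h0 := one_sub_mul_cos_pos he (eccentricAnomaly e l)
  have h1 := sq_lt_one_of_abs he
  rw [ellipseVel, norm_smul, mul_pow, norm_rotated_sq, Real.norm_eq_abs, sq_abs, div_pow,
    Real.sq_sqrt (by positivity), mul_pow, Real.sq_sqrt (sub_nonneg.2 h1.le)]
  field_simp
  linear_combination Real.sin_sq_add_cos_sq (eccentricAnomaly e l)

theorem inner_ellipsePos_ellipseVel (he : |e| < 1) (l g : ℝ) :
    inner ℝ (ellipsePos a e l g) (ellipseVel M a e l g) =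
      a * Real.sqrt (M / a) * (e * Real.sin (eccentricAnomaly e l)) := by
  have h0 := one_sub_mul_cos_pos he (eccentricAnomaly e l)
  have h1 := sq_lt_one_of_abs he
  rw [ellipseVel, real_inner_smul_right, ellipsePos, inner_rotated]
  set u := eccentricAnomaly e l
  have h2 : Real.sqrt (1 - e ^ 2) * Real.sqrt (1 - e ^ 2) = 1 - e ^ 2 :=
    Real.mul_self_sqrt (sub_nonneg.2 h1.le)
  field_simp
  linear_combination (a * Real.sqrt (M / a) * Real.cos u * Real.sin u) * h2

/-- The Keplerian motion of central mass `M` from the position `q` with the velocity `v`, until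
the mean anomaly has increased by `τ`, by means of Lagrange's coefficients. -/
def keplerStep (M τ : ℝ) (q v : Plane) : Plane × Plane :=
  let a := (2 / ‖q‖ - ‖v‖ ^ 2 / M)⁻¹
  let s := Real.sqrt (M / a)
  let α := 1 - ‖q‖ / a
  let γ := inner ℝ q v / (a * s)
  let x := keplerIncrement α γ τ
  let k := 1 - (α * Real.cos x - γ * Real.sin x)
  ((1 - (1 - Real.cos x) / (‖q‖ / a)) • q +
      (a / s * ((1 - α) * Real.sin x + γ * (1 - Real.cos x))) • v,
    (-(s * Real.sin x / (‖q‖ * k))) • q + (1 - (1 - Real.cos x) / k) • v)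

/-- The energy integral: position and velocity determine the semi-major axis. -/
theorem semiMajor_ellipse (ha : 0 < a) (hM : 0 < M) (he : |e| < 1) (l g : ℝ) :
    2 / ‖ellipsePos a e l g‖ - ‖ellipseVel M a e l g‖ ^ 2 / M = a⁻¹ := by
  have h0 := one_sub_mul_cos_pos he (eccentricAnomaly e l)
  rw [norm_ellipsePos ha he, norm_ellipseVel_sq ha hM he]
  field_simp
  ring

theorem eccentricAnomaly_add {e : ℝ} (he : |e| < 1) (l τ : ℝ) :
    eccentricAnomaly e (l + τ) = eccentricAnomaly e l + keplerIncrement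
      (e * Real.cos (eccentricAnomaly e l)) (e * Real.sin (eccentricAnomaly e l)) τ := by
  set u := eccentricAnomaly e l with hu
  have h1 := sq_lt_one_of_abs he
  have h2 : (e * Real.cos u) ^ 2 + (e * Real.sin u) ^ 2 < 1 := by
    have : (e * Real.cos u) ^ 2 + (e * Real.sin u) ^ 2 = e ^ 2 := by
      linear_combination e ^ 2 * Real.sin_sq_add_cos_sq u
    linarith
  refine (eccentricAnomaly_unique he ?_).symm
  have h3 := keplerIncrement_spec h2 τ
  have h4 := eccentricAnomaly_spec he l
  rw [← hu] at h4
  rw [Real.sin_add]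
  linarith

/-- On an ellipse, `keplerStep` is the translation of the mean anomaly. The coefficients `α`, `γ`
of its definition are `e cos u` and `e sin u`, with `u` the eccentric anomaly. -/
theorem keplerStep_ellipse (ha : 0 < a) (hM : 0 < M) (he : |e| < 1) (l g τ : ℝ) :
    keplerStep M τ (ellipsePos a e l g) (ellipseVel M a e l g) =
      (ellipsePos a e (l + τ) g, ellipseVel M a e (l + τ) g) := by
  have h0 := one_sub_mul_cos_pos he (eccentricAnomaly e l)
  have h1 := sq_lt_one_of_abs he
  have hs : 0 < Real.sqrt (M / a) := Real.sqrt_pos.2 (by positivity)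
  have h0' := one_sub_mul_cos_pos he (eccentricAnomaly e (l + τ))
  simp only [keplerStep]
  rw [semiMajor_ellipse ha hM he, inv_inv, norm_ellipsePos ha he, inner_ellipsePos_ellipseVel he]
  have h2 : a * (1 - e * Real.cos (eccentricAnomaly e l)) / a =
      1 - e * Real.cos (eccentricAnomaly e l) := by field_simp
  have h3 : a * Real.sqrt (M / a) * (e * Real.sin (eccentricAnomaly e l)) /
      (a * Real.sqrt (M / a)) = e * Real.sin (eccentricAnomaly e l) := by field_simp
  rw [h2, h3, sub_sub_cancel]
  have h4 := eccentricAnomaly_add he l τ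
  set s := Real.sqrt (M / a)
  set x := keplerIncrement (e * Real.cos (eccentricAnomaly e l))
    (e * Real.sin (eccentricAnomaly e l)) τ
  simp only [ellipsePos, ellipseVel]
  rw [h4] at h0' ⊢
  set u := eccentricAnomaly e l
  set b := Real.sqrt (1 - e ^ 2)
  have hk : 1 - (e * Real.cos u * Real.cos x - e * Real.sin u * Real.sin x) =
      1 - e * Real.cos (u + x) := by
    rw [Real.cos_add]; ring
  rw [hk]
  obtain ⟨k, hk'⟩ : ∃ k, k = 1 - e * Real.cos (u + x) := ⟨_, rfl⟩
  rw [← hk'] at h0' hk ⊢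
  have hsc := Real.sin_sq_add_cos_sq u
  simp only [smul_rotated, rotated_add, Prod.mk.injEq]
  constructor
  · congr 1
    · rw [Real.cos_add]
      field_simp
      linear_combination (-e * (1 - Real.cos x) * s) * hsc
    · rw [Real.sin_add]
      field_simp
      ring
  · congr 1
    · rw [Real.sin_add]
      field_simp
      linear_combination s * Real.sin u * hk - s * e * Real.sin x * hsc
    · rw [Real.cos_add]
      field_simp
      linear_combination (-b * s * Real.cos u) * hk

end Ellipse

/-! ### Regularity and derivatives of Keplerian motions -/

section EllipseRegularity

theorem hasDerivAt_rotated {x y : ℝ → ℝ} {x' y' t : ℝ} (g : ℝ) (hx : HasDerivAt x x' t)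
    (hy : HasDerivAt y y' t) :
    HasDerivAt (fun t => rotated g (x t) (y t)) (rotated g x' y') t := by
  have h : ∀ x y, rotated g x y = x • rotated g 1 0 + y • rotated g 0 1 := fun x y => by
    rw [smul_rotated, smul_rotated, rotated_add, mul_one, mul_zero, mul_zero, mul_one, add_zero,
      zero_add]
  rw [h x' y', show (fun t => rotated g (x t) (y t)) =
    fun t => x t • rotated g 1 0 + y t • rotated g 0 1 from funext fun t => h _ _]
  exact (hx.smul_const _).add (hy.smul_const _)

variable {M a e : ℝ}

/-- The factor `a / √(M / a)` is the inverse of the mean motion. -/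
theorem hasDerivAt_ellipsePos (ha : 0 < a) (hM : 0 < M) (he : |e| < 1) (l g : ℝ) :
    HasDerivAt (fun l => ellipsePos a e l g)
      ((a / Real.sqrt (M / a)) • ellipseVel M a e l g) l := by
  have h0 := one_sub_mul_cos_pos he (eccentricAnomaly e l)
  have hs : 0 < Real.sqrt (M / a) := Real.sqrt_pos.2 (by positivity)
  have hu := hasDerivAt_eccentricAnomaly he l
  refine (hasDerivAt_rotated g ((hu.cos.sub_const e).const_mul a)
    ((hu.sin.const_mul (Real.sqrt (1 - e ^ 2))).const_mul a)).congr_deriv ?_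
  rw [ellipseVel, smul_rotated, smul_rotated]
  congr 1 <;> field_simp

/-- Newton's equation, with the mean anomaly as the time. -/
theorem hasDerivAt_ellipseVel (ha : 0 < a) (hM : 0 < M) (he : |e| < 1) (l g : ℝ) :
    HasDerivAt (fun l => ellipseVel M a e l g)
      (-(a / Real.sqrt (M / a) * (M / ‖ellipsePos a e l g‖ ^ 3)) • ellipsePos a e l g) l := by
  have h0 := one_sub_mul_cos_pos he (eccentricAnomaly e l)
  have hs : 0 < Real.sqrt (M / a) := Real.sqrt_pos.2 (by positivity)
  have hs2 : Real.sqrt (M / a) ^ 2 = M / a := Real.sq_sqrt (by positivity)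
  have hu := hasDerivAt_eccentricAnomaly he l
  have hk : HasDerivAt
      (fun l => Real.sqrt (M / a) / (1 - e * Real.cos (eccentricAnomaly e l))) _ l :=
    (hasDerivAt_const l (Real.sqrt (M / a))).div ((hu.cos.const_mul e).const_sub 1) h0.ne'
  have hr := norm_ellipsePos ha he l g
  refine (hk.smul (hasDerivAt_rotated g hu.sin.fun_neg
    (hu.cos.const_mul (Real.sqrt (1 - e ^ 2))))).congr_deriv ?_
  rw [hr, ellipsePos, smul_rotated, smul_rotated, smul_rotated, rotated_add]
  set u := eccentricAnomaly e l
  set s := Real.sqrt (M / a)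
  have hM' : M = s ^ 2 * a := by rw [hs2]; field_simp
  have hsc := Real.sin_sq_add_cos_sq u
  rw [hM']
  congr 1
  · field_simp
    linear_combination s * e * hsc
  · field_simp
    ring

variable {E : Type*} [NormedAddCommGroup E] [NormedSpace ℝ E] {x : E} {Mf af ef lf gf : E → ℝ}

theorem contDiffAt_rotated {g y z : E → ℝ} (hg : ContDiffAt ℝ ω g x) (hy : ContDiffAt ℝ ω y x)
    (hz : ContDiffAt ℝ ω z x) : ContDiffAt ℝ ω (fun x => rotated (g x) (y x) (z x)) x :=
  ContDiffAt.fun_comp x (g := fun p : ℝ × ℝ × ℝ => rotated p.1 p.2.1 p.2.2)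
    (f := fun x => (g x, y x, z x)) contDiff_rotated.contDiffAt (hg.prodMk (hy.prodMk hz))

theorem contDiffAt_ellipsePos (ha : ContDiffAt ℝ ω af x) (he : ContDiffAt ℝ ω ef x)
    (hl : ContDiffAt ℝ ω lf x) (hg : ContDiffAt ℝ ω gf x) (he1 : |ef x| < 1) :
    ContDiffAt ℝ ω (fun x => ellipsePos (af x) (ef x) (lf x) (gf x)) x := by
  have hu : ContDiffAt ℝ ω (fun x => eccentricAnomaly (ef x) (lf x)) x :=
    ContDiffAt.fun_comp x (g := fun p : ℝ × ℝ => eccentricAnomaly p.1 p.2)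
      (f := fun x => (ef x, lf x)) (contDiffAt_eccentricAnomaly (p := (ef x, lf x)) he1)
      (he.prodMk hl)
  have hb : ContDiffAt ℝ ω (fun x => Real.sqrt (1 - ef x ^ 2)) x :=
    (contDiffAt_const.sub (he.pow 2)).sqrt (sub_pos.2 (sq_lt_one_of_abs he1)).ne'
  simp only [ellipsePos]
  exact contDiffAt_rotated hg (ha.mul (hu.cos.sub he)) (ha.mul (hb.mul hu.sin))

theorem contDiffAt_ellipseVel (hM : ContDiffAt ℝ ω Mf x) (ha : ContDiffAt ℝ ω af x)
    (he : ContDiffAt ℝ ω ef x) (hl : ContDiffAt ℝ ω lf x) (hg : ContDiffAt ℝ ω gf x)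
    (hM0 : 0 < Mf x) (ha0 : 0 < af x) (he1 : |ef x| < 1) :
    ContDiffAt ℝ ω (fun x => ellipseVel (Mf x) (af x) (ef x) (lf x) (gf x)) x := by
  have hu : ContDiffAt ℝ ω (fun x => eccentricAnomaly (ef x) (lf x)) x :=
    ContDiffAt.fun_comp x (g := fun p : ℝ × ℝ => eccentricAnomaly p.1 p.2)
      (f := fun x => (ef x, lf x)) (contDiffAt_eccentricAnomaly (p := (ef x, lf x)) he1)
      (he.prodMk hl)
  have hb : ContDiffAt ℝ ω (fun x => Real.sqrt (1 - ef x ^ 2)) x :=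
    (contDiffAt_const.sub (he.pow 2)).sqrt (sub_pos.2 (sq_lt_one_of_abs he1)).ne'
  have hs : ContDiffAt ℝ ω (fun x => Real.sqrt (Mf x / af x)) x :=
    (hM.div ha ha0.ne').sqrt (div_pos hM0 ha0).ne'
  have hk : ContDiffAt ℝ ω (fun x => 1 - ef x * Real.cos (eccentricAnomaly (ef x) (lf x))) x :=
    contDiffAt_const.sub (he.mul hu.cos)
  simp only [ellipseVel]
  exact (hs.div hk (one_sub_mul_cos_pos he1 _).ne').smul
    (contDiffAt_rotated hg hu.sin.neg (hb.mul hu.cos))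

/-- The Keplerian motion depends analytically on the position and the velocity near a point of an
elliptic motion, circular or not. -/
theorem contDiffAt_keplerStep {τf : E → ℝ} {qf vf : E → Plane} (hM : ContDiffAt ℝ ω Mf x)
    (hτ : ContDiffAt ℝ ω τf x) (hq : ContDiffAt ℝ ω qf x) (hv : ContDiffAt ℝ ω vf x)
    (hM0 : 0 < Mf x) {a e l g : ℝ} (ha : 0 < a) (he : |e| < 1) (hqx : qf x = ellipsePos a e l g)
    (hvx : vf x = ellipseVel (Mf x) a e l g) :
    ContDiffAt ℝ ω (fun x => keplerStep (Mf x) (τf x) (qf x) (vf x)) x := by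
  have h0 := one_sub_mul_cos_pos he (eccentricAnomaly e l)
  have hr := norm_ellipsePos ha he l g
  have hr0 : 0 < ‖qf x‖ := by rw [hqx, hr]; positivity
  have hrc : ContDiffAt ℝ ω (fun x => ‖qf x‖) x := hq.norm ℝ (norm_pos_iff.1 hr0)
  have hax : 2 / ‖qf x‖ - ‖vf x‖ ^ 2 / Mf x = a⁻¹ := by
    rw [hqx, hvx]
    exact semiMajor_ellipse ha hM0 he l g
  have hac : ContDiffAt ℝ ω (fun x => (2 / ‖qf x‖ - ‖vf x‖ ^ 2 / Mf x)⁻¹) x :=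
    ((contDiffAt_const.div hrc hr0.ne').sub ((hv.norm_sq ℝ).div hM hM0.ne')).inv
      (by change 2 / ‖qf x‖ - ‖vf x‖ ^ 2 / Mf x ≠ 0; rw [hax]; positivity)
  have hs0 : 0 < Real.sqrt (Mf x / a) := Real.sqrt_pos.2 (by positivity)
  obtain ⟨A, hA⟩ : ∃ A : E → ℝ, A = fun x => (2 / ‖qf x‖ - ‖vf x‖ ^ 2 / Mf x)⁻¹ := ⟨_, rfl⟩
  have hAx : A x = a := by simp only [hA, hax, inv_inv]
  rw [← hA] at hac
  obtain ⟨S, hS⟩ : ∃ S : E → ℝ, S = fun x => Real.sqrt (Mf x / A x) := ⟨_, rfl⟩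
  have hSx : S x = Real.sqrt (Mf x / a) := by simp only [hS, hAx]
  have hsc : ContDiffAt ℝ ω S x := by
    rw [hS]
    exact (hM.div hac (by rw [hAx]; positivity)).sqrt
      (by change Mf x / A x ≠ 0; rw [hAx]; positivity)
  obtain ⟨α, hα⟩ : ∃ α : E → ℝ, α = fun x => 1 - ‖qf x‖ / A x := ⟨_, rfl⟩
  have hαc : ContDiffAt ℝ ω α x := by
    rw [hα]
    exact contDiffAt_const.sub (hrc.div hac (by rw [hAx]; positivity))
  have hαx : α x = e * Real.cos (eccentricAnomaly e l) := by
    simp only [hα, hAx, hqx, hr]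
    field_simp
    ring
  obtain ⟨γ, hγ⟩ : ∃ γ : E → ℝ, γ = fun x => inner ℝ (qf x) (vf x) / (A x * S x) := ⟨_, rfl⟩
  have hγc : ContDiffAt ℝ ω γ x := by
    rw [hγ]
    exact (hq.inner ℝ hv).div (hac.mul hsc) (by rw [hAx, hSx]; positivity)
  have hγx : γ x = e * Real.sin (eccentricAnomaly e l) := by
    simp only [hγ, hAx, hSx, hqx, hvx]
    rw [inner_ellipsePos_ellipseVel he]
    field_simp
  have h1 : α x ^ 2 + γ x ^ 2 < 1 := by
    rw [hαx, hγx]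
    have : (e * Real.cos (eccentricAnomaly e l)) ^ 2 + (e * Real.sin (eccentricAnomaly e l)) ^ 2 =
        e ^ 2 := by
      linear_combination e ^ 2 * Real.sin_sq_add_cos_sq (eccentricAnomaly e l)
    rw [this]
    exact sq_lt_one_of_abs he
  obtain ⟨ξ, hξ⟩ : ∃ ξ : E → ℝ, ξ = fun x => keplerIncrement (α x) (γ x) (τf x) := ⟨_, rfl⟩
  have hξc : ContDiffAt ℝ ω ξ x := by
    rw [hξ]
    exact (contDiffAt_keplerIncrement (p := (α x, γ x, τf x)) h1).comp x
      (hαc.prodMk (hγc.prodMk hτ))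
  obtain ⟨k, hk⟩ : ∃ k : E → ℝ,
      k = fun x => 1 - (α x * Real.cos (ξ x) - γ x * Real.sin (ξ x)) := ⟨_, rfl⟩
  have hkc : ContDiffAt ℝ ω k x := by
    rw [hk]
    exact contDiffAt_const.sub ((hαc.mul hξc.cos).sub (hγc.mul hξc.sin))
  have hkx : 0 < k x := by
    rw [hk]
    exact sub_pos.2 (mul_cos_sub_mul_sin_lt_one h1 _)
  have hfun : (fun x => keplerStep (Mf x) (τf x) (qf x) (vf x)) = fun x =>
      ((1 - (1 - Real.cos (ξ x)) / (‖qf x‖ / A x)) • qf x +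
      (A x / S x * ((1 - α x) * Real.sin (ξ x) + γ x * (1 - Real.cos (ξ x)))) • vf x,
      (-(S x * Real.sin (ξ x) / (‖qf x‖ * k x))) • qf x +
        (1 - (1 - Real.cos (ξ x)) / k x) • vf x) := by
    subst hk hξ hγ hα hS hA
    rfl
  rw [hfun]
  have hA0 : A x ≠ 0 := by rw [hAx]; positivity
  have hS0 : S x ≠ 0 := by rw [hSx]; positivity
  have hc1 : ContDiffAt ℝ ω (fun x => 1 - Real.cos (ξ x)) x := contDiffAt_const.sub hξc.cos
  have h2 : ContDiffAt ℝ ω (fun x => 1 - (1 - Real.cos (ξ x)) / (‖qf x‖ / A x)) x :=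
    contDiffAt_const.sub (hc1.div (hrc.div hac hA0) (div_ne_zero hr0.ne' hA0))
  have h3 : ContDiffAt ℝ ω
      (fun x => A x / S x * ((1 - α x) * Real.sin (ξ x) + γ x * (1 - Real.cos (ξ x)))) x :=
    (hac.div hsc hS0).mul (((contDiffAt_const.sub hαc).mul hξc.sin).add (hγc.mul hc1))
  have h4 : ContDiffAt ℝ ω (fun x => -(S x * Real.sin (ξ x) / (‖qf x‖ * k x))) x :=
    ((hsc.mul hξc.sin).div (hrc.mul hkc) (mul_pos hr0 hkx).ne').neg
  have h5 : ContDiffAt ℝ ω (fun x => 1 - (1 - Real.cos (ξ x)) / k x) x :=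
    contDiffAt_const.sub (hc1.div hkc hkx.ne')
  exact ((h2.smul hq).add (h3.smul hv)).prodMk ((h4.smul hq).add (h5.smul hv))

end EllipseRegularity

/-! ### Analyticity of the Hamiltonians and of the elements -/

section System

variable {mod : Model} {m₀ : ℝ} {m : Fin 3 → ℝ}

/-- The rescaled Keplerian part as a function of the small parameter and the phase point; in
contrast with `FKep` it is regular at `μ = 0`. -/
def keplerHam (mod : Model) (m₀ : ℝ) (m : Fin 3 → ℝ) (p : ℝ × PhaseSpace) : ℝ :=
  ∑ i, (‖p.2.2 i‖ ^ 2 / (2 * fictMass mod m₀ m p.1 i) - m₀ * m i / ‖p.2.1 i‖)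

theorem FKep_eq_keplerHam {μ : ℝ} (hm₀ : 0 < m₀) (hm : ∀ i, 0 < m i) (hμ : 0 < μ)
    (z : PhaseSpace) : FKep mod m₀ m μ z = keplerHam mod m₀ m (μ, z) := by
  cases mod <;> simp only [FKep, hamKep, keplerHam, fictMass, Finset.mul_sum, norm_smul, mul_pow,
    Real.norm_of_nonneg hμ.le] <;> refine Finset.sum_congr rfl fun i _ => ?_
  · have := hm i
    field_simp
  · have := hm i
    have : 0 < m₀ + μ * m i := by positivity
    field_simp

theorem FPert_eq_mul_hamPert {μ : ℝ} (hμ : 0 < μ) (z : PhaseSpace) :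
    FPert mod m₀ m μ z = μ * hamPert mod m₀ m z := by
  cases mod <;> simp only [FPert, hamPert, Finset.mul_sum, real_inner_smul_left,
    real_inner_smul_right] <;>
    refine Finset.sum_congr rfl fun i _ => Finset.sum_congr rfl fun j _ => ?_
  · field_simp
  · field_simp

theorem fictMass_pos {μ : ℝ} (hm₀ : 0 < m₀) (hm : ∀ i, 0 < m i) {i : Fin 3}
    (hμ : 0 < m₀ + μ * m i) : 0 < fictMass mod m₀ m μ i := by
  have := hm i
  cases mod <;> simp only [fictMass] <;> positivity

theorem centMass_pos {μ : ℝ} (hm₀ : 0 < m₀) {i : Fin 3}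
    (hμ : 0 < m₀ + μ * m i) : 0 < centMass mod m₀ m μ i := by
  cases mod <;> simpa only [centMass]

theorem fictMass_mul_centMass {μ : ℝ} {i : Fin 3} (hμ : 0 < m₀ + μ * m i) :
    fictMass mod m₀ m μ i * centMass mod m₀ m μ i = m₀ * m i := by
  cases mod <;> simp only [fictMass, centMass]
  · ring
  · rw [div_mul_cancel₀ _ hμ.ne']

variable {E : Type*} [NormedAddCommGroup E] [NormedSpace ℝ E] {x : E}

theorem contDiffAt_fictMass {f : E → ℝ} {i : Fin 3} (hf : ContDiffAt ℝ ω f x)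
    (hμ : 0 < m₀ + f x * m i) : ContDiffAt ℝ ω (fun x => fictMass mod m₀ m (f x) i) x := by
  cases mod <;> simp only [fictMass]
  · exact contDiffAt_const
  · exact contDiffAt_const.div (by fun_prop) hμ.ne'

theorem contDiffAt_centMass {f : E → ℝ} (hf : ContDiffAt ℝ ω f x) (i : Fin 3) :
    ContDiffAt ℝ ω (fun x => centMass mod m₀ m (f x) i) x := by
  cases mod <;> simp only [centMass] <;> fun_prop

theorem contDiffAt_circMom {f : E → Fin 3 → ℝ} (hf : ContDiffAt ℝ ω f x) (i : Fin 3) :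
    ContDiffAt ℝ ω (fun x => circMom (f x) i) x := by
  fin_cases i <;> simp [circMom] <;> fun_prop

theorem contDiffAt_angMom {f : E → Fin 3 → ℝ} (hf : ContDiffAt ℝ ω f x) (i : Fin 3) :
    ContDiffAt ℝ ω (fun x => angMom (f x) i) x := by
  fin_cases i <;> simp [angMom] <;> fun_prop

theorem contDiffAt_meanAnom {f : E → Fin 3 → ℝ} (hf : ContDiffAt ℝ ω f x) (i : Fin 3) :
    ContDiffAt ℝ ω (fun x => meanAnom (f x) i) x := by
  fin_cases i <;> simp [meanAnom] <;> fun_prop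

theorem contDiffAt_argPeri {f : E → Fin 3 → ℝ} (hf : ContDiffAt ℝ ω f x) (i : Fin 3) :
    ContDiffAt ℝ ω (fun x => argPeri (f x) i) x := by
  fin_cases i <;> simp [argPeri] <;> fun_prop

/-- Values of the small parameter and of `(D, δ, e, η)` (eccentricities of any sign being allowed)
such that the three ellipses are well defined and lie in disjoint annuli around the centre. -/
def separatedElements (mod : Model) (m₀ : ℝ) (m : Fin 3 → ℝ) : Set (ℝ × Coords) :=
  {p | (∀ i, 0 < m₀ + p.1 * m i) ∧ (∀ i, 0 < circMom p.2.1 i) ∧ (∀ i, |p.2.2.2.1 i| < 1) ∧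
    semiMajor mod m₀ m p.1 p.2.1 0 * (1 + |p.2.2.2.1 0|) <
      semiMajor mod m₀ m p.1 p.2.1 1 * (1 - |p.2.2.2.1 1|) ∧
    semiMajor mod m₀ m p.1 p.2.1 1 * (1 + |p.2.2.2.1 1|) <
      semiMajor mod m₀ m p.1 p.2.1 2 * (1 - |p.2.2.2.1 2|)}

theorem semiMajor_pos {μ : ℝ} {D : Fin 3 → ℝ} {i : Fin 3} (hm₀ : 0 < m₀) (hm : ∀ i, 0 < m i)
    (hμ : 0 < m₀ + μ * m i) (hD : 0 < circMom D i) : 0 < semiMajor mod m₀ m μ D i := by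
  have h1 := fictMass_pos (mod := mod) hm₀ hm hμ
  have h2 := centMass_pos (mod := mod) hm₀ hμ
  rw [semiMajor]
  positivity

theorem contDiffAt_semiMajor (hm₀ : 0 < m₀) (hm : ∀ i, 0 < m i) {p : ℝ × (Fin 3 → ℝ)} {i : Fin 3}
    (hμ : 0 < m₀ + p.1 * m i) :
    ContDiffAt ℝ ω (fun p : ℝ × (Fin 3 → ℝ) => semiMajor mod m₀ m p.1 p.2 i) p := by
  have h1 : ContDiffAt ℝ ω (fun p : ℝ × (Fin 3 → ℝ) => fictMass mod m₀ m p.1 i) p :=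
    contDiffAt_fictMass contDiffAt_fst hμ
  have h2 : ContDiffAt ℝ ω (fun p : ℝ × (Fin 3 → ℝ) => centMass mod m₀ m p.1 i) p :=
    contDiffAt_centMass contDiffAt_fst i
  have h3 : ContDiffAt ℝ ω (fun p : ℝ × (Fin 3 → ℝ) => circMom p.2 i) p :=
    contDiffAt_circMom contDiffAt_snd i
  exact ((h3.div h1 (fictMass_pos hm₀ hm hμ).ne').pow 2).div h2 (centMass_pos hm₀ hμ).ne'

theorem isOpen_separatedElements (hm₀ : 0 < m₀) (hm : ∀ i, 0 < m i) :
    IsOpen (separatedElements mod m₀ m) := by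
  rw [isOpen_iff_mem_nhds]
  rintro p ⟨h1, h2, h3, h4, h5⟩
  have hs : ∀ i, ContinuousAt (fun p : ℝ × Coords => semiMajor mod m₀ m p.1 p.2.1 i) p := fun i =>
    ContinuousAt.comp (g := fun p : ℝ × (Fin 3 → ℝ) => semiMajor mod m₀ m p.1 p.2 i)
      (f := fun p : ℝ × Coords => (p.1, p.2.1))
      (contDiffAt_semiMajor hm₀ hm (p := (p.1, p.2.1)) (h1 i)).continuousAt (by fun_prop)
  have hE : ∀ i, Continuous (fun p : ℝ × Coords => |p.2.2.2.1 i|) := fun i => by fun_prop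
  refine inter_mem ?_ (inter_mem ?_ (inter_mem ?_ (inter_mem ?_ ?_)))
  · exact eventually_all.2 fun i =>
      continuousAt_const.eventually_lt (by fun_prop : Continuous _).continuousAt (h1 i)
  · exact eventually_all.2 fun i => continuousAt_const.eventually_lt
      (contDiffAt_circMom (f := fun p : ℝ × Coords => p.2.1) (by fun_prop) i).continuousAt (h2 i)
  · exact eventually_all.2 fun i => (hE i).continuousAt.eventually_lt continuousAt_const (h3 i)
  · exact ((hs 0).mul (continuousAt_const.add (hE 0).continuousAt)).eventually_lt
      ((hs 1).mul (continuousAt_const.sub (hE 1).continuousAt)) h4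
  · exact ((hs 1).mul (continuousAt_const.add (hE 1).continuousAt)).eventually_lt
      ((hs 2).mul (continuousAt_const.sub (hE 2).continuousAt)) h5

/-- `ofElements`, together with the small parameter. -/
def ofElementsParam (mod : Model) (m₀ : ℝ) (m : Fin 3 → ℝ) (p : ℝ × Coords) : ℝ × PhaseSpace :=
  (p.1, ofElements mod m₀ m p.1 p.2)

theorem contDiffAt_ofElementsParam (hm₀ : 0 < m₀) (hm : ∀ i, 0 < m i) {p : ℝ × Coords}
    (h1 : ∀ i, 0 < m₀ + p.1 * m i) (h2 : ∀ i, 0 < circMom p.2.1 i) (h3 : ∀ i, |p.2.2.2.1 i| < 1) :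
    ContDiffAt ℝ ω (ofElementsParam mod m₀ m) p := by
  have ha : ∀ i, ContDiffAt ℝ ω (fun p : ℝ × Coords => semiMajor mod m₀ m p.1 p.2.1 i) p := fun i =>
    ContDiffAt.fun_comp p (g := fun p : ℝ × (Fin 3 → ℝ) => semiMajor mod m₀ m p.1 p.2 i)
      (f := fun p : ℝ × Coords => (p.1, p.2.1))
      (contDiffAt_semiMajor hm₀ hm (p := (p.1, p.2.1)) (h1 i)) (by fun_prop)
  have he : ∀ i, ContDiffAt ℝ ω (fun p : ℝ × Coords => p.2.2.2.1 i) p := fun i => by fun_prop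
  have hl : ∀ i, ContDiffAt ℝ ω (fun p : ℝ × Coords => meanAnom p.2.2.1 i) p := fun i =>
    contDiffAt_meanAnom (by fun_prop) i
  have hg : ∀ i, ContDiffAt ℝ ω (fun p : ℝ × Coords => argPeri p.2.2.2.2 i) p := fun i =>
    contDiffAt_argPeri (by fun_prop) i
  have hβ : ∀ i, ContDiffAt ℝ ω (fun p : ℝ × Coords => fictMass mod m₀ m p.1 i) p := fun i =>
    contDiffAt_fictMass contDiffAt_fst (h1 i)
  have hM : ∀ i, ContDiffAt ℝ ω (fun p : ℝ × Coords => centMass mod m₀ m p.1 i) p := fun i =>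
    contDiffAt_centMass contDiffAt_fst i
  refine contDiffAt_fst.prodMk (ContDiffAt.prodMk ?_ ?_)
  · exact contDiffAt_pi.2 fun i => contDiffAt_ellipsePos (ha i) (he i) (hl i) (hg i) (h3 i)
  · exact contDiffAt_pi.2 fun i => (hβ i).smul (contDiffAt_ellipseVel (hM i) (ha i) (he i) (hl i)
      (hg i) (centMass_pos hm₀ (h1 i)) (semiMajor_pos hm₀ hm (h1 i) (h2 i)) (h3 i))

theorem separatedElements.contDiffAt_ofElementsParam (hm₀ : 0 < m₀) (hm : ∀ i, 0 < m i)
    {p : ℝ × Coords} (hp : p ∈ separatedElements mod m₀ m) :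
    ContDiffAt ℝ ω (ofElementsParam mod m₀ m) p :=
  SatelliteProblem.contDiffAt_ofElementsParam hm₀ hm hp.1 hp.2.1 hp.2.2.1

theorem norm_ellipsePos_mem {a e : ℝ} (ha : 0 < a) (he : |e| < 1) (l g : ℝ) :
    a * (1 - |e|) ≤ ‖ellipsePos a e l g‖ ∧ ‖ellipsePos a e l g‖ ≤ a * (1 + |e|) := by
  have h : |e * Real.cos (eccentricAnomaly e l)| ≤ |e| := by
    rw [abs_mul]
    exact mul_le_of_le_one_right (abs_nonneg _) (Real.abs_cos_le_one _)
  rw [norm_ellipsePos ha he]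
  have := abs_le.1 h
  constructor <;> gcongr <;> linarith

theorem separatedElements.collisionFree (hm₀ : 0 < m₀) (hm : ∀ i, 0 < m i)
    {μ : ℝ} {y : Coords} (hp : (μ, y) ∈ separatedElements mod m₀ m) :
    ofElements mod m₀ m μ y ∈ collisionFree := by
  obtain ⟨h1, h2, h3, h4, h5⟩ := hp
  dsimp only at h1 h2 h3 h4 h5
  have ha := fun i => semiMajor_pos (mod := mod) hm₀ hm (h1 i) (h2 i)
  have hn := fun i => norm_ellipsePos_mem (ha i) (h3 i) (meanAnom y.2.1 i) (argPeri y.2.2.2 i)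
  set q := (ofElements mod m₀ m μ y).1 with hq
  change ∀ i, _ ≤ ‖q i‖ ∧ ‖q i‖ ≤ _ at hn
  -- the satellites are at increasing distances from the centre
  have h01 : ‖q 0‖ < ‖q 1‖ := ((hn 0).2.trans_lt h4).trans_le (hn 1).1
  have h12 : ‖q 1‖ < ‖q 2‖ := ((hn 1).2.trans_lt h5).trans_le (hn 2).1
  refine ⟨fun i => ?_, fun i j hij => ?_⟩
  · have : 0 < ‖q i‖ := lt_of_lt_of_le (mul_pos (ha i) (sub_pos.2 (h3 i))) (hn i).1
    exact norm_pos_iff.1 this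
  · intro h
    rw [← hq] at h
    have h' : ‖q i‖ = ‖q j‖ := by rw [h]
    fin_cases i <;> fin_cases j <;> simp at hij h' <;> linarith

theorem isOpen_collisionFree : IsOpen collisionFree := by
  simp only [collisionFree, ofPred_and, ofPred_forall]
  refine IsOpen.inter (isOpen_iInter_of_finite fun i => ?_)
    (isOpen_iInter_of_finite fun i => isOpen_iInter_of_finite fun j => ?_)
  · exact isOpen_ne_fun (by fun_prop) (by fun_prop)
  · by_cases h : i = j
    · simp [h]
    · simpa [h] using isOpen_ne_fun (f := fun z : PhaseSpace => z.1 i) (g := fun z => z.1 j)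
        (by fun_prop) (by fun_prop)

theorem contDiffAt_hamPert {z : PhaseSpace} (hz : z ∈ collisionFree) :
    ContDiffAt ℝ ω (hamPert mod m₀ m) z := by
  have hq : ∀ i, ContDiffAt ℝ ω (fun z : PhaseSpace => z.1 i) z := fun i => by fun_prop
  have hp : ∀ i, ContDiffAt ℝ ω (fun z : PhaseSpace => z.2 i) z := fun i => by fun_prop
  have hd : ∀ i j, i < j → ContDiffAt ℝ ω (fun z : PhaseSpace => m i * m j / ‖z.1 i - z.1 j‖) z :=
    fun i j hij => contDiffAt_const.div
      (((hq i).sub (hq j)).norm ℝ (sub_ne_zero.2 (hz.2 i j hij.ne)))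
      (norm_ne_zero_iff.2 (sub_ne_zero.2 (hz.2 i j hij.ne)))
  cases mod
  · exact ContDiffAt.sum fun i _ => ContDiffAt.sum fun j hj => (hd i j (Finset.mem_Ioi.1 hj)).neg
  · exact ContDiffAt.sum fun i _ => ContDiffAt.sum fun j hj =>
      (((hp i).inner ℝ (hp j)).div_const m₀).sub (hd i j (Finset.mem_Ioi.1 hj))

theorem contDiffAt_keplerHam (hm₀ : 0 < m₀) (hm : ∀ i, 0 < m i) {w : ℝ × PhaseSpace}
    (hμ : ∀ i, 0 < m₀ + w.1 * m i) (hz : w.2 ∈ collisionFree) :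
    ContDiffAt ℝ ω (keplerHam mod m₀ m) w := by
  have hq : ∀ i, ContDiffAt ℝ ω (fun w : ℝ × PhaseSpace => w.2.1 i) w := fun i => by fun_prop
  have hp : ∀ i, ContDiffAt ℝ ω (fun w : ℝ × PhaseSpace => w.2.2 i) w := fun i => by fun_prop
  have hβ : ∀ i, ContDiffAt ℝ ω (fun w : ℝ × PhaseSpace => 2 * fictMass mod m₀ m w.1 i) w :=
    fun i => contDiffAt_const.mul (contDiffAt_fictMass contDiffAt_fst (hμ i))
  exact ContDiffAt.sum fun i _ => (((hp i).norm_sq ℝ).div (hβ i)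
    (mul_pos two_pos (fictMass_pos hm₀ hm (hμ i))).ne').sub
      (contDiffAt_const.div ((hq i).norm ℝ (hz.1 i)) (norm_ne_zero_iff.2 (hz.1 i)))

end System

/-! ### The resonant circle action and the averaging Hamiltonian -/

section Resonance

variable {mod : Model} {m₀ : ℝ} {m : Fin 3 → ℝ}

/-- The ratios of the resonant frequencies of the mean anomalies. -/
def resonance : Fin 3 → ℝ := ![4, 2, 1]

/-- The translation of `δ₃`. -/
def advance (t : ℝ) (y : Coords) : Coords :=
  (y.1, Function.update y.2.1 2 (y.2.1 2 + t), y.2.2)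

theorem meanAnom_advance (t : ℝ) (y : Coords) (i : Fin 3) :
    meanAnom (advance t y).2.1 i = meanAnom y.2.1 i + resonance i * t := by
  fin_cases i <;> simp [meanAnom, advance, resonance, Function.update] <;> ring

theorem advance_advance (s t : ℝ) (y : Coords) : advance t (advance s y) = advance (s + t) y := by
  simp [advance, add_assoc]

theorem advance_zero (y : Coords) : advance 0 y = y := by
  simp [advance]

theorem contDiff_advance (y : Coords) : ContDiff ℝ ω (fun t => advance t y) := by
  refine contDiff_const.prodMk (ContDiff.prodMk (contDiff_pi.2 fun i => ?_) contDiff_const)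
  by_cases h : i = 2
  · subst h
    simp only [Function.update_self]
    fun_prop
  · simp only [Function.update_of_ne h]
    fun_prop

theorem advance_mem_separatedElements {μ : ℝ} {y : Coords}
    (hp : (μ, y) ∈ separatedElements mod m₀ m) (t : ℝ) :
    (μ, advance t y) ∈ separatedElements mod m₀ m := hp

/-- `ofElements` depends on the angles modulo `2π` only. -/
theorem ofElements_congr {μ : ℝ} {y y' : Coords} (hD : y'.1 = y.1) (he : y'.2.2.1 = y.2.2.1)
    (he1 : ∀ i, |y.2.2.1 i| < 1)
    (hl : ∀ i, ∃ k : ℤ, meanAnom y'.2.1 i = meanAnom y.2.1 i + k * (2 * Real.pi))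
    (hg : ∀ i, ∃ k : ℤ, argPeri y'.2.2.2 i = argPeri y.2.2.2 i + k * (2 * Real.pi)) :
    ofElements mod m₀ m μ y' = ofElements mod m₀ m μ y := by
  refine Prod.ext (funext fun i => ?_) (funext fun i => ?_) <;>
    obtain ⟨k, hk⟩ := hl i <;> obtain ⟨n, hn⟩ := hg i <;>
    simp only [ofElements, ellipsePos, ellipseVel, hD, he, hk, hn,
      eccentricAnomaly_add_int (he1 i), rotated_add_int, Real.cos_add_int_mul_two_pi,
      Real.sin_add_int_mul_two_pi]

theorem periodic_ofElements_advance {μ : ℝ} {y : Coords} (he1 : ∀ i, |y.2.2.1 i| < 1) :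
    Function.Periodic (fun t => ofElements mod m₀ m μ (advance t y)) (2 * Real.pi) := by
  intro t
  refine ofElements_congr rfl rfl he1 (fun i => ?_) (fun i => ⟨0, by simp [advance]⟩)
  have h : ∃ k : ℤ, resonance i = k := by
    fin_cases i
    · exact ⟨4, by simp [resonance]⟩
    · exact ⟨2, by simp [resonance]⟩
    · exact ⟨1, by simp [resonance]⟩
  obtain ⟨k, hk⟩ := h
  refine ⟨k, ?_⟩
  rw [meanAnom_advance, meanAnom_advance, hk]
  ring

/-- The action of the circle that advances the mean anomalies by `4t`, `2t`, `t`, on phase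
points. -/
def resonantFlow (mod : Model) (m₀ : ℝ) (m : Fin 3 → ℝ) (w : (ℝ × PhaseSpace) × ℝ) : PhaseSpace :=
  (fun i => (keplerStep (centMass mod m₀ m w.1.1 i) (resonance i * w.2) (w.1.2.1 i)
      ((fictMass mod m₀ m w.1.1 i)⁻¹ • w.1.2.2 i)).1,
   fun i => fictMass mod m₀ m w.1.1 i • (keplerStep (centMass mod m₀ m w.1.1 i) (resonance i * w.2)
      (w.1.2.1 i) ((fictMass mod m₀ m w.1.1 i)⁻¹ • w.1.2.2 i)).2)

variable {μ : ℝ} {y : Coords}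

/-- The definition of `resonantFlow` does not involve the elements, which are singular coordinates
at circular motions; in elements it is the translation of `δ₃`. -/
theorem resonantFlow_ofElementsParam (hm₀ : 0 < m₀) (hm : ∀ i, 0 < m i)
    (hp : (μ, y) ∈ separatedElements mod m₀ m) (t : ℝ) :
    resonantFlow mod m₀ m (ofElementsParam mod m₀ m (μ, y), t) =
      ofElements mod m₀ m μ (advance t y) := by
  obtain ⟨h1, h2, h3, -, -⟩ := hp
  dsimp only at h1 h2 h3
  have h : ∀ i, keplerStep (centMass mod m₀ m μ i) (resonance i * t)
      ((ofElements mod m₀ m μ y).1 i) ((fictMass mod m₀ m μ i)⁻¹ • (ofElements mod m₀ m μ y).2 i) =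
      (ellipsePos (semiMajor mod m₀ m μ y.1 i) (y.2.2.1 i) (meanAnom (advance t y).2.1 i)
        (argPeri y.2.2.2 i), ellipseVel (centMass mod m₀ m μ i) (semiMajor mod m₀ m μ y.1 i)
          (y.2.2.1 i) (meanAnom (advance t y).2.1 i) (argPeri y.2.2.2 i)) := by
    intro i
    rw [meanAnom_advance]
    simp only [ofElements]
    rw [inv_smul_smul₀ (fictMass_pos hm₀ hm (h1 i)).ne']
    exact keplerStep_ellipse (semiMajor_pos hm₀ hm (h1 i) (h2 i)) (centMass_pos hm₀ (h1 i)) (h3 i)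
      _ _ _
  simp only [resonantFlow, ofElementsParam, h]
  rfl

theorem contDiffAt_resonantFlow (hm₀ : 0 < m₀) (hm : ∀ i, 0 < m i)
    (hp : (μ, y) ∈ separatedElements mod m₀ m) (t : ℝ) :
    ContDiffAt ℝ ω (resonantFlow mod m₀ m) (ofElementsParam mod m₀ m (μ, y), t) := by
  obtain ⟨h1, h2, h3, -, -⟩ := hp
  dsimp only at h1 h2 h3
  set w : (ℝ × PhaseSpace) × ℝ := (ofElementsParam mod m₀ m (μ, y), t) with hw
  have hβ : ∀ i, ContDiffAt ℝ ω
      (fun w : (ℝ × PhaseSpace) × ℝ => fictMass mod m₀ m w.1.1 i) w := fun i =>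
    contDiffAt_fictMass (by fun_prop) (h1 i)
  have hβ0 : ∀ i, fictMass mod m₀ m w.1.1 i ≠ 0 := fun i => (fictMass_pos hm₀ hm (h1 i)).ne'
  have hM : ∀ i, ContDiffAt ℝ ω
      (fun w : (ℝ × PhaseSpace) × ℝ => centMass mod m₀ m w.1.1 i) w := fun i =>
    contDiffAt_centMass (by fun_prop) i
  have hstep : ∀ i, ContDiffAt ℝ ω (fun w : (ℝ × PhaseSpace) × ℝ =>
      keplerStep (centMass mod m₀ m w.1.1 i) (resonance i * w.2) (w.1.2.1 i)
        ((fictMass mod m₀ m w.1.1 i)⁻¹ • w.1.2.2 i)) w := fun i =>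
    contDiffAt_keplerStep (hM i) (by fun_prop) (by fun_prop)
      (((hβ i).inv (hβ0 i)).smul (by fun_prop)) (centMass_pos hm₀ (h1 i))
      (semiMajor_pos hm₀ hm (h1 i) (h2 i)) (h3 i) (l := meanAnom y.2.1 i) (g := argPeri y.2.2.2 i)
      rfl (inv_smul_smul₀ (hβ0 i) _)
  exact ContDiffAt.prodMk (contDiffAt_pi.2 fun i => (hstep i).fst)
    (contDiffAt_pi.2 fun i => (hβ i).smul (hstep i).snd)

/-- The generating Hamiltonian of the averaging transformation, up to the factor `μ / ν`: it solves
the cohomological equation along the resonant circle action, and is analytic at circular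
motions. -/
def averagingHam (mod : Model) (m₀ : ℝ) (m : Fin 3 → ℝ) (w : ℝ × PhaseSpace) : ℝ :=
  1 / (2 * Real.pi) * ∫ t in (0 : ℝ)..(2 * Real.pi),
    (t - Real.pi) * hamPert mod m₀ m (resonantFlow mod m₀ m (w, t))

theorem contDiffAt_averagingHam (hm₀ : 0 < m₀) (hm : ∀ i, 0 < m i)
    (hp : (μ, y) ∈ separatedElements mod m₀ m) :
    ContDiffAt ℝ ω (averagingHam mod m₀ m) (ofElementsParam mod m₀ m (μ, y)) := by
  have h : ∀ t, ContDiffAt ℝ ω (fun w : (ℝ × PhaseSpace) × ℝ =>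
      (w.2 - Real.pi) * hamPert mod m₀ m (resonantFlow mod m₀ m w))
      (ofElementsParam mod m₀ m (μ, y), t) := by
    intro t
    have h1 : resonantFlow mod m₀ m (ofElementsParam mod m₀ m (μ, y), t) ∈ collisionFree := by
      rw [resonantFlow_ofElementsParam hm₀ hm hp]
      exact separatedElements.collisionFree hm₀ hm (advance_mem_separatedElements hp t)
    have hr := contDiffAt_resonantFlow hm₀ hm hp t
    have hh := contDiffAt_hamPert (mod := mod) (m₀ := m₀) (m := m) h1
    have h2 := ContDiffAt.comp _ hh hr
    have h4 : ContDiffAt ℝ ω (fun w : (ℝ × PhaseSpace) × ℝ => w.2 - Real.pi)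
      (ofElementsParam mod m₀ m (μ, y), t) := by fun_prop
    exact h4.mul h2
  have h3 := contDiffAt_omega_intervalIntegral Real.two_pi_pos.le fun t _ => h t
  exact contDiffAt_const.mul h3

theorem contDiff_hamPert_advance (hm₀ : 0 < m₀) (hm : ∀ i, 0 < m i)
    (hp : (μ, y) ∈ separatedElements mod m₀ m) :
    ContDiff ℝ ω (fun t => hamPert mod m₀ m (ofElements mod m₀ m μ (advance t y))) := by
  refine contDiff_iff_contDiffAt.2 fun t => ?_
  have hp' := advance_mem_separatedElements hp t
  have h0 : ContDiffAt ℝ ω (fun t => (μ, advance t y)) t :=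
    contDiffAt_const.prodMk (contDiff_advance y).contDiffAt
  have h1 := ContDiffAt.fun_comp (g := ofElementsParam mod m₀ m) (f := fun t => (μ, advance t y)) t
    (separatedElements.contDiffAt_ofElementsParam hm₀ hm hp') h0
  exact ContDiffAt.fun_comp (g := hamPert mod m₀ m)
    (f := fun t => (ofElementsParam mod m₀ m (μ, advance t y)).2) t
    (contDiffAt_hamPert (separatedElements.collisionFree hm₀ hm hp')) h1.snd

theorem avgδ₃_eq_integral_advance (f : Coords → ℝ) (y : Coords)
    (hf : Function.Periodic (fun t => f (advance t y)) (2 * Real.pi)) :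
    avgδ₃ f y = 1 / (2 * Real.pi) * ∫ t in (0 : ℝ)..(2 * Real.pi), f (advance t y) := by
  rw [avgδ₃]
  congr 1
  have h1 : ∀ t, f (y.1, Function.update y.2.1 2 t, y.2.2) = f (advance (t - y.2.1 2) y) := by
    intro t
    simp [advance]
  simp only [h1]
  rw [intervalIntegral.integral_comp_sub_right (fun t => f (advance t y))]
  have h2 := hf.intervalIntegral_add_eq (0 - y.2.1 2) 0
  rw [zero_add] at h2
  rw [← h2]
  congr 1
  ring

/-- The cohomological equation: the derivative of `averagingHam` along the resonant circle action
is the perturbation minus its average. -/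
theorem hasDerivAt_averagingHam_advance (hm₀ : 0 < m₀) (hm : ∀ i, 0 < m i)
    (hp : (μ, y) ∈ separatedElements mod m₀ m) :
    HasDerivAt (fun t => averagingHam mod m₀ m (ofElementsParam mod m₀ m (μ, advance t y)))
      (hamPert mod m₀ m (ofElements mod m₀ m μ y) -
        avgδ₃ (fun y => hamPert mod m₀ m (ofElements mod m₀ m μ y)) y) 0 := by
  have hper : Function.Periodic
      (fun t => hamPert mod m₀ m (ofElements mod m₀ m μ (advance t y))) (2 * Real.pi) :=
    fun t => congrArg (hamPert mod m₀ m) (periodic_ofElements_advance hp.2.2.1 t)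
  have h := hasDerivAt_integral_mul_periodic (contDiff_hamPert_advance hm₀ hm hp).continuous hper 0
  rw [avgδ₃_eq_integral_advance _ _ hper]
  simp only [advance_zero] at h
  refine h.congr_of_eventuallyEq (Eventually.of_forall fun s => ?_)
  simp only [averagingHam, resonantFlow_ofElementsParam hm₀ hm (advance_mem_separatedElements hp s),
    advance_advance]

/-- The velocity of the Keplerian motion of `keplerHam`, with the factor `c i` for the `i`-th
satellite. -/
def keplerField (mod : Model) (m₀ : ℝ) (m : Fin 3 → ℝ) (c : Fin 3 → ℝ) (w : ℝ × PhaseSpace) :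
    PhaseSpace :=
  (fun i => c i • (fictMass mod m₀ m w.1 i)⁻¹ • w.2.2 i,
   fun i => -(c i • (m₀ * m i / ‖w.2.1 i‖ ^ 3) • w.2.1 i))

theorem meanMotion_eq {D : Fin 3 → ℝ} {i : Fin 3} (ha : 0 < semiMajor mod m₀ m μ D i) :
    meanMotion mod m₀ m μ D i = Real.sqrt (centMass mod m₀ m μ i / semiMajor mod m₀ m μ D i) /
      semiMajor mod m₀ m μ D i := by
  rw [meanMotion, ← Real.sqrt_sq ha.le, ← Real.sqrt_div' _ (sq_nonneg _), Real.sqrt_sq ha.le]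
  congr 1
  field_simp

/-- The translation of `δ₃` moves the `i`-th satellite along its Keplerian motion, at speed
`k_i / n_i` if the frequencies are `n_i` and the resonance is `k = (4, 2, 1)`. -/
theorem hasDerivAt_ofElements_advance (hm₀ : 0 < m₀) (hm : ∀ i, 0 < m i)
    (hp : (μ, y) ∈ separatedElements mod m₀ m) :
    HasDerivAt (fun t => ofElements mod m₀ m μ (advance t y))
      (keplerField mod m₀ m (fun i => resonance i / meanMotion mod m₀ m μ y.1 i)
        (ofElementsParam mod m₀ m (μ, y))) 0 := by
  obtain ⟨h1, h2, h3, -, -⟩ := hp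
  dsimp only at h1 h2 h3
  have ha := fun i => semiMajor_pos (mod := mod) hm₀ hm (h1 i) (h2 i)
  have hM := fun i => centMass_pos (mod := mod) hm₀ (h1 i)
  have hβ := fun i => fictMass_pos (mod := mod) hm₀ hm (h1 i)
  have hl : ∀ i, HasDerivAt (fun t => meanAnom (advance t y).2.1 i) (resonance i) 0 := fun i => by
    simp only [meanAnom_advance]
    simpa using ((hasDerivAt_id (0 : ℝ)).const_mul (resonance i)).const_add (meanAnom y.2.1 i)
  have hl0 : ∀ i, meanAnom y.2.1 i = meanAnom (advance 0 y).2.1 i := fun i => by rw [advance_zero]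
  refine HasDerivAt.prodMk (hasDerivAt_pi.2 fun i => ?_) (hasDerivAt_pi.2 fun i => ?_)
  · have h := hasDerivAt_ellipsePos (ha i) (hM i) (h3 i) (meanAnom y.2.1 i) (argPeri y.2.2.2 i)
    rw [hl0] at h
    refine (HasDerivAt.scomp (0 : ℝ) h (hl i)).congr_deriv ?_
    simp only [ofElementsParam, ofElements, advance_zero]
    rw [meanMotion_eq (ha i), inv_smul_smul₀ (hβ i).ne', smul_smul]
    congr 1
    field_simp
  · have h := hasDerivAt_ellipseVel (ha i) (hM i) (h3 i) (meanAnom y.2.1 i) (argPeri y.2.2.2 i)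
    nth_rewrite 3 [hl0] at h
    refine ((HasDerivAt.scomp (0 : ℝ) h (hl i)).const_smul (fictMass mod m₀ m μ i)).congr_deriv ?_
    simp only [ofElementsParam, ofElements]
    rw [meanMotion_eq (ha i), ← fictMass_mul_centMass (mod := mod) (h1 i), smul_smul, smul_smul,
      smul_smul, ← neg_smul]
    congr 1
    field_simp

theorem phaseDeriv_keplerHam (hm₀ : 0 < m₀) (hm : ∀ i, 0 < m i) {w : ℝ × PhaseSpace}
    (hμ : ∀ i, 0 < m₀ + w.1 * m i) (hz : w.2 ∈ collisionFree) (v : PhaseSpace) :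
    phaseDeriv (keplerHam mod m₀ m) w v =
      ∑ i, ((fictMass mod m₀ m w.1 i)⁻¹ * inner ℝ (w.2.2 i) (v.2 i) +
        m₀ * m i / ‖w.2.1 i‖ ^ 3 * inner ℝ (w.2.1 i) (v.1 i)) := by
  obtain ⟨μ, z⟩ := w
  have h1 : HasFDerivAt (fun z => keplerHam mod m₀ m (μ, z)) _ z := hasFDerivAt_phaseDeriv
    ((contDiffAt_keplerHam (mod := mod) hm₀ hm hμ hz).differentiableAt (by simp))
  have hγ : HasDerivAt (fun s : ℝ => z + s • v) v 0 := by
    simpa using ((hasDerivAt_id (0 : ℝ)).smul_const v).const_add z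
  have h0 : z = z + (0 : ℝ) • v := by simp
  nth_rewrite 2 [h0] at h1
  have h2 := h1.comp_hasDerivAt (0 : ℝ) hγ
  refine h2.unique ?_
  have hterm : ∀ i, HasDerivAt (fun s : ℝ =>
      ‖z.2 i + s • v.2 i‖ ^ 2 / (2 * fictMass mod m₀ m μ i) - m₀ * m i / ‖z.1 i + s • v.1 i‖)
      ((fictMass mod m₀ m μ i)⁻¹ * inner ℝ (z.2 i) (v.2 i) +
        m₀ * m i / ‖z.1 i‖ ^ 3 * inner ℝ (z.1 i) (v.1 i)) 0 := by
    intro i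
    have hβ : 0 < fictMass mod m₀ m μ i := fictMass_pos hm₀ hm (hμ i)
    have hq0 : 0 < ‖z.1 i‖ := norm_pos_iff.2 (hz.1 i)
    have hline : ∀ a b : Plane, HasDerivAt (fun s : ℝ => a + s • b) b 0 := fun a b => by
      simpa using ((hasDerivAt_id (0 : ℝ)).smul_const b).const_add a
    have hp := (hline (z.2 i) (v.2 i)).norm_sq
    have hq := (hline (z.1 i) (v.1 i)).norm_sq.sqrt (by simpa using hz.1 i)
    simp only [Real.sqrt_sq (norm_nonneg _)] at hq
    simp only [zero_smul, add_zero] at hp hq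
    refine ((hp.div_const _).sub ((hasDerivAt_const (0 : ℝ) (m₀ * m i)).div hq
      (by simpa using hz.1 i))).congr_deriv ?_
    simp only [zero_smul, add_zero]
    field_simp
    ring
  exact HasDerivAt.fun_sum (u := Finset.univ) fun i _ => hterm i

theorem hamVector_phaseDeriv_keplerHam (hm₀ : 0 < m₀) (hm : ∀ i, 0 < m i) {w : ℝ × PhaseSpace}
    (hμ : ∀ i, 0 < m₀ + w.1 * m i) (hz : w.2 ∈ collisionFree) :
    hamVector (phaseDeriv (keplerHam mod m₀ m) w) = keplerField mod m₀ m (fun _ => 1) w := by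
  refine Prod.ext (funext fun i => ?_) (funext fun i => ?_) <;> ext a
  · rw [hamVector_fst, phaseDeriv_keplerHam hm₀ hm hμ hz]
    simp only [keplerField, Pi.zero_apply, inner_zero_right, mul_zero, add_zero]
    rw [Finset.sum_eq_single i (fun j _ hj => by simp [Pi.single_eq_of_ne hj]) (by simp)]
    simp [EuclideanSpace.inner_single_right]
  · rw [hamVector_snd, phaseDeriv_keplerHam hm₀ hm hμ hz]
    simp only [keplerField, Pi.zero_apply, inner_zero_right, mul_zero, zero_add]
    rw [Finset.sum_eq_single i (fun j _ hj => by simp [Pi.single_eq_of_ne hj]) (by simp)]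
    simp [EuclideanSpace.inner_single_right]

end Resonance

/-! ### Uniformity near the resonant tori -/

section ResonantBox

variable {mod : Model} {m₀ : ℝ} {m : Fin 3 → ℝ}

/-- Values `(δ, e, η)` with angles in `[0, 2π]` and eccentricities in `[e₀, E]`. -/
def elementsBox (e₀ E : ℝ) : Set ((Fin 3 → ℝ) × (Fin 3 → ℝ) × (Fin 3 → ℝ)) :=
  Icc 0 (fun _ => 2 * Real.pi) ×ˢ Icc (fun _ => e₀) (fun _ => E) ×ˢ Icc 0 (fun _ => 2 * Real.pi)

/-- The elements of the resonant tori `D = D⁰` at `μ = 0`, with angles in `[0, 2π]` and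
eccentricities in `[e₀, E]`. -/
def resonantBox (D : Fin 3 → ℝ) (e₀ E : ℝ) : Set (ℝ × Coords) :=
  {0} ×ˢ {D} ×ˢ elementsBox e₀ E

theorem isCompact_resonantBox (D : Fin 3 → ℝ) (e₀ E : ℝ) : IsCompact (resonantBox D e₀ E) :=
  isCompact_singleton.prod (isCompact_singleton.prod
    (isCompact_Icc.prod (isCompact_Icc.prod isCompact_Icc)))

theorem exists_forall_mem_of_mem_nhdsSet {D : Fin 3 → ℝ} {e₀ E : ℝ} {U : Set (ℝ × Coords)}
    (hU : U ∈ 𝓝ˢ (resonantBox D e₀ E)) :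
    ∃ ε > 0, ∀ μ : ℝ, |μ| < ε → ∀ D', ‖D' - D‖ < ε → ∀ b ∈ elementsBox e₀ E, (μ, D', b) ∈ U := by
  obtain ⟨V, hVo, hSV, hVU⟩ := mem_nhdsSet_iff_exists.1 hU
  obtain ⟨ε, hε, h⟩ := (isCompact_resonantBox D e₀ E).exists_thickening_subset_open hVo hSV
  refine ⟨ε, hε, fun μ hμ D' hD' b hb => hVU (h ?_)⟩
  rw [Metric.mem_thickening_iff]
  refine ⟨(0, D, b), ⟨rfl, rfl, hb⟩, ?_⟩
  simpa [Prod.dist_eq, dist_eq_norm, hε] using ⟨hμ, hD'⟩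

theorem Separated.mem_separatedElements {μ E : ℝ} {D δ e η : Fin 3 → ℝ}
    (hsep : Separated E (semiMajor mod m₀ m μ D)) (hE₁ : E < 1) (hμ : ∀ i, 0 < m₀ + μ * m i)
    (hD : ∀ i, 0 < circMom D i) (he : ∀ i, |e i| ≤ E) :
    (μ, D, δ, e, η) ∈ separatedElements mod m₀ m := by
  obtain ⟨ha0, h01, h12, hs1, hs2⟩ := hsep
  have ha1 := ha0.trans h01
  have ha2 := ha1.trans h12
  have hE1 : 0 < 1 - E := sub_pos.2 hE₁
  rw [div_lt_one (by positivity)] at hs1 hs2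
  refine ⟨hμ, hD, fun i => (he i).trans_lt hE₁, ?_, ?_⟩
  · calc semiMajor mod m₀ m μ D 0 * (1 + |e 0|) ≤ semiMajor mod m₀ m μ D 0 * (1 + E) := by
          gcongr; exact he 0
      _ < semiMajor mod m₀ m μ D 1 * (1 - E) := hs1
      _ ≤ _ := by gcongr; exact he 1
  · calc semiMajor mod m₀ m μ D 1 * (1 + |e 1|) ≤ semiMajor mod m₀ m μ D 1 * (1 + E) := by
          gcongr; exact he 1
      _ < semiMajor mod m₀ m μ D 2 * (1 - E) := hs2
      _ ≤ _ := by gcongr; exact he 2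

theorem resonantBox_subset_separatedElements (hm₀ : 0 < m₀) {D : Fin 3 → ℝ}
    {E e₀ : ℝ} (he₀ : 0 ≤ e₀) (hE₁ : E < 1) (hD : ∀ i, 0 < circMom D i)
    (hsep : Separated E (semiMajor mod m₀ m 0 D)) :
    resonantBox D e₀ E ⊆ separatedElements mod m₀ m := by
  rintro ⟨μ, D', δ, e, η⟩ ⟨hμ, hD', hδ, he, hη⟩
  rw [mem_singleton_iff] at hμ hD'
  subst hμ hD'
  refine hsep.mem_separatedElements hE₁ (fun i => by simpa using hm₀) hD fun i => ?_
  rw [abs_of_nonneg (he₀.trans (he.1 i))]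
  exact he.2 i

/-- Equality of angles modulo `2π`, for triples of angles. -/
def AngleCongr (θ θ' : Fin 3 → ℝ) : Prop :=
  ∃ k : Fin 3 → ℤ, ∀ i, θ' i = θ i + k i * (2 * Real.pi)

theorem exists_angleCongr_mem_Icc (θ : Fin 3 → ℝ) :
    ∃ θ' ∈ Icc (0 : Fin 3 → ℝ) (fun _ => 2 * Real.pi), AngleCongr θ θ' := by
  have h : ∀ i, ∃ k : ℤ, θ i + k * (2 * Real.pi) ∈ Ico (0 : ℝ) (0 + 2 * Real.pi) := fun i => by
    obtain ⟨k, hk, -⟩ := existsUnique_add_zsmul_mem_Ico Real.two_pi_pos (θ i) 0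
    exact ⟨k, by simpa using hk⟩
  choose k hk using h
  refine ⟨fun i => θ i + k i * (2 * Real.pi), ⟨fun i => (hk i).1, fun i => ?_⟩, k, fun i => rfl⟩
  have := (hk i).2
  rw [zero_add] at this
  exact this.le

theorem AngleCongr.meanAnom {δ δ' : Fin 3 → ℝ} (h : AngleCongr δ δ') (i : Fin 3) :
    ∃ k : ℤ, SatelliteProblem.meanAnom δ' i =
      SatelliteProblem.meanAnom δ i + k * (2 * Real.pi) := by
  obtain ⟨k, hk⟩ := h
  fin_cases i
  · exact ⟨k 0 + 2 * k 1 + 4 * k 2, by simp [SatelliteProblem.meanAnom, hk]; ring⟩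
  · exact ⟨k 1 + 2 * k 2, by simp [SatelliteProblem.meanAnom, hk]; ring⟩
  · exact ⟨k 2, by simp [SatelliteProblem.meanAnom, hk]⟩

theorem AngleCongr.argPeri {δ δ' : Fin 3 → ℝ} (h : AngleCongr δ δ') (i : Fin 3) :
    ∃ k : ℤ, SatelliteProblem.argPeri δ' i =
      SatelliteProblem.argPeri δ i + k * (2 * Real.pi) := by
  obtain ⟨k, hk⟩ := h
  fin_cases i
  · exact ⟨k 0 + k 1 + k 2, by simp [SatelliteProblem.argPeri, hk]; ring⟩
  · exact ⟨k 1 + k 2, by simp [SatelliteProblem.argPeri, hk]; ring⟩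
  · exact ⟨k 2, by simp [SatelliteProblem.argPeri, hk]⟩

theorem ofElements_angleCongr {μ : ℝ} {D δ δ' e η η' : Fin 3 → ℝ} (he : ∀ i, |e i| < 1)
    (hδ : AngleCongr δ δ') (hη : AngleCongr η η') :
    ofElements mod m₀ m μ (D, δ', e, η') = ofElements mod m₀ m μ (D, δ, e, η) :=
  ofElements_congr rfl rfl he hδ.meanAnom hη.argPeri

theorem meanMotion_eq_div {μ : ℝ} {D : Fin 3 → ℝ} {i : Fin 3} (hm₀ : 0 < m₀) (hm : ∀ i, 0 < m i)
    (hμ : 0 < m₀ + μ * m i) (hD : 0 < circMom D i) :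
    meanMotion mod m₀ m μ D i =
      centMass mod m₀ m μ i ^ 2 * fictMass mod m₀ m μ i ^ 3 / circMom D i ^ 3 := by
  have h1 := fictMass_pos (mod := mod) hm₀ hm hμ
  have h2 := centMass_pos (mod := mod) hm₀ hμ
  rw [meanMotion, semiMajor, Real.sqrt_eq_iff_mul_self_eq (by positivity) (by positivity)]
  field_simp

theorem IsResonant.meanMotion_eq {μ ν : ℝ} {D : Fin 3 → ℝ} (h : IsResonant mod m₀ m μ ν D)
    (i : Fin 3) : meanMotion mod m₀ m μ D i = resonance i * ν := by
  obtain ⟨-, h0, h1, h2⟩ := h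
  fin_cases i <;> simp [resonance, h0, h1, h2]

theorem resonance_pos (i : Fin 3) : 0 < resonance i := by
  fin_cases i <;> simp [resonance]

theorem add_mul_pos {μ : ℝ} (hm₀ : 0 < m₀) (hm : ∀ i, 0 < m i) (hμ : 0 ≤ μ) (i : Fin 3) :
    0 < m₀ + μ * m i := by
  have := hm i
  positivity

/-- Kepler's third law determines the resonant tori. -/
theorem IsResonant.circMom_eq {μ ν : ℝ} {D : Fin 3 → ℝ} (hm₀ : 0 < m₀) (hm : ∀ i, 0 < m i)
    (hν : 0 < ν) (hμ : 0 ≤ μ) (h : IsResonant mod m₀ m μ ν D) (i : Fin 3) :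
    circMom D i = (centMass mod m₀ m μ i ^ 2 * fictMass mod m₀ m μ i ^ 3 / (resonance i * ν)) ^
      (1 / 3 : ℝ) := by
  have hμ' := add_mul_pos hm₀ hm hμ i
  have hD := h.1 i
  have h1 := h.meanMotion_eq i
  rw [meanMotion_eq_div hm₀ hm hμ' hD, div_eq_iff (by positivity)] at h1
  have h2 := mul_pos (resonance_pos i) hν
  rw [h1, mul_div_cancel_left₀ _ h2.ne', one_div, ← Real.rpow_natCast, ← Real.rpow_mul hD.le]
  norm_num

theorem tendsto_resonant {ν : ℝ} {D₀ : ℝ → Fin 3 → ℝ} (hm₀ : 0 < m₀) (hm : ∀ i, 0 < m i)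
    (hν : 0 < ν) (hD₀ : ∀ μ, 0 ≤ μ → IsResonant mod m₀ m μ ν (D₀ μ)) :
    Tendsto D₀ (𝓝[≥] 0) (𝓝 (D₀ 0)) := by
  have hL : ∀ i, Tendsto (fun μ => circMom (D₀ μ) i) (𝓝[≥] 0) (𝓝 (circMom (D₀ 0) i)) := by
    intro i
    have hμ' : 0 < m₀ + (0 : ℝ) * m i := by simpa using hm₀
    have hβ := fictMass_pos (mod := mod) hm₀ hm hμ'
    have hM := centMass_pos (mod := mod) hm₀ hμ'
    have h2 := mul_pos (resonance_pos i) hν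
    have hc : ContinuousAt (fun μ => (centMass mod m₀ m μ i ^ 2 * fictMass mod m₀ m μ i ^ 3 /
        (resonance i * ν)) ^ (1 / 3 : ℝ)) 0 := by
      have h3 : ContinuousAt (fun μ => centMass mod m₀ m μ i) 0 :=
        (contDiffAt_centMass contDiffAt_id i).continuousAt
      have h4 : ContinuousAt (fun μ => fictMass mod m₀ m μ i) 0 :=
        (contDiffAt_fictMass contDiffAt_id hμ').continuousAt
      exact (((h3.pow 2).mul (h4.pow 3)).div_const _).rpow_const
        (Or.inl (div_pos (mul_pos (pow_pos hM 2) (pow_pos hβ 3)) h2).ne')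
    rw [(hD₀ 0 le_rfl).circMom_eq hm₀ hm hν le_rfl i]
    refine (hc.tendsto.mono_left nhdsWithin_le_nhds).congr' ?_
    filter_upwards [self_mem_nhdsWithin] with μ hμ
    exact ((hD₀ μ hμ).circMom_eq hm₀ hm hν hμ i).symm
  have h1 : ∀ D : Fin 3 → ℝ, D 1 = circMom D 1 + 2 * circMom D 0 := fun D => by simp [circMom]
  have h2 : ∀ D : Fin 3 → ℝ, D 2 = circMom D 2 + 2 * (circMom D 1 + 2 * circMom D 0) :=
    fun D => by simp [circMom]
  refine tendsto_pi_nhds.2 fun i => ?_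
  fin_cases i
  · exact hL 0
  · have h := (hL 1).add ((hL 0).const_mul 2)
    rw [← h1 (D₀ 0)] at h
    exact h.congr fun μ => (h1 (D₀ μ)).symm
  · have h := (hL 2).add (((hL 1).add ((hL 0).const_mul 2)).const_mul 2)
    rw [← h2 (D₀ 0)] at h
    exact h.congr fun μ => (h2 (D₀ μ)).symm

/-- On the neighbourhoods of radius `C₁ μ` of the resonant tori, the Keplerian frequencies are
resonant up to `O(μ)`. -/
theorem exists_abs_meanMotion_ratio_le {ν C₁ : ℝ} {D₀ : ℝ → Fin 3 → ℝ} (hm₀ : 0 < m₀)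
    (hm : ∀ i, 0 < m i) (hν : 0 < ν) (hC₁ : 0 < C₁)
    (hD₀ : ∀ μ, 0 ≤ μ → IsResonant mod m₀ m μ ν (D₀ μ)) :
    ∃ C ≥ 0, ∀ᶠ μ in 𝓝[>] (0 : ℝ), ∀ D, ‖D - D₀ μ‖ < C₁ * μ → ∀ i,
      |1 - ν * (resonance i / meanMotion mod m₀ m μ D i)| ≤ C * μ := by
  have htend := (tendsto_resonant hm₀ hm hν hD₀).mono_left (nhdsWithin_mono 0 Ioi_subset_Ici_self)
  have hi : ∀ i, ∃ C ≥ 0, ∀ᶠ μ in 𝓝[>] (0 : ℝ), ∀ D, ‖D - D₀ μ‖ < C₁ * μ →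
      |1 - ν * (resonance i / meanMotion mod m₀ m μ D i)| ≤ C * μ := by
    intro i
    -- The ratio is `1` at `D₀ μ`, and is Lipschitz in `(μ, D)` near `(0, D₀ 0)`.
    let r : ℝ × (Fin 3 → ℝ) → ℝ := fun p =>
      ν * (resonance i * circMom p.2 i ^ 3 /
        (centMass mod m₀ m p.1 i ^ 2 * fictMass mod m₀ m p.1 i ^ 3))
    have hμ' : 0 < m₀ + (0 : ℝ) * m i := by simpa using hm₀
    have hβ := fictMass_pos (mod := mod) hm₀ hm hμ'
    have hM := centMass_pos (mod := mod) hm₀ hμ'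
    have hr : ContDiffAt ℝ 1 r (0, D₀ 0) := by
      have h1 : ContDiffAt ℝ ω (fun p : ℝ × (Fin 3 → ℝ) => circMom p.2 i) (0, D₀ 0) :=
        contDiffAt_circMom contDiffAt_snd i
      have h2 : ContDiffAt ℝ ω (fun p : ℝ × (Fin 3 → ℝ) => centMass mod m₀ m p.1 i) (0, D₀ 0) :=
        contDiffAt_centMass contDiffAt_fst i
      have h3 : ContDiffAt ℝ ω (fun p : ℝ × (Fin 3 → ℝ) => fictMass mod m₀ m p.1 i) (0, D₀ 0) :=
        contDiffAt_fictMass contDiffAt_fst hμ'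
      have h4 : ContDiffAt ℝ ω r (0, D₀ 0) :=
        contDiffAt_const.mul ((contDiffAt_const.mul (h1.pow 3)).div ((h2.pow 2).mul (h3.pow 3))
          (mul_pos (pow_pos hM 2) (pow_pos hβ 3)).ne')
      exact h4.of_le le_top
    obtain ⟨K, t, ht, hK⟩ := hr.exists_lipschitzOnWith
    obtain ⟨ε, hε, hball⟩ := Metric.mem_nhds_iff.1 ht
    have hLpos : ∀ᶠ D in 𝓝 (D₀ 0), 0 < circMom D i :=
      continuousAt_const.eventually_lt
        (contDiffAt_circMom (f := fun D => D) contDiffAt_id i).continuousAt ((hD₀ 0 le_rfl).1 i)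
    obtain ⟨ε', hε', hball'⟩ := Metric.mem_nhds_iff.1 hLpos
    refine ⟨K * C₁, by positivity, ?_⟩
    have hev1 : ∀ᶠ μ in 𝓝[>] (0 : ℝ), dist (D₀ μ) (D₀ 0) < min ε ε' / 2 :=
      htend (Metric.ball_mem_nhds _ (by positivity))
    have hev2 : ∀ᶠ μ in 𝓝[>] (0 : ℝ), μ < min ε (min ε ε' / 2 / C₁) :=
      nhdsWithin_le_nhds (Iio_mem_nhds (by positivity))
    filter_upwards [hev1, hev2, self_mem_nhdsWithin] with μ h1 h2 hμ D hD
    rw [mem_Ioi] at hμ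
    have hμm := add_mul_pos hm₀ hm hμ.le i
    have hC : C₁ * μ < min ε ε' / 2 := by
      have := h2.trans_le (min_le_right _ _)
      rw [lt_div_iff₀ hC₁] at this
      linarith
    have hDd : dist D (D₀ 0) < min ε ε' := by
      have h3 := dist_triangle D (D₀ μ) (D₀ 0)
      rw [dist_eq_norm D (D₀ μ)] at h3
      linarith
    have hDd0 : dist (D₀ μ) (D₀ 0) < min ε ε' := h1.trans (half_lt_self (by positivity))
    have hmem : ∀ D, dist D (D₀ 0) < min ε ε' → (μ, D) ∈ t := by
      intro D hD
      apply hball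
      rw [Metric.mem_ball, Prod.dist_eq, max_lt_iff]
      exact ⟨by simpa [abs_of_pos hμ] using h2.trans_le (min_le_left _ _),
        hD.trans_le (min_le_left _ _)⟩
    have hval : ∀ D, dist D (D₀ 0) < min ε ε' →
        r (μ, D) = ν * (resonance i / meanMotion mod m₀ m μ D i) := by
      intro D hD
      have hL : 0 < circMom D i := hball' (hD.trans_le (min_le_right _ _))
      rw [meanMotion_eq_div hm₀ hm hμm hL]
      simp only [r]
      rw [div_div_eq_mul_div]
    have hone : r (μ, D₀ μ) = 1 := by
      rw [hval _ hDd0, (hD₀ μ hμ.le).meanMotion_eq i]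
      have := resonance_pos i
      field_simp
    have h4 := hK.dist_le_mul _ (hmem _ hDd0) _ (hmem _ hDd)
    rw [hone, hval _ hDd, Real.dist_eq] at h4
    refine h4.trans ?_
    rw [mul_assoc]
    gcongr
    rw [dist_comm, Prod.dist_eq, dist_self, max_eq_right dist_nonneg, dist_eq_norm]
    exact hD.le
  choose C hC0 hC using hi
  refine ⟨∑ i, C i, Finset.sum_nonneg fun i _ => hC0 i, ?_⟩
  filter_upwards [eventually_all.2 hC, self_mem_nhdsWithin] with μ h hμ D hD i
  refine (h i D hD).trans ?_
  rw [mem_Ioi] at hμ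
  gcongr
  exact Finset.single_le_sum (fun i _ => hC0 i) (Finset.mem_univ i)

theorem ecc_nonneg (D Z : Fin 3 → ℝ) (i : Fin 3) : 0 ≤ ecc D Z i := Real.sqrt_nonneg _

/-- Points of the domain close to the resonant tori have elements, up to multiples of `2π` for the
angles, that are close to the compact box. -/
theorem exists_elements_of_mem_resonantNhd {ν C₁ E : ℝ} {D₀ : ℝ → Fin 3 → ℝ} (hm₀ : 0 < m₀)
    (hm : ∀ i, 0 < m i) (hν : 0 < ν)
    (hD₀ : ∀ μ, 0 ≤ μ → IsResonant mod m₀ m μ ν (D₀ μ)) {ε : ℝ} (hε : 0 < ε) :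
    ∀ᶠ μ in 𝓝[>] (0 : ℝ), |μ| < ε ∧ ∀ x ∈ resonantNhd mod m₀ m μ E (D₀ μ) (C₁ * μ),
      ‖x.1 - D₀ 0‖ < ε ∧ ∀ e₀, (∀ i, e₀ ≤ ecc x.1 x.2.2.1 i) →
        ∃ δ η, AngleCongr x.2.1 δ ∧ AngleCongr x.2.2.2 η ∧
          (δ, ecc x.1 x.2.2.1, η) ∈ elementsBox e₀ E := by
  have htend := (tendsto_resonant hm₀ hm hν hD₀).mono_left (nhdsWithin_mono 0 Ioi_subset_Ici_self)
  have hev1 : ∀ᶠ μ in 𝓝[>] (0 : ℝ), dist (D₀ μ) (D₀ 0) < ε / 2 :=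
    htend (Metric.ball_mem_nhds _ (by positivity))
  have hev2 : ∀ᶠ μ in 𝓝[>] (0 : ℝ), C₁ * μ < ε / 2 := by
    have h : ContinuousAt (fun μ : ℝ => C₁ * μ) 0 := by fun_prop
    exact nhdsWithin_le_nhds (h.eventually_lt continuousAt_const (by simpa using hε))
  have hev3 : ∀ᶠ μ in 𝓝[>] (0 : ℝ), μ < ε := nhdsWithin_le_nhds (Iio_mem_nhds hε)
  filter_upwards [hev1, hev2, hev3, self_mem_nhdsWithin] with μ h1 h2 h3 hμ
  rw [mem_Ioi] at hμ
  refine ⟨by rwa [abs_of_pos hμ], fun x hx => ⟨?_, fun e₀ he₀ => ?_⟩⟩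
  · have h4 := dist_triangle x.1 (D₀ μ) (D₀ 0)
    rw [dist_eq_norm, dist_eq_norm x.1] at h4
    have := hx.2
    linarith
  · obtain ⟨δ, hδ, hδ'⟩ := exists_angleCongr_mem_Icc x.2.1
    obtain ⟨η, hη, hη'⟩ := exists_angleCongr_mem_Icc x.2.2.2
    exact ⟨δ, η, hδ', hη', hδ, ⟨he₀, fun i => (hx.1.2.1 i).le⟩, hη⟩

end ResonantBox

/-! ### The averaged perturbation and its truncation in the eccentricities -/

section AveragedPerturbation

variable {mod : Model} {m₀ : ℝ} {m : Fin 3 → ℝ}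

/-- The average over `δ₃` of the perturbation divided by `μ`, as a function of `μ` and
`(D, δ, e, η)`. -/
def avgPert (mod : Model) (m₀ : ℝ) (m : Fin 3 → ℝ) (p : ℝ × Coords) : ℝ :=
  avgδ₃ (fun y => hamPert mod m₀ m (ofElements mod m₀ m p.1 y)) p.2

theorem contDiffAt_avgPert (hm₀ : 0 < m₀) (hm : ∀ i, 0 < m i) {μ : ℝ} {y : Coords}
    (hp : (μ, y) ∈ separatedElements mod m₀ m) :
    ContDiffAt ℝ ω (avgPert mod m₀ m) (μ, y) := by
  have h : ∀ t, ContDiffAt ℝ ω (fun w : (ℝ × Coords) × ℝ => hamPert mod m₀ m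
      (ofElements mod m₀ m w.1.1 (w.1.2.1, Function.update w.1.2.2.1 2 w.2, w.1.2.2.2)))
      ((μ, y), t) := by
    intro t
    have hp' : (μ, y.1, Function.update y.2.1 2 t, y.2.2) ∈ separatedElements mod m₀ m := hp
    have h0 : ContDiffAt ℝ ω (fun w : (ℝ × Coords) × ℝ => Function.update w.1.2.2.1 2 w.2)
        ((μ, y), t) := by
      refine contDiffAt_pi.2 fun i => ?_
      by_cases hi : i = 2
      · subst hi
        simp only [Function.update_self]
        fun_prop
      · simp only [Function.update_of_ne hi]
        fun_prop
    have h1 : ContDiffAt ℝ ω (fun w : (ℝ × Coords) × ℝ =>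
        (w.1.1, w.1.2.1, Function.update w.1.2.2.1 2 w.2, w.1.2.2.2)) ((μ, y), t) :=
      ContDiffAt.prodMk (by fun_prop) (ContDiffAt.prodMk (by fun_prop)
        (h0.prodMk (by fun_prop)))
    have h2 := ContDiffAt.fun_comp (g := ofElementsParam mod m₀ m) (f := fun w : (ℝ × Coords) × ℝ =>
        (w.1.1, w.1.2.1, Function.update w.1.2.2.1 2 w.2, w.1.2.2.2)) ((μ, y), t)
      (separatedElements.contDiffAt_ofElementsParam hm₀ hm hp') h1
    exact ContDiffAt.fun_comp (g := hamPert mod m₀ m) (f := fun w : (ℝ × Coords) × ℝ =>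
        (ofElementsParam mod m₀ m
          (w.1.1, w.1.2.1, Function.update w.1.2.2.1 2 w.2, w.1.2.2.2)).2) ((μ, y), t)
      (contDiffAt_hamPert (separatedElements.collisionFree hm₀ hm hp')) h2.snd
  exact contDiffAt_const.mul
    (contDiffAt_omega_intervalIntegral Real.two_pi_pos.le fun t _ => h t)

theorem avgPert_angleCongr {μ : ℝ} {D δ δ' e η η' : Fin 3 → ℝ} (he : ∀ i, |e i| < 1)
    (hδ : AngleCongr δ δ') (hη : AngleCongr η η') :
    avgPert mod m₀ m (μ, D, δ', e, η') = avgPert mod m₀ m (μ, D, δ, e, η) := by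
  simp only [avgPert, avgδ₃]
  congr 2
  ext t
  obtain ⟨k, hk⟩ := hδ
  rw [ofElements_angleCongr he ⟨Function.update k 2 0, fun i => ?_⟩ hη]
  by_cases hi : i = 2
  · subst hi
    simp
  · simp [Function.update_of_ne hi, hk]

/-- The truncation of `avgPert` at first order in the eccentricities. -/
def truncPert (mod : Model) (m₀ : ℝ) (m : Fin 3 → ℝ) (p : ℝ × Coords) : ℝ :=
  avgPert mod m₀ m (p.1, p.2.1, p.2.2.1, 0, p.2.2.2.2) +
    fderiv ℝ (avgPert mod m₀ m) (p.1, p.2.1, p.2.2.1, 0, p.2.2.2.2) (0, 0, 0, p.2.2.2.1, 0)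

theorem contDiffAt_truncPert (hm₀ : 0 < m₀) (hm : ∀ i, 0 < m i) {μ : ℝ} {D δ e η : Fin 3 → ℝ}
    (hp : (μ, D, δ, 0, η) ∈ separatedElements mod m₀ m) :
    ContDiffAt ℝ ω (truncPert mod m₀ m) (μ, D, δ, e, η) := by
  have h := contDiffAt_avgPert hm₀ hm hp
  have h0 : ContDiffAt ℝ ω
      (fun p : ℝ × Coords => ((p.1, p.2.1, p.2.2.1, 0, p.2.2.2.2) : ℝ × Coords)) (μ, D, δ, e, η) := by
    fun_prop
  have h1 := ContDiffAt.fun_comp (g := avgPert mod m₀ m) (μ, D, δ, e, η) h h0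
  have h2 := ContDiffAt.fun_comp (g := fderiv ℝ (avgPert mod m₀ m)) (μ, D, δ, e, η)
    (h.fderiv_right (m := ω) le_rfl) h0
  exact h1.add (h2.clm_apply (by fun_prop))

/-- A derivative at `e = 0` involves eccentricities of both signs, for which `avgPert` is still
periodic in the angles. -/
theorem truncPert_angleCongr {μ : ℝ} {D δ δ' e η η' : Fin 3 → ℝ}
    (hδ : AngleCongr δ δ') (hη : AngleCongr η η') :
    truncPert mod m₀ m (μ, D, δ', e, η') = truncPert mod m₀ m (μ, D, δ, e, η) := by
  simp only [truncPert]
  rw [avgPert_angleCongr (by simp) hδ hη]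
  congr 1
  set c : ℝ × Coords := (0, 0, δ' - δ, 0, η' - η) with hc
  have h1 : ((μ, D, δ', 0, η') : ℝ × Coords) = (μ, D, δ, 0, η) + c := by simp [hc]
  have h2 : (fun p => avgPert mod m₀ m (p + c)) =ᶠ[𝓝 (μ, D, δ, 0, η)] avgPert mod m₀ m := by
    have h3 : ∀ᶠ p : ℝ × Coords in 𝓝 (μ, D, δ, 0, η), ∀ i, |p.2.2.2.1 i| < 1 :=
      eventually_all.2 fun i => ContinuousAt.eventually_lt
        (by fun_prop : Continuous fun p : ℝ × Coords => |p.2.2.2.1 i|).continuousAt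
        continuousAt_const (by simp)
    filter_upwards [h3] with ⟨μ', D', δ₁, e', η₁⟩ h
    obtain ⟨k, hk⟩ := hδ
    obtain ⟨n, hn⟩ := hη
    simp only [hc, Prod.mk_add_mk, add_zero]
    refine avgPert_angleCongr h ⟨k, fun i => ?_⟩ ⟨n, fun i => ?_⟩
    · simp [hk]
    · simp [hn]
  rw [h1, ← fderiv_comp_add_right, h2.fderiv_eq]

theorem FRes_eq_mul_truncPert (hm₀ : 0 < m₀) (hm : ∀ i, 0 < m i) {μ : ℝ} (hμ : 0 < μ) {x : Coords}
    (hp : (μ, x.1, x.2.1, 0, x.2.2.2) ∈ separatedElements mod m₀ m) :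
    FRes mod m₀ m μ x = μ * truncPert mod m₀ m (μ, x.1, x.2.1, ecc x.1 x.2.2.1, x.2.2.2) := by
  have h1 : avgδ₃ (fun y => FPert mod m₀ m μ (ofElements mod m₀ m μ y)) =
      fun y => μ * avgPert mod m₀ m (μ, y) := by
    ext y
    simp only [avgδ₃, avgPert, FPert_eq_mul_hamPert hμ, intervalIntegral.integral_const_mul]
    ring
  have hd := ((contDiffAt_avgPert hm₀ hm hp).differentiableAt (by simp)).hasFDerivAt
  have hι : HasFDerivAt (fun e : Fin 3 → ℝ => ((μ, x.1, x.2.1, e, x.2.2.2) : ℝ × Coords))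
      ((0 : (Fin 3 → ℝ) →L[ℝ] ℝ).prod ((0 : (Fin 3 → ℝ) →L[ℝ] (Fin 3 → ℝ)).prod
        ((0 : (Fin 3 → ℝ) →L[ℝ] (Fin 3 → ℝ)).prod ((ContinuousLinearMap.id ℝ (Fin 3 → ℝ)).prod
          (0 : (Fin 3 → ℝ) →L[ℝ] (Fin 3 → ℝ)))))) 0 :=
    (hasFDerivAt_const _ _).prodMk ((hasFDerivAt_const _ _).prodMk ((hasFDerivAt_const _ _).prodMk
      ((hasFDerivAt_id _).prodMk (hasFDerivAt_const _ _))))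
  have h2 := ((hd.comp (0 : Fin 3 → ℝ) hι).const_mul μ).fderiv
  rw [FRes, h1, truncEcc, truncPert, mul_add]
  congr 1
  exact congrArg (fun ℓ => ℓ (ecc x.1 x.2.2.1)) h2

theorem avgδ₃_FRes (μ : ℝ) (x : Coords) :
    avgδ₃ (FRes mod m₀ m μ) x = FRes mod m₀ m μ x := by
  have h1 : ∀ t, FRes mod m₀ m μ (x.1, Function.update x.2.1 2 t, x.2.2) = FRes mod m₀ m μ x := by
    intro t
    simp [FRes, truncEcc, avgδ₃]
  simp only [avgδ₃, h1, intervalIntegral.integral_const]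
  have := Real.pi_pos
  rw [smul_eq_mul]
  field_simp
  ring

/-- The elements `(D, δ, e, η)` of a point in modified Delaunay coordinates. -/
def elements (x : Coords) : Coords := (x.1, x.2.1, ecc x.1 x.2.2.1, x.2.2.2)

theorem sq_ecc {x : Coords} (hx : x ∈ delaunayDomain) (i : Fin 3) :
    0 < 1 - (angMom x.2.2.1 i / circMom x.1 i) ^ 2 ∧
      ecc x.1 x.2.2.1 i ^ 2 = 1 - (angMom x.2.2.1 i / circMom x.1 i) ^ 2 := by
  obtain ⟨h1, h2⟩ := hx i
  have hL := h1.trans h2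
  have h3 : (angMom x.2.2.1 i / circMom x.1 i) ^ 2 < 1 := by
    rw [sq_lt_one_iff₀ (by positivity), div_lt_one hL]
    exact h2
  exact ⟨sub_pos.2 h3, Real.sq_sqrt (sub_nonneg.2 h3.le)⟩

theorem ecc_lt_one {x : Coords} (hx : x ∈ delaunayDomain) (i : Fin 3) :
    ecc x.1 x.2.2.1 i < 1 := by
  obtain ⟨h1, h2⟩ := hx i
  have hL := h1.trans h2
  rw [ecc, Real.sqrt_lt' one_pos]
  have : 0 < (angMom x.2.2.1 i / circMom x.1 i) ^ 2 := by positivity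
  linarith

theorem circMom_pos {x : Coords} (hx : x ∈ delaunayDomain) (i : Fin 3) : 0 < circMom x.1 i :=
  (hx i).1.trans (hx i).2

theorem contDiffAt_elements {x : Coords} (hx : x ∈ delaunayDomain) :
    ContDiffAt ℝ ω elements x := by
  have he : ContDiffAt ℝ ω (fun x : Coords => ecc x.1 x.2.2.1) x := by
    refine contDiffAt_pi.2 fun i => ?_
    have h1 : ContDiffAt ℝ ω (fun x : Coords => circMom x.1 i) x :=
      contDiffAt_circMom contDiffAt_fst i
    have h2 : ContDiffAt ℝ ω (fun x : Coords => angMom x.2.2.1 i) x :=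
      contDiffAt_angMom (by fun_prop) i
    exact (contDiffAt_const.sub ((h2.div h1 (circMom_pos hx i).ne').pow 2)).sqrt
      (sq_ecc hx i).1.ne'
  exact ContDiffAt.prodMk (by fun_prop) (ContDiffAt.prodMk (by fun_prop)
    (he.prodMk (by fun_prop)))

theorem ellipticRegion.mem_separatedElements (hm₀ : 0 < m₀) (hm : ∀ i, 0 < m i) {μ E : ℝ}
    (hμ : 0 < μ) (hE₁ : E < 1) {x : Coords} (hx : x ∈ ellipticRegion mod m₀ m μ E) :
    (μ, elements x) ∈ separatedElements mod m₀ m ∧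
      (μ, x.1, x.2.1, 0, x.2.2.2) ∈ separatedElements mod m₀ m := by
  obtain ⟨hd, he, hs⟩ := hx
  refine ⟨hs.mem_separatedElements hE₁ (add_mul_pos hm₀ hm hμ.le) (circMom_pos hd) fun i => ?_,
    hs.mem_separatedElements hE₁ (add_mul_pos hm₀ hm hμ.le) (circMom_pos hd) fun i => ?_⟩
  · rw [abs_of_nonneg (ecc_nonneg _ _ i)]
    exact (he i).le
  · simpa using (ecc_nonneg _ _ i).trans (he i).le

theorem contDiffAt_ofDelaunay (hm₀ : 0 < m₀) (hm : ∀ i, 0 < m i) {μ E : ℝ}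
    (hμ : 0 < μ) (hE₁ : E < 1) {x : Coords} (hx : x ∈ ellipticRegion mod m₀ m μ E) :
    ContDiffAt ℝ ω (ofDelaunay mod m₀ m μ) x := by
  have h1 : ContDiffAt ℝ ω (fun x => (μ, elements x)) x :=
    contDiffAt_const.prodMk (contDiffAt_elements hx.1)
  have h2 := ContDiffAt.fun_comp (g := ofElementsParam mod m₀ m) x
    (separatedElements.contDiffAt_ofElementsParam hm₀ hm
      (ellipticRegion.mem_separatedElements hm₀ hm hμ hE₁ hx).1) h1
  exact h2.snd

theorem contDiffAt_FRes (hm₀ : 0 < m₀) (hm : ∀ i, 0 < m i) {μ E : ℝ}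
    (hμ : 0 < μ) (hE₁ : E < 1) {x : Coords} (hx : x ∈ ellipticRegion mod m₀ m μ E) :
    ContDiffAt ℝ ω (FRes mod m₀ m μ) x := by
  have hp := (ellipticRegion.mem_separatedElements hm₀ hm hμ hE₁ hx).2
  have h1 : ContDiffAt ℝ ω (fun x => (μ, elements x)) x :=
    contDiffAt_const.prodMk (contDiffAt_elements hx.1)
  have h2 := ContDiffAt.fun_comp (g := truncPert mod m₀ m) (f := fun x => (μ, elements x)) x
    (contDiffAt_truncPert hm₀ hm hp) h1
  have h3 : ContDiffAt ℝ ω (fun x => μ * truncPert mod m₀ m (μ, elements x)) x :=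
    contDiffAt_const.mul h2
  refine h3.congr_of_eventuallyEq ?_
  have h4 : Continuous fun x : Coords => ((μ, x.1, x.2.1, 0, x.2.2.2) : ℝ × Coords) := by fun_prop
  filter_upwards [h4.continuousAt.preimage_mem_nhds
    ((isOpen_separatedElements hm₀ hm).mem_nhds hp)] with x' hx'
  exact FRes_eq_mul_truncPert hm₀ hm hμ hx'

/-- Uniform remainder of the truncation in the eccentricities near the resonant tori. -/
theorem exists_abs_avgPert_sub_truncPert_le (hm₀ : 0 < m₀) (hm : ∀ i, 0 < m i) {D : Fin 3 → ℝ}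
    {E : ℝ} (hE₀ : 0 < E) (hE₁ : E < 1) (hD : ∀ i, 0 < circMom D i)
    (hsep : Separated E (semiMajor mod m₀ m 0 D)) :
    ∃ C ≥ 0, ∃ ε > 0, ∀ μ : ℝ, |μ| < ε → ∀ D', ‖D' - D‖ < ε → ∀ b ∈ elementsBox 0 E,
      |avgPert mod m₀ m (μ, D', b) - truncPert mod m₀ m (μ, D', b)| ≤ C * ‖b.2.1‖ ^ 2 := by
  obtain ⟨G, hG, hGs, hGe⟩ := exists_contDiff_hasCompactSupport_eventuallyEq
    (isCompact_resonantBox D 0 E) (g := avgPert mod m₀ m) fun p hp =>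
      contDiffAt_avgPert hm₀ hm
        (resonantBox_subset_separatedElements hm₀ le_rfl hE₁ hD hsep hp)
  obtain ⟨C, hC, -, hT⟩ := exists_taylor_bound hG hGs
  obtain ⟨V, hVo, hSV, hVU⟩ := mem_nhdsSet_iff_exists.1 hGe
  obtain ⟨ε, hε, h⟩ := exists_forall_mem_of_mem_nhdsSet (hVo.mem_nhdsSet.2 hSV)
  refine ⟨C, hC, ε, hε, fun μ hμ D' hD' b hb => ?_⟩
  obtain ⟨δ, e, η⟩ := b
  have h1 := h μ hμ D' hD' _ hb
  have h0 := h μ hμ D' hD' (δ, 0, η) ⟨hb.1, ⟨le_rfl, fun i => hE₀.le⟩, hb.2.2⟩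
  have hfd : G =ᶠ[𝓝 (μ, D', δ, 0, η)] avgPert mod m₀ m := by
    filter_upwards [hVo.mem_nhds h0] with p hp using hVU hp
  have hT' := hT (μ, D', δ, 0, η) (0, 0, 0, e, 0)
  have hv : ‖((0, 0, 0, e, 0) : ℝ × Coords)‖ = ‖e‖ := by simp [Prod.norm_def]
  rw [hv, hfd.fderiv_eq, hVU h0] at hT'
  simp only [Prod.mk_add_mk, add_zero, zero_add] at hT'
  rw [hVU h1, sub_sub] at hT'
  exact hT'

end AveragedPerturbation

/-! ### The averaging transformation -/

section AveragingStep

variable {mod : Model} {m₀ : ℝ} {m : Fin 3 → ℝ}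

theorem phaseDeriv_congr {H H' : ℝ × PhaseSpace → ℝ} {w : ℝ × PhaseSpace} (h : H =ᶠ[𝓝 w] H') :
    phaseDeriv H w = phaseDeriv H' w := by
  rw [phaseDeriv, phaseDeriv, h.fderiv_eq]

theorem norm_phaseDeriv_le (H : ℝ × PhaseSpace → ℝ) (w : ℝ × PhaseSpace) :
    ‖phaseDeriv H w‖ ≤ ‖fderiv ℝ H w‖ := by
  refine ContinuousLinearMap.opNorm_le_bound _ (norm_nonneg _) fun v => ?_
  rw [phaseDeriv_apply]
  refine (ContinuousLinearMap.le_opNorm _ _).trans_eq ?_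
  simp [Prod.norm_def]

/-- The cohomological equation in phase space. -/
theorem phaseDeriv_averagingHam_keplerField (hm₀ : 0 < m₀) (hm : ∀ i, 0 < m i) {μ : ℝ} {y : Coords}
    (hp : (μ, y) ∈ separatedElements mod m₀ m) :
    phaseDeriv (averagingHam mod m₀ m) (ofElementsParam mod m₀ m (μ, y))
      (keplerField mod m₀ m (fun i => resonance i / meanMotion mod m₀ m μ y.1 i)
        (ofElementsParam mod m₀ m (μ, y))) =
      hamPert mod m₀ m (ofElements mod m₀ m μ y) - avgPert mod m₀ m (μ, y) := by
  have h1 := ((contDiffAt_averagingHam hm₀ hm hp).differentiableAt (by simp)).hasFDerivAt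
  have h2 := (hasDerivAt_const (0 : ℝ) μ).prodMk (hasDerivAt_ofElements_advance hm₀ hm hp)
  have h0 : ofElementsParam mod m₀ m (μ, y) = (μ, ofElements mod m₀ m μ (advance 0 y)) := by
    rw [advance_zero]; rfl
  nth_rewrite 2 [h0] at h1
  have h3 := HasFDerivAt.comp_hasDerivAt (0 : ℝ) h1 h2
  exact h3.unique (hasDerivAt_averagingHam_advance hm₀ hm hp)

theorem norm_keplerField_le {d : Fin 3 → ℝ} {B : ℝ} (hB : 0 ≤ B) (hd : ∀ i, |d i| ≤ B)
    (w : ℝ × PhaseSpace) :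
    ‖keplerField mod m₀ m d w‖ ≤ B * ‖keplerField mod m₀ m (fun _ => 1) w‖ := by
  have h : ∀ {u : Fin 3 → Plane} {v : Fin 3 → Plane} (_ : ∀ i, u i = d i • v i),
      ‖u‖ ≤ B * ‖v‖ := by
    intro u v h
    refine (pi_norm_le_iff_of_nonneg (by positivity)).2 fun i => ?_
    rw [h, norm_smul, Real.norm_eq_abs]
    gcongr
    · exact hd i
    · exact norm_le_pi_norm v i
  rw [norm_prod_le_iff]
  constructor
  · refine (h (v := (keplerField mod m₀ m (fun _ => 1) w).1) fun i => ?_).trans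
      (by gcongr; exact norm_fst_le _)
    simp [keplerField]
  · refine (h (v := (keplerField mod m₀ m (fun _ => 1) w).2) fun i => ?_).trans
      (by gcongr; exact norm_snd_le _)
    simp [keplerField]

theorem keplerField_one_eq (ν : ℝ) (c : Fin 3 → ℝ) (w : ℝ × PhaseSpace) :
    keplerField mod m₀ m (fun _ => 1) w =
      ν • keplerField mod m₀ m c w + keplerField mod m₀ m (fun i => 1 - ν * c i) w := by
  ext i a
  · simp [keplerField]; ring
  · simp [keplerField]; ring

/-- A neighbourhood of the resonant tori at `μ = 0` contains the points of the domain for small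
`μ`, together with balls of a fixed radius. -/
theorem exists_forall_mem_of_mem_resonantNhd {ν C₁ E : ℝ} {D₀ : ℝ → Fin 3 → ℝ} (hm₀ : 0 < m₀)
    (hm : ∀ i, 0 < m i) (hν : 0 < ν) (hE₁ : E < 1)
    (hD₀ : ∀ μ, 0 ≤ μ → IsResonant mod m₀ m μ ν (D₀ μ))
    (hsep : Separated E (semiMajor mod m₀ m 0 (D₀ 0))) {W : Set (ℝ × PhaseSpace)} (hWo : IsOpen W)
    (hW : ofElementsParam mod m₀ m '' resonantBox (D₀ 0) 0 E ⊆ W) :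
    ∃ ρ > 0, ∀ᶠ μ in 𝓝[>] (0 : ℝ), ∀ x ∈ resonantNhd mod m₀ m μ E (D₀ μ) (C₁ * μ),
      ∀ w, ‖w - ofDelaunay mod m₀ m μ x‖ < ρ → (μ, w) ∈ W := by
  have hS := resonantBox_subset_separatedElements (e₀ := 0) hm₀ le_rfl hE₁ (hD₀ 0 le_rfl).1 hsep
  have hc : ∀ p ∈ resonantBox (D₀ 0) 0 E, ContinuousAt (ofElementsParam mod m₀ m) p := fun p hp =>
    (separatedElements.contDiffAt_ofElementsParam hm₀ hm (hS hp)).continuousAt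
  have hK : IsCompact (ofElementsParam mod m₀ m '' resonantBox (D₀ 0) 0 E) :=
    (isCompact_resonantBox _ _ _).image_of_continuousOn
      fun p hp => (hc p hp).continuousWithinAt
  obtain ⟨ρ, hρ, hρW⟩ := hK.exists_thickening_subset_open hWo hW
  have hU : ofElementsParam mod m₀ m ⁻¹' (Metric.thickening (ρ / 2)
      (ofElementsParam mod m₀ m '' resonantBox (D₀ 0) 0 E)) ∈ 𝓝ˢ (resonantBox (D₀ 0) 0 E) := by
    refine mem_nhdsSet_iff_forall.2 fun p hp => (hc p hp).preimage_mem_nhds ?_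
    exact Metric.isOpen_thickening.mem_nhds
      (Metric.self_subset_thickening (by positivity) _ (mem_image_of_mem _ hp))
  obtain ⟨ε, hε, h⟩ := exists_forall_mem_of_mem_nhdsSet hU
  refine ⟨ρ / 2, by positivity, ?_⟩
  filter_upwards [exists_elements_of_mem_resonantNhd (C₁ := C₁) (E := E) hm₀ hm hν hD₀ hε]
    with μ hμ x hx w hw
  obtain ⟨hx1, hx2⟩ := hμ.2 x hx
  obtain ⟨δ, η, hδ, hη, hb⟩ := hx2 0 fun i => ecc_nonneg _ _ i
  have h1 := h μ hμ.1 x.1 hx1 _ hb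
  have h2 : ofElementsParam mod m₀ m (μ, x.1, δ, ecc x.1 x.2.2.1, η) =
      (μ, ofDelaunay mod m₀ m μ x) := by
    rw [ofElementsParam, ofElements_angleCongr (fun i => ?_) hδ hη]
    · rfl
    · rw [abs_of_nonneg (ecc_nonneg _ _ i)]
      exact ecc_lt_one hx.1.1 i
  rw [mem_preimage, h2, Metric.mem_thickening_iff] at h1
  obtain ⟨k, hk, hk'⟩ := h1
  refine hρW (Metric.mem_thickening_iff.2 ⟨k, hk, ?_⟩)
  have h3 := dist_triangle (μ, w) (μ, ofDelaunay mod m₀ m μ x) k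
  have h4 : dist (μ, w) (μ, ofDelaunay mod m₀ m μ x) = ‖w - ofDelaunay mod m₀ m μ x‖ := by
    rw [Prod.dist_eq, dist_self, max_eq_right dist_nonneg, dist_eq_norm]
  linarith

/-- The averaging transformation: the midpoint map of `μ H / ν`, where `H` coincides with
`averagingHam` near the resonant tori and has compact support. -/
theorem exists_averaging_step {ν C₁ E : ℝ} {D₀ : ℝ → Fin 3 → ℝ} (hm₀ : 0 < m₀)
    (hm : ∀ i, 0 < m i) (hν : 0 < ν) (hE₀ : 0 < E) (hE₁ : E < 1) (hC₁ : 0 < C₁)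
    (hD₀ : ∀ μ, 0 ≤ μ → IsResonant mod m₀ m μ ν (D₀ μ))
    (hsep : Separated E (semiMajor mod m₀ m 0 (D₀ 0))) :
    ∃ μ₀ > 0, ∃ C > 0, ∃ φ : ℝ → PhaseSpace → PhaseSpace, ∀ μ, 0 < μ → μ < μ₀ →
      Function.Injective (φ μ) ∧
      (∀ z v w, symplecticForm (fderiv ℝ (φ μ) z v) (fderiv ℝ (φ μ) z w) = symplecticForm v w) ∧
      (∀ z, ‖φ μ z - z‖ ≤ C * μ) ∧
      ∀ x ∈ resonantNhd mod m₀ m μ E (D₀ μ) (C₁ * μ),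
        ofDelaunay mod m₀ m μ x ∈ collisionFree ∧
        φ μ (ofDelaunay mod m₀ m μ x) ∈ collisionFree ∧
        ContDiffAt ℝ ω (φ μ) (ofDelaunay mod m₀ m μ x) ∧
        |FTotal mod m₀ m μ (φ μ (ofDelaunay mod m₀ m μ x)) -
            FKep mod m₀ m μ (ofDelaunay mod m₀ m μ x) - FRes mod m₀ m μ x| ≤
          C * (μ * ‖ecc x.1 x.2.2.1‖ ^ 2 + μ ^ 2) := by
  have hDpos := (hD₀ 0 le_rfl).1
  have hS := resonantBox_subset_separatedElements (e₀ := 0) hm₀ le_rfl hE₁ hDpos hsep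
  set k := ofElementsParam mod m₀ m '' resonantBox (D₀ 0) 0 E with hk
  have hkc : IsCompact k := (isCompact_resonantBox _ _ _).image_of_continuousOn fun p hp =>
    (separatedElements.contDiffAt_ofElementsParam hm₀ hm (hS hp)).continuousAt.continuousWithinAt
  have hav : ∀ w ∈ k, ContDiffAt ℝ ω (averagingHam mod m₀ m) w := by
    rintro w ⟨⟨μ, y⟩, hp, rfl⟩
    exact contDiffAt_averagingHam hm₀ hm (hS hp)
  have hcf : ∀ w ∈ k, w.2 ∈ collisionFree ∧ ∀ i, 0 < m₀ + w.1 * m i := by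
    rintro w ⟨⟨μ, y⟩, hp, rfl⟩
    exact ⟨separatedElements.collisionFree hm₀ hm (hS hp), (hS hp).1⟩
  -- `G`, `K`, `f` replace `averagingHam` and the two parts of the Hamiltonian outside the open
  -- set `W`, which contains the points at distance less than `ρ` from the domain.
  obtain ⟨G, hG, hGs, hGe⟩ := exists_contDiff_hasCompactSupport_eventuallyEq hkc hav
  obtain ⟨K, hK, hKs, hKe⟩ := exists_contDiff_hasCompactSupport_eventuallyEq hkc
    (g := keplerHam mod m₀ m) fun w hw => contDiffAt_keplerHam hm₀ hm (hcf w hw).2 (hcf w hw).1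
  obtain ⟨f, hf, hfs, hfe⟩ := exists_contDiff_hasCompactSupport_eventuallyEq hkc
    (g := fun w : ℝ × PhaseSpace => hamPert mod m₀ m w.2) fun w hw =>
      ContDiffAt.fun_comp w (contDiffAt_hamPert (hcf w hw).1) contDiffAt_snd
  have hcfe : ∀ᶠ w in 𝓝ˢ k, w.2 ∈ collisionFree := eventually_nhdsSet_iff_forall.2 fun w hw =>
    continuousAt_snd.preimage_mem_nhds (isOpen_collisionFree.mem_nhds (hcf w hw).1)
  have have' : ∀ᶠ w in 𝓝ˢ k, ContDiffAt ℝ ω (averagingHam mod m₀ m) w :=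
    eventually_nhdsSet_iff_forall.2 fun w hw => (hav w hw).eventually (by simp)
  obtain ⟨W, hWo, hkW, hW⟩ := mem_nhdsSet_iff_exists.1
    (hGe.and (hKe.and (hfe.and (hcfe.and have'))))
  obtain ⟨ρ, hρ, hev⟩ := exists_forall_mem_of_mem_resonantNhd (C₁ := C₁) hm₀ hm hν hE₁ hD₀ hsep
    hWo hkW
  have hHc : ContDiff ℝ ∞ (fun w => ν⁻¹ * G w) := contDiff_const.mul hG
  have hHs : HasCompactSupport (fun w => ν⁻¹ * G w) := hGs.mul_left
  obtain ⟨C, hC, μ₁, hμ₁, φ, hφ⟩ := exists_symplectic_step hHc hHs hK hKs hf hfs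
  obtain ⟨CH, hCH, hCH', -⟩ := exists_taylor_bound hHc hHs
  obtain ⟨CK, hCK, hCK', -⟩ := exists_taylor_bound hK hKs
  obtain ⟨Cr, hCr, hratio⟩ := exists_abs_meanMotion_ratio_le hm₀ hm hν hC₁ hD₀
  obtain ⟨Ct, hCt, ε, hε, htrunc⟩ := exists_abs_avgPert_sub_truncPert_le hm₀ hm hE₀ hE₁ hDpos hsep
  have hsmall : ∀ᶠ μ in 𝓝[>] (0 : ℝ), C * μ < ρ := by
    have h : ContinuousAt (fun μ : ℝ => C * μ) 0 := by fun_prop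
    exact nhdsWithin_le_nhds (h.eventually_lt continuousAt_const (by simpa using hρ))
  obtain ⟨μ₂, hμ₂, hall⟩ := mem_nhdsGT_iff_exists_Ioo_subset.1
    (hev.and (hratio.and (hsmall.and
      (exists_elements_of_mem_resonantNhd (C₁ := C₁) (E := E) hm₀ hm hν hD₀ hε))))
  set C' := C + CH * (Cr * (‖hamVector‖ * CK)) + Ct with hC'
  have hC'pos : 0 < C' := by positivity
  refine ⟨min μ₁ μ₂, lt_min hμ₁ hμ₂, C', hC'pos, φ, fun μ hμ hμlt => ?_⟩
  obtain ⟨hinj, hsymp, han, hclose, hest⟩ := hφ μ hμ (hμlt.trans_le (min_le_left _ _))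
  obtain ⟨hball, hrat, hCρ, hμε, helem⟩ := hall ⟨hμ, hμlt.trans_le (min_le_right _ _)⟩
  have hCC' : C ≤ C' := by
    have h1 : 0 ≤ CH * (Cr * (‖hamVector‖ * CK)) := by positivity
    linarith
  refine ⟨hinj, hsymp, fun z => (hclose z).trans (by gcongr), fun x hx => ?_⟩
  set z := ofDelaunay mod m₀ m μ x with hz
  have hmem : ∀ w, ‖w - z‖ ≤ C * μ → (μ, w) ∈ W := fun w hw => hball x hx w (hw.trans_lt hCρ)
  have hzW : (μ, z) ∈ W := hmem z (by simpa using (mul_pos hC hμ).le)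
  have hφW : (μ, φ μ z) ∈ W := hmem _ (hclose z)
  have hsepx := (ellipticRegion.mem_separatedElements hm₀ hm hμ hE₁ hx.1)
  refine ⟨(hW hzW).2.2.2.1, (hW hφW).2.2.2.1, han z fun w hw => ?_, ?_⟩
  · have hwW := hmem w hw
    have h1 : ContDiffAt ℝ ω (fun w => ν⁻¹ * averagingHam mod m₀ m w) (μ, w) :=
      contDiffAt_const.mul (hW hwW).2.2.2.2
    refine h1.congr_of_eventuallyEq ?_
    filter_upwards [hWo.mem_nhds hwW] with w' hw'
    rw [(hW hw').1]
  · -- `K ∘ φ + μ (f ∘ φ)` is compared with `K + μ ⟨f⟩`, then `⟨f⟩` with its truncation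
    have hKz : K =ᶠ[𝓝 (μ, z)] keplerHam mod m₀ m := by
      filter_upwards [hWo.mem_nhds hzW] with w hw using (hW hw).2.1
    have hGz : G =ᶠ[𝓝 (μ, z)] averagingHam mod m₀ m := by
      filter_upwards [hWo.mem_nhds hzW] with w hw using (hW hw).1
    set c : Fin 3 → ℝ := fun i => resonance i / meanMotion mod m₀ m μ x.1 i with hc
    have hX : hamVector (phaseDeriv K (μ, z)) = keplerField mod m₀ m (fun _ => 1) (μ, z) := by
      rw [phaseDeriv_congr hKz]
      exact hamVector_phaseDeriv_keplerHam hm₀ hm (add_mul_pos hm₀ hm hμ.le) (hW hzW).2.2.2.1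
    have hHG : phaseDeriv (fun w => ν⁻¹ * G w) (μ, z) = ν⁻¹ • phaseDeriv G (μ, z) := by
      rw [phaseDeriv, phaseDeriv, fderiv_const_mul ((hG.differentiable (by simp)) _)]
      rfl
    have hmain : phaseDeriv G (μ, z) (keplerField mod m₀ m c (μ, z)) =
        hamPert mod m₀ m z - avgPert mod m₀ m (μ, elements x) := by
      rw [phaseDeriv_congr hGz]
      exact phaseDeriv_averagingHam_keplerField hm₀ hm hsepx.1
    -- The Keplerian field is `ν` times the generator of the resonant circle action, up to a
    -- remainder of order `μ` due to the detuning of the frequencies.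
    have hdecomp : phaseDeriv (fun w => ν⁻¹ * G w) (μ, z) (hamVector (phaseDeriv K (μ, z))) =
        hamPert mod m₀ m z - avgPert mod m₀ m (μ, elements x) +
        phaseDeriv (fun w => ν⁻¹ * G w) (μ, z)
          (keplerField mod m₀ m (fun i => 1 - ν * c i) (μ, z)) := by
      rw [hX, keplerField_one_eq ν c, map_add, map_smul, hHG]
      simp only [smul_apply, smul_eq_mul, hmain]
      field_simp
    have hrem : |phaseDeriv (fun w => ν⁻¹ * G w) (μ, z)
        (keplerField mod m₀ m (fun i => 1 - ν * c i) (μ, z))| ≤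
        CH * (Cr * (‖hamVector‖ * CK)) * μ := by
      have h1 := (phaseDeriv (fun w => ν⁻¹ * G w) (μ, z)).le_opNorm
        (keplerField mod m₀ m (fun i => 1 - ν * c i) (μ, z))
      have h2 := (norm_phaseDeriv_le (fun w => ν⁻¹ * G w) (μ, z)).trans (hCH' _)
      have h3 := norm_keplerField_le (mod := mod) (m₀ := m₀) (m := m) (by positivity)
        (hrat x.1 hx.2) (μ, z)
      have h4 : ‖keplerField mod m₀ m (fun _ => 1) (μ, z)‖ ≤ ‖hamVector‖ * CK := by
        rw [← hX]
        refine (hamVector.le_opNorm _).trans ?_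
        gcongr
        exact (norm_phaseDeriv_le K (μ, z)).trans (hCK' _)
      rw [Real.norm_eq_abs] at h1
      calc _ ≤ _ := h1
        _ ≤ CH * (Cr * μ * (‖hamVector‖ * CK)) := by
          gcongr
          exact h3.trans (by gcongr)
        _ = _ := by ring
    have htr : |avgPert mod m₀ m (μ, elements x) - truncPert mod m₀ m (μ, elements x)| ≤
        Ct * ‖ecc x.1 x.2.2.1‖ ^ 2 := by
      obtain ⟨hx1, hx2⟩ := helem x hx
      obtain ⟨δ, η, hδ, hη, hb⟩ := hx2 0 fun i => ecc_nonneg _ _ i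
      have h1 := htrunc μ hμε x.1 hx1 _ hb
      rwa [avgPert_angleCongr (fun i => ?_) hδ hη, truncPert_angleCongr hδ hη] at h1
      rw [abs_of_nonneg (ecc_nonneg _ _ i)]
      exact ecc_lt_one hx.1.1 i
    have h1 := hest z
    rw [(hW hφW).2.1, (hW hφW).2.2.1, (hW hzW).2.1, (hW hzW).2.2.1, hdecomp] at h1
    rw [FTotal, FKep_eq_keplerHam hm₀ hm hμ, FKep_eq_keplerHam hm₀ hm hμ, FPert_eq_mul_hamPert hμ,
      FRes_eq_mul_truncPert hm₀ hm hμ hsepx.2]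
    change |_ - _ - μ * truncPert mod m₀ m (μ, elements x)| ≤ _
    dsimp only at h1
    set r := phaseDeriv (fun w => ν⁻¹ * G w) (μ, z)
      (keplerField mod m₀ m (fun i => 1 - ν * c i) (μ, z))
    have hsplit : keplerHam mod m₀ m (μ, φ μ z) + μ * hamPert mod m₀ m (φ μ z) -
        keplerHam mod m₀ m (μ, z) - μ * truncPert mod m₀ m (μ, elements x) =
        (keplerHam mod m₀ m (μ, φ μ z) + μ * hamPert mod m₀ m (φ μ z) -
          keplerHam mod m₀ m (μ, z) - μ * hamPert mod m₀ m z +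
          μ * (hamPert mod m₀ m z - avgPert mod m₀ m (μ, elements x) + r)) +
        (μ * (avgPert mod m₀ m (μ, elements x) - truncPert mod m₀ m (μ, elements x)) -
          μ * r) := by ring
    rw [hsplit]
    have h2 : |μ * (avgPert mod m₀ m (μ, elements x) - truncPert mod m₀ m (μ, elements x)) -
        μ * r| ≤ μ * (Ct * ‖ecc x.1 x.2.2.1‖ ^ 2) + μ * (CH * (Cr * (‖hamVector‖ * CK)) * μ) := by
      refine (abs_sub _ _).trans ?_
      rw [abs_mul, abs_mul, abs_of_pos hμ]
      gcongr
    refine (abs_add_le _ _).trans ((add_le_add h1 h2).trans ?_)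
    have h3 : 0 ≤ μ * ‖ecc x.1 x.2.2.1‖ ^ 2 := by positivity
    have h4 : 0 ≤ CH * (Cr * (‖hamVector‖ * CK)) := by positivity
    rw [hC']
    nlinarith [mul_nonneg h3 hC.le, mul_nonneg h3 h4, mul_nonneg hCt (sq_nonneg μ)]

end AveragingStep

/-! ### Local inverses near compact sets -/

section LocalInverse

/-- The inverse function theorem with constants that are uniform near a compact set; the
displacement of the preimage is measured by means of a map `T`. -/
theorem exists_uniform_local_inverse {E F G : Type*} [NormedAddCommGroup E] [NormedSpace ℝ E]
    [CompleteSpace E] [NormedAddCommGroup F] [NormedSpace ℝ F] [NormedAddCommGroup G]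
    [NormedSpace ℝ G] {Φ : E → F} {T : E → G} {s O : Set E} (hs : IsCompact s)
    (hΦ : ∀ p ∈ s, ∃ Φ' : E ≃L[ℝ] F, HasStrictFDerivAt Φ (Φ' : E →L[ℝ] F) p)
    (hT : ∀ p ∈ s, ∃ T' : E →L[ℝ] G, HasStrictFDerivAt T T' p) (hO : IsOpen O) (hsO : s ⊆ O) :
    ∃ U, IsOpen U ∧ s ⊆ U ∧ ∃ K ≥ 0, ∃ r > 0, ∀ p ∈ U, ∀ w, ‖w - Φ p‖ < r →
      ∃ p' ∈ O, Φ p' = w ∧ ‖T p' - T p‖ ≤ K * ‖w - Φ p‖ := by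
  refine hs.induction_on (p := fun s => ∃ U, IsOpen U ∧ s ⊆ U ∧ ∃ K ≥ 0, ∃ r > 0, ∀ p ∈ U, ∀ w,
      ‖w - Φ p‖ < r → ∃ p' ∈ O, Φ p' = w ∧ ‖T p' - T p‖ ≤ K * ‖w - Φ p‖)
    ⟨∅, isOpen_empty, empty_subset _, 0, le_rfl, 1, one_pos, by simp⟩ ?_ ?_ ?_
  · rintro s t hst ⟨U, hUo, hU, h⟩
    exact ⟨U, hUo, hst.trans hU, h⟩
  · rintro s t ⟨U, hUo, hU, K, hK, r, hr, h⟩ ⟨U', hUo', hU', K', hK', r', hr', h'⟩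
    refine ⟨U ∪ U', hUo.union hUo', union_subset_union hU hU', max K K', le_max_of_le_left hK,
      min r r', lt_min hr hr', ?_⟩
    rintro p (hp | hp) w hw
    · obtain ⟨p', h1, h2, h3⟩ := h p hp w (hw.trans_le (min_le_left _ _))
      exact ⟨p', h1, h2, h3.trans (by gcongr; exact le_max_left _ _)⟩
    · obtain ⟨p', h1, h2, h3⟩ := h' p hp w (hw.trans_le (min_le_right _ _))
      exact ⟨p', h1, h2, h3.trans (by gcongr; exact le_max_right _ _)⟩
  · intro p₀ hp₀
    obtain ⟨Φ', hΦ'⟩ := hΦ p₀ hp₀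
    obtain ⟨T', hT'⟩ := hT p₀ hp₀
    set g := hΦ'.localInverse Φ Φ' p₀ with hg
    have hg0 : g (Φ p₀) = p₀ := hΦ'.localInverse_apply_image
    have hgT : HasStrictFDerivAt (fun w => T (g w)) _ (Φ p₀) :=
      HasStrictFDerivAt.comp (g := T) (f := g) (Φ p₀) (by rw [hg0]; exact hT')
        hΦ'.to_localInverse
    obtain ⟨K, t, ht, hK⟩ := hgT.exists_lipschitzOnWith
    have hcont : ContinuousAt g (Φ p₀) := hΦ'.localInverse_continuousAt
    have h1 : ∀ᶠ w in 𝓝 (Φ p₀), w ∈ t ∧ Φ (g w) = w ∧ g w ∈ O := by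
      refine (eventually_mem_set.2 ht).and (hΦ'.eventually_right_inverse.and ?_)
      exact hcont.preimage_mem_nhds (by rw [hg0]; exact hO.mem_nhds (hsO hp₀))
    obtain ⟨r, hr, hball⟩ := Metric.mem_nhds_iff.1 h1
    have h2 : ∀ᶠ p in 𝓝 p₀, g (Φ p) = p ∧ Φ p ∈ Metric.ball (Φ p₀) (r / 2) :=
      hΦ'.eventually_left_inverse.and
        (hΦ'.continuousAt.preimage_mem_nhds (Metric.ball_mem_nhds _ (by positivity)))
    obtain ⟨U, hU, hUo, hpU⟩ := mem_nhds_iff.1 h2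
    refine ⟨U, mem_nhdsWithin_of_mem_nhds (hUo.mem_nhds hpU), U, hUo, subset_rfl, K, K.2, r / 2,
      by positivity, fun p hp w hw => ?_⟩
    obtain ⟨h3, h4⟩ := hU hp
    have hw' : w ∈ Metric.ball (Φ p₀) r := by
      rw [Metric.mem_ball] at h4 ⊢
      have := dist_triangle w (Φ p) (Φ p₀)
      rw [dist_eq_norm w (Φ p)] at this
      linarith
    obtain ⟨h5, h6, h7⟩ := hball hw'
    obtain ⟨h8, -, -⟩ := hball (Metric.ball_subset_ball (by linarith) h4)
    refine ⟨g w, h7, h6, ?_⟩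
    have := hK.dist_le_mul _ h5 _ h8
    rwa [dist_eq_norm, dist_eq_norm, h3] at this

end LocalInverse

/-! ### Elements as local coordinates at non-circular motions -/

section Immersion

theorem polar_deriv_eq_zero {r θ : ℝ → ℝ} {r' θ' t : ℝ} (hr : HasDerivAt r r' t)
    (hθ : HasDerivAt θ θ' t) (h0 : r t ≠ 0)
    (hc : HasDerivAt (fun s => r s * Real.cos (θ s)) 0 t)
    (hs : HasDerivAt (fun s => r s * Real.sin (θ s)) 0 t) : r' = 0 ∧ θ' = 0 := by
  have h1 := (hr.mul hθ.cos).unique hc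
  have h2 := (hr.mul hθ.sin).unique hs
  have h3 := Real.sin_sq_add_cos_sq (θ t)
  have h4 : r' = 0 := by
    linear_combination Real.cos (θ t) * h1 + Real.sin (θ t) * h2 - r' * h3
  have h5 : r t * θ' = 0 := by
    linear_combination Real.cos (θ t) * h2 - Real.sin (θ t) * h1 - r t * θ' * h3
  exact ⟨h4, (mul_eq_zero.1 h5).resolve_left h0⟩

/-- A curve of elements of non-circular ellipses along which position and velocity are stationary
is stationary. -/
theorem ellipse_deriv_eq_zero {M : ℝ} {a e l g : ℝ → ℝ} {a' e' l' g' t : ℝ} (hM : 0 < M)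
    (ha : HasDerivAt a a' t) (he : HasDerivAt e e' t) (hl : HasDerivAt l l' t)
    (hg : HasDerivAt g g' t) (ha0 : 0 < a t) (he0 : 0 < e t) (he1 : e t < 1)
    (hq : HasDerivAt (fun s => ellipsePos (a s) (e s) (l s) (g s)) 0 t)
    (hv : HasDerivAt (fun s => ellipseVel M (a s) (e s) (l s) (g s)) 0 t) :
    a' = 0 ∧ e' = 0 ∧ l' = 0 ∧ g' = 0 := by
  have heabs : |e t| < 1 := by rwa [abs_of_pos he0]
  have hev : ∀ᶠ s in 𝓝 t, 0 < a s ∧ |e s| < 1 :=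
    (continuousAt_const.eventually_lt ha.continuousAt ha0).and
      (he.continuousAt.abs.eventually_lt continuousAt_const heabs)
  set u : ℝ → ℝ := fun s => eccentricAnomaly (e s) (l s) with hu
  have hpos := one_sub_mul_cos_pos heabs (u t)
  have hrt := norm_ellipsePos ha0 heabs (l t) (g t)
  have hr0 : 0 < ‖ellipsePos (a t) (e t) (l t) (g t)‖ := by rw [hrt]; positivity
  have hr : HasDerivAt (fun s => ‖ellipsePos (a s) (e s) (l s) (g s)‖) 0 t := by
    have h := hq.norm_sq.sqrt (by positivity)
    simpa using h
  have hv2 : HasDerivAt (fun s => ‖ellipseVel M (a s) (e s) (l s) (g s)‖ ^ 2) 0 t := by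
    simpa using hv.norm_sq
  have hqv : HasDerivAt (fun s => (inner ℝ (ellipsePos (a s) (e s) (l s) (g s))
      (ellipseVel M (a s) (e s) (l s) (g s)) : ℝ)) 0 t := by
    simpa using hq.inner ℝ hv
  -- energy
  have ha' : a' = 0 := by
    have h1 : HasDerivAt (fun s => 2 / ‖ellipsePos (a s) (e s) (l s) (g s)‖ -
        ‖ellipseVel M (a s) (e s) (l s) (g s)‖ ^ 2 / M) 0 t := by
      simpa using ((hasDerivAt_const t (2 : ℝ)).fun_div hr hr0.ne').fun_sub (hv2.div_const M)
    have h2 : HasDerivAt (fun s => (a s)⁻¹) 0 t := by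
      refine h1.congr_of_eventuallyEq ?_
      filter_upwards [hev] with s hs
      exact (semiMajor_ellipse hs.1 hM hs.2 (l s) (g s)).symm
    have h3 := (ha.inv ha0.ne').unique h2
    simpa [ha0.ne'] using h3
  subst ha'
  obtain ⟨u', hu'⟩ : ∃ u', HasDerivAt u u' t := by
    have h1 := (contDiffAt_eccentricAnomaly (p := (e t, l t)) heabs).differentiableAt
      (by simp)
    have h2 := HasFDerivAt.comp_hasDerivAt t h1.hasFDerivAt (he.prodMk hl)
    exact ⟨_, h2⟩
  -- `e cos u` and `e sin u` are functions of `a`, `‖q‖` and `q · v`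
  have hcos : HasDerivAt (fun s => e s * Real.cos (u s)) 0 t := by
    have h1 : HasDerivAt (fun s => 1 - ‖ellipsePos (a s) (e s) (l s) (g s)‖ / a s) 0 t := by
      simpa using (hr.fun_div ha ha0.ne').const_sub 1
    refine h1.congr_of_eventuallyEq ?_
    filter_upwards [hev] with s hs
    rw [norm_ellipsePos hs.1 hs.2]
    have := hs.1.ne'
    field_simp
    ring
  have hsin : HasDerivAt (fun s => e s * Real.sin (u s)) 0 t := by
    have h0 : HasDerivAt (fun s => a s * Real.sqrt (M / a s)) 0 t := by
      have h2 : HasDerivAt (fun s => M / a s) 0 t := by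
        simpa using (hasDerivAt_const t M).fun_div ha ha0.ne'
      have h3 := ha.fun_mul (h2.sqrt (by positivity))
      simpa using h3
    have h1 : HasDerivAt (fun s => (inner ℝ (ellipsePos (a s) (e s) (l s) (g s))
        (ellipseVel M (a s) (e s) (l s) (g s)) : ℝ) / (a s * Real.sqrt (M / a s))) 0 t := by
      simpa using hqv.fun_div h0 (by positivity)
    refine h1.congr_of_eventuallyEq ?_
    filter_upwards [hev] with s hs
    rw [inner_ellipsePos_ellipseVel hs.2]
    have h2 : 0 < a s * Real.sqrt (M / a s) := mul_pos hs.1 (Real.sqrt_pos.2 (div_pos hM hs.1))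
    rw [mul_div_cancel_left₀ _ h2.ne']
  obtain ⟨he', hu0⟩ := polar_deriv_eq_zero he hu' he0.ne' hcos hsin
  subst he' hu0
  -- Kepler's equation
  have hl' : l' = 0 := by
    have h1 : HasDerivAt l 0 t := by
      have h2 : HasDerivAt (fun s => u s - e s * Real.sin (u s)) 0 t := by
        simpa using hu'.fun_sub hsin
      refine h2.congr_of_eventuallyEq ?_
      filter_upwards [hev] with s hs
      exact (eccentricAnomaly_spec hs.2 (l s)).symm
    exact hl.unique h1
  refine ⟨rfl, rfl, hl', ?_⟩
  -- The position relative to the axes of the ellipse is stationary, hence so are the axes.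
  have hx : HasDerivAt (fun s => a s * (Real.cos (u s) - e s)) 0 t := by
    simpa using ha.fun_mul (hu'.cos.fun_sub he)
  have hy : HasDerivAt (fun s => a s * (Real.sqrt (1 - e s ^ 2) * Real.sin (u s))) 0 t := by
    have h1 : HasDerivAt (fun s => Real.sqrt (1 - e s ^ 2)) 0 t := by
      have h2 : HasDerivAt (fun s => 1 - e s ^ 2) 0 t := by
        simpa using (he.fun_pow 2).const_sub 1
      simpa using h2.sqrt (sub_pos.2 (sq_lt_one_of_abs heabs)).ne'
    simpa using ha.fun_mul (h1.fun_mul hu'.sin)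
  have hn := norm_rotated_sq (g t) (a t * (Real.cos (u t) - e t))
    (a t * (Real.sqrt (1 - e t ^ 2) * Real.sin (u t)))
  change ‖ellipsePos (a t) (e t) (l t) (g t)‖ ^ 2 = _ at hn
  have h0 : HasDerivAt (fun s => Real.cos (g s) * (a s * (Real.cos (u s) - e s)) -
      Real.sin (g s) * (a s * (Real.sqrt (1 - e s ^ 2) * Real.sin (u s)))) 0 t := by
    have := (EuclideanSpace.proj (0 : Fin 2) : Plane →L[ℝ] ℝ).hasFDerivAt.comp_hasDerivAt t hq
    rw [map_zero] at this
    exact this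
  have h1 : HasDerivAt (fun s => Real.sin (g s) * (a s * (Real.cos (u s) - e s)) +
      Real.cos (g s) * (a s * (Real.sqrt (1 - e s ^ 2) * Real.sin (u s)))) 0 t := by
    have := (EuclideanSpace.proj (1 : Fin 2) : Plane →L[ℝ] ℝ).hasFDerivAt.comp_hasDerivAt t hq
    rw [map_zero] at this
    exact this
  have h2 := ((hg.cos.mul hx).sub (hg.sin.mul hy)).unique h0
  have h3 := ((hg.sin.mul hx).add (hg.cos.mul hy)).unique h1
  set X := a t * (Real.cos (u t) - e t)
  set Y := a t * (Real.sqrt (1 - e t ^ 2) * Real.sin (u t))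
  have h4 : g' * (X ^ 2 + Y ^ 2) = 0 := by
    linear_combination (Real.cos (g t) * X - Real.sin (g t) * Y) * h3 -
      (Real.sin (g t) * X + Real.cos (g t) * Y) * h2 -
      g' * (X ^ 2 + Y ^ 2) * Real.sin_sq_add_cos_sq (g t)
  have h5 : 0 < X ^ 2 + Y ^ 2 := hn ▸ (by positivity)
  exact (mul_eq_zero.1 h4).resolve_right h5.ne'

variable {mod : Model} {m₀ : ℝ} {m : Fin 3 → ℝ}

theorem circMom_add_smul (D D' : Fin 3 → ℝ) (s : ℝ) (i : Fin 3) :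
    circMom (D + s • D') i = circMom D i + s * circMom D' i := by
  fin_cases i <;> simp [circMom] <;> ring

theorem meanAnom_add_smul (D D' : Fin 3 → ℝ) (s : ℝ) (i : Fin 3) :
    meanAnom (D + s • D') i = meanAnom D i + s * meanAnom D' i := by
  fin_cases i <;> simp [meanAnom] <;> ring

theorem argPeri_add_smul (D D' : Fin 3 → ℝ) (s : ℝ) (i : Fin 3) :
    argPeri (D + s • D') i = argPeri D i + s * argPeri D' i := by
  fin_cases i <;> simp [argPeri] <;> ring

theorem eq_zero_of_circMom {D : Fin 3 → ℝ} (h : ∀ i, circMom D i = 0) : D = 0 := by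
  have h0 := h 0
  have h1 := h 1
  have h2 := h 2
  simp [circMom] at h0 h1 h2
  ext i
  fin_cases i <;> simp <;> linarith

theorem eq_zero_of_meanAnom {δ : Fin 3 → ℝ} (h : ∀ i, meanAnom δ i = 0) : δ = 0 := by
  have h0 := h 0
  have h1 := h 1
  have h2 := h 2
  simp [meanAnom] at h0 h1 h2
  ext i
  fin_cases i <;> simp <;> linarith

theorem eq_zero_of_argPeri {η : Fin 3 → ℝ} (h : ∀ i, argPeri η i = 0) : η = 0 := by
  have h0 := h 0
  have h1 := h 1
  have h2 := h 2
  simp [argPeri] at h0 h1 h2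
  ext i
  fin_cases i <;> simp <;> linarith

/-- At non-circular motions, the elements are local coordinates in phase space. -/
theorem exists_equiv_hasStrictFDerivAt_ofElementsParam (hm₀ : 0 < m₀) (hm : ∀ i, 0 < m i)
    {p : ℝ × Coords} (hp : p ∈ separatedElements mod m₀ m) (he : ∀ i, 0 < p.2.2.2.1 i) :
    ∃ A : (ℝ × Coords) ≃L[ℝ] (ℝ × PhaseSpace),
      HasStrictFDerivAt (ofElementsParam mod m₀ m) (A : (ℝ × Coords) →L[ℝ] (ℝ × PhaseSpace)) p := by
  have hd := (separatedElements.contDiffAt_ofElementsParam hm₀ hm hp).hasStrictFDerivAt (by simp)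
  set A := fderiv ℝ (ofElementsParam mod m₀ m) p with hA
  have hinj : Function.Injective (A : (ℝ × Coords) →ₗ[ℝ] (ℝ × PhaseSpace)) := by
    rw [injective_iff_map_eq_zero]
    rintro ⟨τ, dD, dδ, de, dη⟩ hv
    obtain ⟨μ, D, δ, e, η⟩ := p
    obtain ⟨h1, h2, h3, -, -⟩ := hp
    dsimp only at h1 h2 h3 he
    have hfst : HasFDerivAt (fun p : ℝ × Coords => p.1) (ContinuousLinearMap.fst ℝ ℝ Coords)
      (μ, D, δ, e, η) := hasFDerivAt_fst
    have hτ : τ = 0 := by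
      have h4 : HasFDerivAt (fun p : ℝ × Coords => p.1) _ (μ, D, δ, e, η) :=
        hd.hasFDerivAt.fst
      have h5 := congrArg (fun ℓ => ℓ (τ, dD, dδ, de, dη)) (h4.unique hfst)
      have h6 : (A (τ, dD, dδ, de, dη)).1 = τ := h5
      rw [← h6]
      exact congrArg Prod.fst hv
    subst hτ
    have hγ : HasDerivAt (fun s : ℝ => ((μ, D + s • dD, δ + s • dδ, e + s • de, η + s • dη) :
        ℝ × Coords)) (0, dD, dδ, de, dη) 0 := by
      have h4 : ∀ a b : Fin 3 → ℝ, HasDerivAt (fun s : ℝ => a + s • b) b 0 := fun a b => by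
        simpa using ((hasDerivAt_id (0 : ℝ)).smul_const b).const_add a
      exact (hasDerivAt_const _ _).prodMk ((h4 _ _).prodMk ((h4 _ _).prodMk
        ((h4 _ _).prodMk (h4 _ _))))
    have hd0 : HasFDerivAt (ofElementsParam mod m₀ m) A
        (μ, D + (0 : ℝ) • dD, δ + (0 : ℝ) • dδ, e + (0 : ℝ) • de, η + (0 : ℝ) • dη) := by
      simpa using hd.hasFDerivAt
    have hcurve : HasDerivAt (fun s : ℝ => ofElementsParam mod m₀ m
        (μ, D + s • dD, δ + s • dδ, e + s • de, η + s • dη)) 0 0 := by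
      have h4 := HasFDerivAt.comp_hasDerivAt (0 : ℝ) hd0 hγ
      rwa [show A (0, dD, dδ, de, dη) = 0 from hv] at h4
    have hz : HasDerivAt (fun s : ℝ => ofElements mod m₀ m μ
        (D + s • dD, δ + s • dδ, e + s • de, η + s • dη)) 0 0 := by
      have h4 := (ContinuousLinearMap.snd ℝ ℝ PhaseSpace).hasFDerivAt.comp_hasDerivAt (0 : ℝ) hcurve
      rw [map_zero] at h4
      exact h4
    have hlin : ∀ a b : ℝ, HasDerivAt (fun s : ℝ => a + s * b) b 0 := fun a b => by
      simpa using ((hasDerivAt_id (0 : ℝ)).mul_const b).const_add a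
    have hi : ∀ i, circMom dD i = 0 ∧ de i = 0 ∧ meanAnom dδ i = 0 ∧ argPeri dη i = 0 := by
      intro i
      have hβ := fictMass_pos (mod := mod) hm₀ hm (h1 i)
      have hM := centMass_pos (mod := mod) hm₀ (h1 i)
      have ha := semiMajor_pos (mod := mod) hm₀ hm (h1 i) (h2 i)
      have hz1 : HasDerivAt (fun s : ℝ => (ofElements mod m₀ m μ
          (D + s • dD, δ + s • dδ, e + s • de, η + s • dη)).1) 0 0 := by
        have h4 := (ContinuousLinearMap.fst ℝ (Fin 3 → Plane) (Fin 3 → Plane)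
          ).hasFDerivAt.comp_hasDerivAt (0 : ℝ) hz
        rw [map_zero] at h4
        exact h4
      have hz2 : HasDerivAt (fun s : ℝ => (ofElements mod m₀ m μ
          (D + s • dD, δ + s • dδ, e + s • de, η + s • dη)).2) 0 0 := by
        have h4 := (ContinuousLinearMap.snd ℝ (Fin 3 → Plane) (Fin 3 → Plane)
          ).hasFDerivAt.comp_hasDerivAt (0 : ℝ) hz
        rw [map_zero] at h4
        exact h4
      have hq := hasDerivAt_pi.1 hz1 i
      have hp := (hasDerivAt_pi.1 hz2 i).fun_const_smul (fictMass mod m₀ m μ i)⁻¹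
      simp only [ofElements, inv_smul_smul₀ hβ.ne', meanAnom_add_smul,
        argPeri_add_smul] at hq hp
      have hL : HasDerivAt (fun s : ℝ => semiMajor mod m₀ m μ (D + s • dD) i)
          (2 * (circMom D i / fictMass mod m₀ m μ i) * (circMom dD i / fictMass mod m₀ m μ i) /
            centMass mod m₀ m μ i) 0 := by
        simp only [semiMajor, circMom_add_smul]
        simpa using ((((hlin (circMom D i) (circMom dD i)).div_const
          (fictMass mod m₀ m μ i)).fun_pow 2).div_const (centMass mod m₀ m μ i))
      obtain ⟨r1, r2, r3, r4⟩ := ellipse_deriv_eq_zero hM hL (hlin (e i) (de i))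
        (hlin (meanAnom δ i) (meanAnom dδ i)) (hlin (argPeri η i) (argPeri dη i))
        (by simpa using ha) (by simpa using he i) (by simpa using (abs_lt.1 (h3 i)).2)
        (by simpa using hq) (by simpa using hp)
      refine ⟨?_, r2, r3, r4⟩
      have h5 := (h2 i).ne'
      simpa [hβ.ne', hM.ne', h5] using r1
    rw [eq_zero_of_circMom fun i => (hi i).1, eq_zero_of_meanAnom fun i => (hi i).2.2.1,
      eq_zero_of_argPeri fun i => (hi i).2.2.2, show de = 0 from funext fun i => (hi i).2.1]
    rfl
  have hrank : Module.finrank ℝ (ℝ × Coords) = Module.finrank ℝ (ℝ × PhaseSpace) := by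
    simp [Module.finrank_prod, Module.finrank_pi_fintype]
  refine ⟨(LinearMap.linearEquivOfInjective _ hinj hrank).toContinuousLinearEquiv, ?_⟩
  have : (((LinearMap.linearEquivOfInjective (A : (ℝ × Coords) →ₗ[ℝ] (ℝ × PhaseSpace)) hinj
      hrank).toContinuousLinearEquiv : (ℝ × Coords) ≃L[ℝ] (ℝ × PhaseSpace)) :
        (ℝ × Coords) →L[ℝ] (ℝ × PhaseSpace)) = A := by
    ext v <;> simp
  rw [this]
  exact hd

end Immersion

/-! ### The averaging transformation in Delaunay coordinates -/

section CloseCoordinates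

variable {mod : Model} {m₀ : ℝ} {m : Fin 3 → ℝ}

/-- The modified Delaunay coordinates of given elements `(D, δ, e, η)`, from
`G_i = L_i √(1 - e_i²)`. -/
def toDelaunay (y : Coords) : Coords :=
  (y.1, y.2.1,
    ![circMom y.1 0 * Real.sqrt (1 - y.2.2.1 0 ^ 2),
      circMom y.1 0 * Real.sqrt (1 - y.2.2.1 0 ^ 2) + circMom y.1 1 * Real.sqrt (1 - y.2.2.1 1 ^ 2),
      circMom y.1 0 * Real.sqrt (1 - y.2.2.1 0 ^ 2) +
        circMom y.1 1 * Real.sqrt (1 - y.2.2.1 1 ^ 2) +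
        circMom y.1 2 * Real.sqrt (1 - y.2.2.1 2 ^ 2)],
    y.2.2.2)

theorem angMom_toDelaunay (y : Coords) (i : Fin 3) :
    angMom (toDelaunay y).2.2.1 i = circMom y.1 i * Real.sqrt (1 - y.2.2.1 i ^ 2) := by
  fin_cases i <;> simp [angMom, toDelaunay]

theorem contDiffAt_toDelaunay {y : Coords} (he : ∀ i, |y.2.2.1 i| < 1) :
    ContDiffAt ℝ ω toDelaunay y := by
  have h : ∀ i, ContDiffAt ℝ ω
      (fun y : Coords => circMom y.1 i * Real.sqrt (1 - y.2.2.1 i ^ 2)) y := fun i => by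
    have h1 : ContDiffAt ℝ ω (fun y : Coords => circMom y.1 i) y :=
      contDiffAt_circMom contDiffAt_fst i
    have h2 : ContDiffAt ℝ ω (fun y : Coords => 1 - y.2.2.1 i ^ 2) y := by fun_prop
    exact h1.mul (h2.sqrt (sub_pos.2 (sq_lt_one_of_abs (he i))).ne')
  refine ContDiffAt.prodMk (by fun_prop) (ContDiffAt.prodMk (by fun_prop)
    (ContDiffAt.prodMk (contDiffAt_pi.2 fun i => ?_) (by fun_prop)))
  fin_cases i
  · exact h 0
  · exact (h 0).add (h 1)
  · exact ((h 0).add (h 1)).add (h 2)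

theorem toDelaunay_mem_delaunayDomain {y : Coords} (hD : ∀ i, 0 < circMom y.1 i)
    (he : ∀ i, 0 < y.2.2.1 i) (he1 : ∀ i, y.2.2.1 i < 1) : toDelaunay y ∈ delaunayDomain := by
  intro i
  have h1 : 0 < 1 - y.2.2.1 i ^ 2 :=
    sub_pos.2 (sq_lt_one_of_abs (by rw [abs_of_pos (he i)]; exact he1 i))
  rw [angMom_toDelaunay]
  refine ⟨mul_pos (hD i) (Real.sqrt_pos.2 h1), mul_lt_of_lt_one_right (hD i) ?_⟩
  rw [Real.sqrt_lt' one_pos]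
  have := pow_pos (he i) 2
  linarith

theorem elements_toDelaunay {y : Coords} (hD : ∀ i, 0 < circMom y.1 i)
    (he : ∀ i, 0 < y.2.2.1 i) (he1 : ∀ i, y.2.2.1 i < 1) : elements (toDelaunay y) = y := by
  have h : ecc y.1 (toDelaunay y).2.2.1 = y.2.2.1 := by
    ext i
    have h1 : 0 < 1 - y.2.2.1 i ^ 2 :=
      sub_pos.2 (sq_lt_one_of_abs (by rw [abs_of_pos (he i)]; exact he1 i))
    rw [ecc, angMom_toDelaunay, mul_div_cancel_left₀ _ (hD i).ne', Real.sq_sqrt h1.le,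
      sub_sub_cancel, Real.sqrt_sq (he i).le]
  exact Prod.ext rfl (Prod.ext rfl (Prod.ext h rfl))

theorem toDelaunay_elements {x : Coords} (hx : x ∈ delaunayDomain) :
    toDelaunay (elements x) = x := by
  have h : ∀ i, circMom x.1 i * Real.sqrt (1 - ecc x.1 x.2.2.1 i ^ 2) = angMom x.2.2.1 i := by
    intro i
    have hL := circMom_pos hx i
    rw [(sq_ecc hx i).2, sub_sub_cancel, Real.sqrt_sq (div_nonneg (hx i).1.le hL.le)]
    field_simp
  refine Prod.ext rfl (Prod.ext rfl (Prod.ext ?_ rfl))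
  simp only [toDelaunay, elements, h]
  ext i
  fin_cases i <;> simp [angMom]

/-- Away from circular motions, a displacement of order `μ` in phase space is a displacement of
order `μ` of the modified Delaunay coordinates. -/
theorem exists_delaunay_close {ν C₁ E C μ₀ e₀ : ℝ} {D₀ : ℝ → Fin 3 → ℝ}
    {φ : ℝ → PhaseSpace → PhaseSpace} (hm₀ : 0 < m₀)
    (hm : ∀ i, 0 < m i) (hν : 0 < ν) (hE₁ : E < 1) (he₀ : 0 < e₀)
    (hD₀ : ∀ μ, 0 ≤ μ → IsResonant mod m₀ m μ ν (D₀ μ))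
    (hsep : Separated E (semiMajor mod m₀ m 0 (D₀ 0))) (hC : 0 < C) (hμ₀ : 0 < μ₀)
    (hφ : ∀ μ, 0 < μ → μ < μ₀ → ∀ z, ‖φ μ z - z‖ ≤ C * μ) :
    ∃ μ₁ > 0, ∃ C' > 0, ∀ μ, 0 < μ → μ < μ₁ →
      ∀ x ∈ resonantNhd mod m₀ m μ E (D₀ μ) (C₁ * μ), (∀ i, e₀ ≤ ecc x.1 x.2.2.1 i) →
        ∃ x' ∈ delaunayDomain,
          φ μ (ofDelaunay mod m₀ m μ x) = ofDelaunay mod m₀ m μ x' ∧ ‖x' - x‖ ≤ C' * μ := by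
  have hS := resonantBox_subset_separatedElements (e₀ := e₀) hm₀ he₀.le hE₁ (hD₀ 0 le_rfl).1 hsep
  have hpos : ∀ p ∈ resonantBox (D₀ 0) e₀ E, ∀ i, 0 < p.2.2.2.1 i := fun p hp i =>
    he₀.trans_le (hp.2.2.2.1.1 i)
  have hOo : IsOpen (separatedElements mod m₀ m ∩ {p | ∀ i, 0 < p.2.2.2.1 i}) := by
    refine (isOpen_separatedElements hm₀ hm).inter ?_
    simp only [ofPred_forall]
    exact isOpen_iInter_of_finite fun i => isOpen_lt (by fun_prop) (by fun_prop)
  obtain ⟨U, hUo, hSU, K, hK, r, hr, hU⟩ := exists_uniform_local_inverse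
    (Φ := ofElementsParam mod m₀ m) (T := fun p : ℝ × Coords => toDelaunay p.2)
    (isCompact_resonantBox (D₀ 0) e₀ E)
    (fun p hp => exists_equiv_hasStrictFDerivAt_ofElementsParam hm₀ hm (hS hp) (hpos p hp))
    (fun p hp => by
      have h1 : ContDiffAt ℝ ω (fun p : ℝ × Coords => toDelaunay p.2) p :=
        ContDiffAt.fun_comp p (contDiffAt_toDelaunay (hS hp).2.2.1) contDiffAt_snd
      exact ⟨_, h1.hasStrictFDerivAt (by simp)⟩)
    hOo (fun p hp => ⟨hS hp, hpos p hp⟩)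
  obtain ⟨ε, hε, hbox⟩ := exists_forall_mem_of_mem_nhdsSet (hUo.mem_nhdsSet.2 hSU)
  have hsmall : ∀ᶠ μ in 𝓝[>] (0 : ℝ), C * μ < r := by
    have h : ContinuousAt (fun μ : ℝ => C * μ) 0 := by fun_prop
    exact nhdsWithin_le_nhds (h.eventually_lt continuousAt_const (by simpa using hr))
  obtain ⟨μ₂, hμ₂, hall⟩ := mem_nhdsGT_iff_exists_Ioo_subset.1
    (hsmall.and (exists_elements_of_mem_resonantNhd (C₁ := C₁) (E := E) hm₀ hm hν hD₀ hε))
  refine ⟨min μ₀ μ₂, lt_min hμ₀ hμ₂, K * C + 1, by positivity, fun μ hμ hμlt x hx hex => ?_⟩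
  obtain ⟨hCr, hμε, helem⟩ := hall ⟨hμ, hμlt.trans_le (min_le_right _ _)⟩
  obtain ⟨hx1, hx2⟩ := helem x hx
  obtain ⟨δ, η, hδ, hη, hb⟩ := hx2 e₀ hex
  have hpU := hbox μ hμε x.1 hx1 _ hb
  set z := ofDelaunay mod m₀ m μ x with hz
  have hΦ : ofElementsParam mod m₀ m (μ, x.1, δ, ecc x.1 x.2.2.1, η) = (μ, z) := by
    rw [ofElementsParam, ofElements_angleCongr (fun i => ?_) hδ hη]
    · rfl
    · rw [abs_of_nonneg (ecc_nonneg _ _ i)]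
      exact ecc_lt_one hx.1.1 i
  have hdist : ‖(μ, φ μ z) - (μ, z)‖ ≤ C * μ := by
    have h1 := hφ μ hμ (hμlt.trans_le (min_le_left _ _)) z
    rw [Prod.mk_sub_mk, sub_self, Prod.norm_mk, norm_zero, max_eq_right (norm_nonneg _)]
    exact h1
  obtain ⟨⟨μ', D', δ', e', η'⟩, ⟨hsep', he'⟩, hΦ', hT⟩ := hU _ hpU (μ, φ μ z)
    (by rw [hΦ]; exact hdist.trans_lt hCr)
  obtain rfl : μ' = μ := congrArg Prod.fst hΦ'
  have hΦ'' : ofElements mod m₀ m μ' (D', δ', e', η') = φ μ' z := congrArg Prod.snd hΦ'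
  have hD' : ∀ i, 0 < circMom D' i := hsep'.2.1
  have he1 : ∀ i, e' i < 1 := fun i => (abs_lt.1 (hsep'.2.2.1 i)).2
  -- the angles are shifted back by multiples of `2π`
  set y : Coords := (D', δ' + (x.2.1 - δ), e', η' + (x.2.2.2 - η)) with hy
  refine ⟨toDelaunay y, toDelaunay_mem_delaunayDomain hD' he' he1, ?_, ?_⟩
  · change _ = ofElements mod m₀ m μ' (elements (toDelaunay y))
    rw [elements_toDelaunay (y := y) hD' he' he1, ← hΦ'']
    obtain ⟨k, hk⟩ := hδ
    obtain ⟨n, hn⟩ := hη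
    refine ofElements_angleCongr hsep'.2.2.1 ⟨-k, fun i => ?_⟩ ⟨-n, fun i => ?_⟩ |>.symm
    · simp [hk]
    · simp [hn]
  · have h1 : toDelaunay y - x = toDelaunay (D', δ', e', η') -
        toDelaunay (x.1, δ, ecc x.1 x.2.2.1, η) := by
      nth_rewrite 1 [← toDelaunay_elements hx.1.1]
      simp only [toDelaunay, elements, hy, Prod.mk_sub_mk]
      refine Prod.ext rfl (Prod.ext ?_ (Prod.ext rfl ?_))
      · change δ' + (x.2.1 - δ) - x.2.1 = δ' - δ
        abel
      · change η' + (x.2.2.2 - η) - x.2.2.2 = η' - η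
        abel
    rw [h1]
    refine hT.trans ?_
    rw [hΦ]
    calc _ ≤ K * (C * μ') := by gcongr
      _ ≤ _ := by nlinarith

end CloseCoordinates

end SatelliteProblem

end

theorem mainTheorem8 (mod : Model) (m₀ : ℝ) (m : Fin 3 → ℝ) (ν E C₁ : ℝ) (D₀ : ℝ → Fin 3 → ℝ)
    (hm₀ : 0 < m₀) (hm : ∀ i, 0 < m i) (hν : 0 < ν) (hE₀ : 0 < E) (hE₁ : E < 1) (hC₁ : 0 < C₁)
    (hD₀ : ∀ μ, 0 ≤ μ → IsResonant mod m₀ m μ ν (D₀ μ))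
    (hsep : Separated E (semiMajor mod m₀ m 0 (D₀ 0))) :
    ∃ μ₀ > 0, ∃ C > 0, ∃ φ : ℝ → PhaseSpace → PhaseSpace, ∃ FRem : ℝ → Coords → ℝ,
      (∀ μ, 0 < μ → μ < μ₀ →
        let N : Set Coords := resonantNhd mod m₀ m μ E (D₀ μ) (C₁ * μ)
        let P : Set PhaseSpace := ofDelaunay mod m₀ m μ '' N
        AnalyticOnNhd ℝ (φ μ) P ∧ InjOn (φ μ) P ∧ MapsTo (φ μ) P collisionFree ∧
        IsSymplecticOn (φ μ) P ∧
        (∀ z ∈ P, ‖φ μ z - z‖ ≤ C * μ) ∧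
        (∀ x ∈ N, FTotal mod m₀ m μ (φ μ (ofDelaunay mod m₀ m μ x)) =
          FKep mod m₀ m μ (ofDelaunay mod m₀ m μ x) + FRes mod m₀ m μ x + FRem μ x) ∧
        AnalyticOnNhd ℝ (FRes mod m₀ m μ) N ∧
        (∀ x ∈ N, avgδ₃ (FRes mod m₀ m μ) x = FRes mod m₀ m μ x) ∧
        AnalyticOnNhd ℝ (FRem μ) N ∧
        (∀ x ∈ N, |FRem μ x| ≤ C * (μ * ‖ecc x.1 x.2.2.1‖ ^ 2 + μ ^ 2))) ∧
      (∀ e₀ > 0, ∃ μ₁ > 0, ∃ C' > 0, ∀ μ, 0 < μ → μ < μ₁ →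
        ∀ x ∈ resonantNhd mod m₀ m μ E (D₀ μ) (C₁ * μ), (∀ i, e₀ ≤ ecc x.1 x.2.2.1 i) →
          ∃ x' ∈ delaunayDomain,
            φ μ (ofDelaunay mod m₀ m μ x) = ofDelaunay mod m₀ m μ x' ∧ ‖x' - x‖ ≤ C' * μ) := by
  obtain ⟨μ₀, hμ₀, C, hC, φ, hφ⟩ := exists_averaging_step hm₀ hm hν hE₀ hE₁ hC₁ hD₀ hsep
  refine ⟨μ₀, hμ₀, C, hC, φ, fun μ x => FTotal mod m₀ m μ (φ μ (ofDelaunay mod m₀ m μ x)) -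
    FKep mod m₀ m μ (ofDelaunay mod m₀ m μ x) - FRes mod m₀ m μ x, fun μ hμ hμlt => ?_,
    fun e₀ he₀ => exists_delaunay_close hm₀ hm hν hE₁ he₀ hD₀ hsep hC hμ₀
      fun μ hμ hμlt => (hφ μ hμ hμlt).2.2.1⟩
  obtain ⟨hinj, hsymp, hclose, hN⟩ := hφ μ hμ hμlt
  have hRes : ∀ x ∈ resonantNhd mod m₀ m μ E (D₀ μ) (C₁ * μ),
      ContDiffAt ℝ ⊤ (FRes mod m₀ m μ) x := fun x hx =>
    contDiffAt_FRes hm₀ hm hμ hE₁ hx.1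
  refine ⟨?_, hinj.injOn, ?_, fun z _ => hsymp z, fun z _ => hclose z, fun x _ => by ring,
    fun x hx => (hRes x hx).analyticAt, fun x _ => avgδ₃_FRes μ x, fun x hx => ?_,
    fun x hx => (hN x hx).2.2.2⟩
  · rintro _ ⟨x, hx, rfl⟩
    exact (hN x hx).2.2.1.analyticAt
  · rintro _ ⟨x, hx, rfl⟩
    exact (hN x hx).2.1
  · obtain ⟨hz, hφz, han, -⟩ := hN x hx
    have hof : ContDiffAt ℝ ⊤ (ofDelaunay mod m₀ m μ) x := contDiffAt_ofDelaunay hm₀ hm hμ hE₁ hx.1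
    have hKep : ∀ z ∈ collisionFree, ContDiffAt ℝ ⊤ (FKep mod m₀ m μ) z := fun z hz => by
      have h1 : ContDiffAt ℝ ⊤ (fun z => keplerHam mod m₀ m (μ, z)) z :=
        ContDiffAt.fun_comp z (contDiffAt_keplerHam hm₀ hm (add_mul_pos hm₀ hm hμ.le) hz)
          (contDiffAt_const.prodMk contDiffAt_id)
      exact h1.congr_of_eventuallyEq
        (Filter.Eventually.of_forall fun z => FKep_eq_keplerHam hm₀ hm hμ z)
    have hTot : ContDiffAt ℝ ⊤ (FTotal mod m₀ m μ) (φ μ (ofDelaunay mod m₀ m μ x)) := by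
      have h1 : ContDiffAt ℝ ⊤ (fun z => μ * hamPert mod m₀ m z) (φ μ (ofDelaunay mod m₀ m μ x)) :=
        contDiffAt_const.mul (contDiffAt_hamPert hφz)
      exact (hKep _ hφz).add (h1.congr_of_eventuallyEq
        (Filter.Eventually.of_forall fun z => FPert_eq_mul_hamPert hμ z))
    have h1 : ContDiffAt ℝ ⊤ (fun x => φ μ (ofDelaunay mod m₀ m μ x)) x :=
      ContDiffAt.fun_comp x han hof
    have h2 := ContDiffAt.fun_comp (g := FTotal mod m₀ m μ) x hTot h1
    have h3 := ContDiffAt.fun_comp (g := FKep mod m₀ m μ) x (hKep _ hz) hof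
    exact ((h2.sub h3).sub (hRes x hx)).analyticAt
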